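/- **Snake graphs.** A *tile* is a unit square of the grid $\mathbb Z^2$, regarded as a graph with 4 vertices and 4 edges (north, south, east, west). A *snake graph* $\mathcal G=(G_1,\dots,G_d)$, $d\ge 1$, is the union of a sequence of tiles in which $G_{i+1}$ is the northern or the eastern neighbour of $G_i$ for $1\le i<d$; $e_i$ is the edge shared by $G_i$ and $G_{i+1}$, and $\mathcal G[i,j]=(G_i,\dots,G_j)$. A graph with a single edge is called an *empty snake graph*. $\overline{\mathcal G}$ is the reflection of $\mathcal G$ in the line $y=-x$, with the order of the tiles reversed. A *sign function* on $\mathcal G$ is a map $f$ from its edges to $\{\pm1\}$ such that on every tile $f(\text{north})=f(\text{west})=-f(\text{south})=-f(\text{east})$. $\operatorname{Match}(G)$ is the set of perfect matchings of a graph $G$, and for a pair of graphs $\operatorname{Match}(G,G')=\operatorname{Match}(G)\sqcup\operatorname{Match}(G')$ (disjoint union of sets). For $\varepsilon=\pm1$ and an integer $n$ let $\mathcal G^{\le n}_{f,\varepsilon}$ be $\mathcal G[1,k]$ for the largest $k$ with $1\le k\le n$ and $f(e_k)=\varepsilon$, or, if there is none, the single edge $e_0$ of $G_1$ that is south or west and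 has sign $\varepsilon$; let $\mathcal G^{>n}_{f,\varepsilon}$ be $\mathcal G[k,d]$ for the least $k$ with $n<k\le d$ and $f(e_{k-1})=\varepsilon$, or, if there is none, the single edge $e_d$ of $G_d$ that is north or east and has sign $\varepsilon$. If $\mathcal A,\mathcal B$ are snake graphs, then *gluing $\mathcal B$ to the north (east) of $\mathcal A$* means translating $\mathcal B$ so that its first tile is the northern (eastern) neighbour of the last tile of $\mathcal A$; the edge shared by these two tiles is the gluing edge $a$. For sets $A$, $B$ of edges of $\mathcal A$, $\mathcal B$ let $A\sqcup B\setminus\{a\}$ be $A\cup B$ with $a$ removed unless $a\in A\cap B$. **Overlaps and crossings.** Let $\mathcal G_1=(G_1,\dots,G_d)$ and $\mathcal G_2=(G'_1,\dots,G'_{d'})$ be snake graphs. An *overlap* is a snake graph $\mathcal G=\mathcal G_1[s,t]=\mathcal G_2[s',t']$, where $\mathcal G_2$ has been moved by a translation, possibly combined with reflections in the lines $y=\pm x$, so that the two copies of $\mathcal G$ coincide, and which is not contained in a larger common sequence of tiles of the two snake graphs in this position. From now on $\mathcal G_2$ stands for this moved copy, and $f_1,f_2$ are the sign functions on $\mathcal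 G_1,\mathcal G_2$ that extend a sign function on $\mathcal G$. The snake graphs *cross in $\mathcal G$* if one of the following holds: $f_1(e_{s-1})=-f_1(e_t)$ with $s>1,\ t<d$; or $f_2(e'_{s'-1})=-f_2(e'_{t'})$ with $s'>1,\ t'<d'$; or $f_1(e_t)=f_2(e'_{s'-1})$ with $s=1,\ t<d,\ s'>1,\ t'=d'$; or $f_1(e_{s-1})=f_2(e'_{t'})$ with $s>1,\ t=d,\ s'=1,\ t'<d'$. **Resolution of a crossing.** If they cross, $\operatorname{Res}_{\mathcal G}(\mathcal G_1,\mathcal G_2)=(\mathcal G_3\sqcup\mathcal G_4,\ \mathcal G_5\sqcup\mathcal G_6)$, where * $\mathcal G_3=\mathcal G_1[1,t]\cup\mathcal G_2[t'+1,d']$ and $\mathcal G_4=\mathcal G_2[1,t']\cup\mathcal G_1[t+1,d]$, the adjacency of the two parts being that in $\mathcal G_2$, respectively in $\mathcal G_1$; * if $s,s'>1$, $\mathcal G_5$ is $\overline{\mathcal G_2[1,s'-1]}$ glued to the north of $\mathcal G_1[1,s-1]$ if $G_s$ is east of $G_{s-1}$, and to the east if $G_s$ is north of $G_{s-1}$;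 if $s'=1$, $\mathcal G_5=(\mathcal G_1)^{\le s-2}_{f_1,\varepsilon}$ with $\varepsilon=f_1(e_{s-1})$; if $s=1$, $\mathcal G_5=\overline{(\mathcal G_2)^{\le s'-2}_{f_2,\varepsilon}}$ with $\varepsilon=f_2(e'_{s'-1})$; * if $t<d$ and $t'<d'$, $\mathcal G_6$ is $\mathcal G_1[t+1,d]$ glued to the north of $\overline{\mathcal G_2[t'+1,d']}$ if $G_{t+1}$ is east of $G_t$, and to the east if $G_{t+1}$ is north of $G_t$; if $t=d$, $\mathcal G_6=\overline{(\mathcal G_2)^{>t'+1}_{f_2,\varepsilon}}$ with $\varepsilon=f_2(e'_{t'})$; if $t'=d'$, $\mathcal G_6=(\mathcal G_1)^{>t+1}_{f_1,\varepsilon}$ with $\varepsilon=f_1(e_t)$. If they do not cross in $\mathcal G$, then $\operatorname{Res}_{\mathcal G}(\mathcal G_1,\mathcal G_2)=\mathcal G_1\sqcup\mathcal G_2$. **Resolution of a grafting.** Let $\mathcal G_1,\mathcal G_2$ be snake graphs and $f_1$ a sign function on $\mathcal G_1$. * *Case $1\le s<d$.* Let $a$ be "east" if $G_{s+1}$ is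 north of $G_s$, and "north" if $G_{s+1}$ is east of $G_s$. Let $\delta_3$ be the edge of $G_s$ on the side $a$ and $\delta_3'$ the edge of $G_1'$ on the side opposite to $a$. Then $\mathcal G_3$ is $\mathcal G_2$ glued to the side $a$ of $\mathcal G_1[1,s]$; $\mathcal G_4=(\mathcal G_1)^{>s+1}_{f_1,\varepsilon}$ and $\mathcal G_5=(\mathcal G_1)^{\le s-1}_{f_1,\varepsilon}$ with $\varepsilon=-f_1(e_s)$; and $\mathcal G_6$ is $\mathcal G_1[s+1,d]$ glued to the side $a$ of $\overline{\mathcal G_2}$. * *Case $s=d$.* Choose $a\in\{\text{north},\text{east}\}$, let $\delta_3$ be the edge of $G_d$ on the side $a$, $\delta_3'$ the edge of $G'_1$ on the opposite side, and $f_2$ the sign function on $\mathcal G_2$ with $f_2(\delta_3')=f_1(\delta_3)=:\varepsilon$. Then $\mathcal G_3$ is $\mathcal G_2$ glued to the side $a$ of $\mathcal G_1$, $\mathcal G_4=\{\delta_3\}$, $\mathcal G_5=(\mathcal G_1)^{\le d-1}_{f_1,\varepsilon}$, and $\mathcal G_6=\overline{(\mathcal G_2)^{>1}_{f_2,\varepsilon}}$.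 In both cases $\operatorname{Graft}_{s,\delta_3}(\mathcal G_1,\mathcal G_2)=(\mathcal G_3\sqcup\mathcal G_4,\ \mathcal G_5\sqcup\mathcal G_6)$. **Theorem.** Let $\mathcal G_1,\mathcal G_2$ be two snake graphs. Write a perfect matching of $\mathcal G_1\sqcup\mathcal G_2$ as a pair $(P_1,P_2)$. (1) For every overlap $\mathcal G$ there is a bijection $$\varphi:\operatorname{Match}(\mathcal G_1\sqcup\mathcal G_2)\to\operatorname{Match}(\operatorname{Res}_{\mathcal G}(\mathcal G_1,\mathcal G_2)).$$ It is the identity if there is no crossing in $\mathcal G$. If there is a crossing, it is given by the following rule. Say that $(Q_3,Q_4)\in\operatorname{Match}(\mathcal G_3\sqcup\mathcal G_4)$ arises from $(P_1,P_2)$ by *switching at the tile* $G_j=G'_{j'}$ of $\mathcal G$ if, apart from the edges of this tile, $Q_3$ consists of the edges of $P_1$ in $\mathcal G_1[1,j-1]$ and the edges of $P_2$ in $\mathcal G_2[j'+1,d']$, while $Q_4$ consists of the edges of $P_2$ in $\mathcal G_2[1,j'-1]$ and the edges of $P_1$ in $\mathcal G_1[j+1,d]$; and each edge of the tile occurs in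 $(Q_3,Q_4)$ as often as in $(P_1,P_2)$. If $(P_1,P_2)$ can be switched at some tile of $\mathcal G$, then $\varphi(P_1,P_2)\in\operatorname{Match}(\mathcal G_3\sqcup\mathcal G_4)$ arises by switching at the first such tile. Otherwise $\varphi(P_1,P_2)\in\operatorname{Match}(\mathcal G_5\sqcup\mathcal G_6)$ is the restriction of $(P_1,P_2)$ to $\mathcal G_5$ and $\mathcal G_6$; where $\mathcal G_5$ (or $\mathcal G_6$) is glued from two parts with gluing edge $a$, this means $A\sqcup B\setminus\{a\}$ for the restrictions $A$, $B$ to the two parts. (2) For every $s$ with $1\le s\le d$ (and, if $s=d$, both choices of $a$) there is a bijection $$\varphi:\operatorname{Match}(\mathcal G_1\sqcup\mathcal G_2)\to\operatorname{Match}(\operatorname{Graft}_{s,\delta_3}(\mathcal G_1,\mathcal G_2)).$$ It maps $(P_1,P_2)$ to its restriction to $\mathcal G_3\sqcup\mathcal G_4$ if $\delta_3\in P_1$, or if $\delta_3'\in P_2$ and (for $s<d$) $e_s\in P_1$; and to its restriction to $\mathcal G_5\sqcup\mathcal G_6$ otherwise. Here restriction to a glued graph with gluing edge $a$ again means $A\sqcup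 B\setminus\{a\}$, and the matching on $\mathcal G_4=\{\delta_3\}$ (case $s=d$) is $\{\delta_3\}$. -/

import Mathlib

namespace SnakeCalculus

/-! ### Graphs and perfect matchings -/

/-- Perfect matchings of a graph: sets `P` of edges such that each vertex is incident to exactly one
edge in `P`. All graphs below are finite graphs without isolated vertices that are drawn on an
infinite set of points, so their vertices are the points of `G.support`. -/
def perfectMatchings {V : Type*} (G : SimpleGraph V) : Set (Set (Sym2 V)) :=
  {P | P ⊆ G.edgeSet ∧ ∀ v ∈ G.support, ∃! e, e ∈ P ∧ v ∈ e}

/-- The matchings of a family of graphs: matchings of one of its members. (A resolution is a pair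
of graphs, and its set of matchings is the disjoint union of the two sets of matchings.) -/
def MatchingsOf {V : Type*} (L : List (SimpleGraph V)) : Type _ :=
  Σ i : Fin L.length, perfectMatchings (L.get i)

/-- The part of a set of edges of a disjoint union that lies in the first summand. -/
def fstPart {V W : Type*} (P : Set (Sym2 (V ⊕ W))) : Set (Sym2 V) :=
  {e | e.map Sum.inl ∈ P}

/-- The part of a set of edges of a disjoint union that lies in the second summand. -/
def sndPart {V W : Type*} (P : Set (Sym2 (V ⊕ W))) : Set (Sym2 W) :=
  {e | e.map Sum.inr ∈ P}

/-! ### Tiles -/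

/-- Points of the integer grid in the plane. -/
abbrev Pt := ℤ × ℤ

/-- Edges are segments, recorded by their two end points. -/
abbrev Edge := Sym2 Pt

/-- A tile is a unit square of the grid; it is recorded by its south-west corner `q`. -/
def southE (q : Pt) : Edge := s(q, q + (1, 0))
def westE (q : Pt) : Edge := s(q, q + (0, 1))
def northE (q : Pt) : Edge := s(q + (0, 1), q + (1, 1))
def eastE (q : Pt) : Edge := s(q + (1, 0), q + (1, 1))

/-- The four edges of a tile. -/
def tileEdges (q : Pt) : Set Edge := {southE q, westE q, northE q, eastE q}

/-- The two directions in which a snake graph may continue. -/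
inductive Dir
  | north
  | east

def Dir.step : Dir → Pt
  | .north => (0, 1)
  | .east => (1, 0)

def Dir.other : Dir → Dir
  | .north => .east
  | .east => .north

/-- The edge of a tile on the side `a` (north or east). -/
def sideOut (q : Pt) : Dir → Edge
  | .north => northE q
  | .east => eastE q

/-- The edge of a tile opposite to the side `a` (south or west). -/
def sideIn (q : Pt) : Dir → Edge
  | .north => southE q
  | .east => westE q

/-! ### Snake graphs -/

/-- A (nonempty) snake graph: a finite sequence of tiles `G_1, ..., G_d`, `d ≥ 1`, such that `G_{i+1}`
is the northern or the eastern neighbour of `G_i`. It is given by the first tile and the list of the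
`d - 1` directions. (Since all steps go north or east, tiles whose indices differ by at least two
have no edge in common, and by at least three are disjoint.) -/
structure SnakeGraph where
  base : Pt
  dirs : List Dir

namespace SnakeGraph

/-- The number `d` of tiles. -/
def d (G : SnakeGraph) : ℕ := G.dirs.length + 1

/-- The tile `G_i`, for `1 ≤ i ≤ d`. -/
def tile (G : SnakeGraph) (i : ℕ) : Pt := G.base + ((G.dirs.take (i - 1)).map Dir.step).sum

/-- The direction from `G_i` to `G_{i+1}`, for `1 ≤ i < d`. -/
def dir (G : SnakeGraph) (i : ℕ) : Dir := G.dirs.getD (i - 1) Dir.east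

/-- The interior edge `e_i` shared by `G_i` and `G_{i+1}`, for `1 ≤ i < d`. -/
def inner (G : SnakeGraph) (i : ℕ) : Edge := sideOut (G.tile i) (G.dir i)

/-- The last tile `G_d`. -/
def last (G : SnakeGraph) : Pt := G.tile G.d

/-- The edges of the tiles `G_i, ..., G_j`. -/
def edgesOf (G : SnakeGraph) (i j : ℕ) : Set Edge :=
  {e | ∃ k, i ≤ k ∧ k ≤ j ∧ e ∈ tileEdges (G.tile k)}

/-- All edges of the snake graph. -/
def edges (G : SnakeGraph) : Set Edge := G.edgesOf 1 G.d

/-- The subgraph `G[i, j]`, for `1 ≤ i ≤ j ≤ d`. -/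
def sub (G : SnakeGraph) (i j : ℕ) : SnakeGraph :=
  ⟨G.tile i, (G.dirs.drop (i - 1)).take (j - i)⟩

end SnakeGraph

/-- The reflection of the plane in the line `y = -x`; it reverses the order of the tiles. -/
def barPt (p : Pt) : Pt := (-p.2, -p.1)

def barEdge (e : Edge) : Edge := e.map barPt

/-- The snake graph obtained by reflecting `G` such that the order of the tiles is reversed. -/
def SnakeGraph.bar (G : SnakeGraph) : SnakeGraph :=
  ⟨barPt (G.last + (1, 1)), (G.dirs.map Dir.other).reverse⟩

/-- Snake graphs including the empty ones, which are sets containing a single edge. -/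
inductive Piece
  | single (e : Edge)
  | snake (G : SnakeGraph)

namespace Piece

def edges : Piece → Set Edge
  | single e => {e}
  | snake G => G.edges

/-- The underlying graph. -/
def graph (A : Piece) : SimpleGraph Pt := SimpleGraph.fromEdgeSet A.edges

/-- Reflection reversing the order of the tiles. -/
def bar : Piece → Piece
  | single e => single (barEdge e)
  | snake G => snake G.bar

end Piece

/-- The disjoint union of two snake graphs, as a graph. -/
def disjointUnion (A B : Piece) : SimpleGraph (Pt ⊕ Pt) := SimpleGraph.sum A.graph B.graph

/-! ### Gluing -/

/-- `B` is glued to the side `a` (north or east) of the last tile of `A`: the first tile of the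
translated `B` becomes the neighbour of the last tile of `A` on this side. -/
def glue (A : SnakeGraph) (a : Dir) (B : SnakeGraph) : SnakeGraph :=
  ⟨A.base, A.dirs ++ a :: B.dirs⟩

/-- The translation of the edges of `B` to their place in `glue A a B`. -/
def glueEdge (A : SnakeGraph) (a : Dir) (B : SnakeGraph) (e : Edge) : Edge :=
  e.map (fun p => p + (A.last + a.step - B.base))

/-- For sets `P`, `Q` of edges of `A`, `B`: the union of `P` and `Q` in `glue A a B`, from which the
gluing edge is removed unless it belongs to both `P` and `Q`. -/
def glueMatching (A : SnakeGraph) (a : Dir) (B : SnakeGraph) (P Q : Set Edge) : Set Edge :=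
  {e | e ∈ P ∪ glueEdge A a B '' Q ∧
    (e = sideOut A.last a → e ∈ P ∩ glueEdge A a B '' Q)}

/-! ### Sign functions, and the pieces that they cut off -/

/-- `f` is a sign function on `G` (its values outside of the edges of `G` are irrelevant). -/
def IsSign (G : SnakeGraph) (f : Edge → ℤˣ) : Prop :=
  ∀ i, 1 ≤ i → i ≤ G.d →
    f (northE (G.tile i)) = f (westE (G.tile i)) ∧
    f (southE (G.tile i)) = f (eastE (G.tile i)) ∧
    f (northE (G.tile i)) = -f (southE (G.tile i))

open Classical in
/-- `G[1, k]` where `k ≤ n` is the largest integer with `k ≥ 1` and `f (e_k) = c`; if there is none,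
the south or west edge `e_0` of `G_1` with `f (e_0) = c`. -/
noncomputable def initialPiece (G : SnakeGraph) (f : Edge → ℤˣ) (c : ℤˣ) (n : ℕ) : Piece :=
  if ∃ k, 1 ≤ k ∧ k ≤ n ∧ f (G.inner k) = c then
    .snake (G.sub 1 (Nat.findGreatest (fun k => 1 ≤ k ∧ f (G.inner k) = c) n))
  else .single (if f (southE (G.tile 1)) = c then southE (G.tile 1) else westE (G.tile 1))

open Classical in
/-- `G[k, d]` where `k > n` is the least integer with `k ≤ d` and `f (e_{k-1}) = c`; if there is none,
the north or east edge `e_d` of `G_d` with `f (e_d) = c`. -/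
noncomputable def finalPiece (G : SnakeGraph) (f : Edge → ℤˣ) (c : ℤˣ) (n : ℕ) : Piece :=
  if h : ∃ k, n < k ∧ k ≤ G.d ∧ f (G.inner (k - 1)) = c then
    .snake (G.sub (Nat.find h) G.d)
  else .single (if f (northE G.last) = c then northE G.last else eastE G.last)

/-! ### Overlaps and crossings -/

/-- The motions of the plane that carry snake graphs to snake graphs: the reflections in the lines
`y = x` (`flip`) and `y = -x` (`rev`, which reverses the order of the tiles), followed by a
translation. -/
structure Motion where
  flip : Bool
  rev : Bool
  shift : Pt

namespace Motion

def onPt (m : Motion) (p : Pt) : Pt :=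
  (fun q : Pt => if m.rev then barPt q else q) (if m.flip then p.swap else p) + m.shift

def onEdge (m : Motion) (e : Edge) : Edge := e.map m.onPt

/-- The image of a snake graph under a motion. -/
def onSnake (m : Motion) (G : SnakeGraph) : SnakeGraph :=
  let G₁ : SnakeGraph := if m.flip then ⟨G.base.swap, G.dirs.map Dir.other⟩ else G
  let G₂ : SnakeGraph := if m.rev then G₁.bar else G₁
  ⟨G₂.base + m.shift, G₂.dirs⟩

end Motion

/-- `G[s, t]` and `H[s', t']` are the same sequence of tiles. -/
def IsCommon (G H : SnakeGraph) (s t s' t' : ℕ) : Prop :=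
  1 ≤ s ∧ s ≤ t ∧ t ≤ G.d ∧ 1 ≤ s' ∧ s' ≤ t' ∧ t' ≤ H.d ∧ t - s = t' - s' ∧
    ∀ i ≤ t - s, G.tile (s + i) = H.tile (s' + i)

/-- The snake graph `G[s, t] = H[s', t']` is an overlap of `G` and `H`: it is not part of a larger
common snake graph. The two snake graphs are drawn here in such a way that the two copies of the
overlap coincide. -/
def IsOverlap (G H : SnakeGraph) (s t s' t' : ℕ) : Prop :=
  IsCommon G H s t s' t' ∧
    ∀ a b a' b', IsCommon G H a b a' b' → a ≤ s → t ≤ b → a' ≤ s' → t' ≤ b' →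
      a = s ∧ b = t ∧ a' = s' ∧ b' = t'

/-- `G` and `H` cross in the overlap `G[s, t] = H[s', t']`; here `f₁`, `f₂` are the sign functions
on `G`, `H` induced by a sign function on the overlap. -/
def Crosses (G H : SnakeGraph) (f₁ f₂ : Edge → ℤˣ) (s t s' t' : ℕ) : Prop :=
  (1 < s ∧ t < G.d ∧ f₁ (G.inner (s - 1)) = -f₁ (G.inner t)) ∨
  (1 < s' ∧ t' < H.d ∧ f₂ (H.inner (s' - 1)) = -f₂ (H.inner t')) ∨
  (s = 1 ∧ t < G.d ∧ 1 < s' ∧ t' = H.d ∧ f₁ (G.inner t) = f₂ (H.inner (s' - 1))) ∨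
  (1 < s ∧ t = G.d ∧ s' = 1 ∧ t' < H.d ∧ f₁ (G.inner (s - 1)) = f₂ (H.inner t'))

/-! ### Resolution of a crossing -/

/-- `G[1, t] ∪ H[t'+1, d']`, the adjacency of the two subgraphs being induced by `H`. With `G`, `H`
this is `G_3`; with the roles of `G` and `H` exchanged it is `G_4`. -/
def switchGraph (G H : SnakeGraph) (t t' : ℕ) : SnakeGraph :=
  ⟨G.base, G.dirs.take (t - 1) ++ H.dirs.drop (t' - 1)⟩

/-- The graph `G_5` of the resolution of a crossing. -/
noncomputable def resFive (G H : SnakeGraph) (f₁ f₂ : Edge → ℤˣ) (s s' : ℕ) : Piece :=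
  if 1 < s ∧ 1 < s' then
    .snake (glue (G.sub 1 (s - 1)) (G.dir (s - 1)).other (H.sub 1 (s' - 1)).bar)
  else if s' = 1 then initialPiece G f₁ (f₁ (G.inner (s - 1))) (s - 2)
  else (initialPiece H f₂ (f₂ (H.inner (s' - 1))) (s' - 2)).bar

/-- The graph `G_6` of the resolution of a crossing. -/
noncomputable def resSix (G H : SnakeGraph) (f₁ f₂ : Edge → ℤˣ) (t t' : ℕ) : Piece :=
  if t < G.d ∧ t' < H.d then
    .snake (glue (H.sub (t' + 1) H.d).bar (G.dir t).other (G.sub (t + 1) G.d))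
  else if t = G.d then (finalPiece H f₂ (f₂ (H.inner t')) (t' + 1)).bar
  else finalPiece G f₁ (f₁ (G.inner t)) (t + 1)

open Classical in
/-- The resolution of the crossing of `G₁` and `G₂` at the overlap `G₁[s, t] = m(G₂)[s', t']`, where
the motion `m` puts `G₂` in the position in which the two copies of the overlap coincide. -/
noncomputable def resolution (G₁ G₂ : SnakeGraph) (m : Motion) (f₁ f₂ : Edge → ℤˣ)
    (s t s' t' : ℕ) : List (SimpleGraph (Pt ⊕ Pt)) :=
  if Crosses G₁ (m.onSnake G₂) f₁ f₂ s t s' t' then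
    [disjointUnion (.snake (switchGraph G₁ (m.onSnake G₂) t t'))
        (.snake (switchGraph (m.onSnake G₂) G₁ t' t)),
      disjointUnion (resFive G₁ (m.onSnake G₂) f₁ f₂ s s')
        (resSix G₁ (m.onSnake G₂) f₁ f₂ t t')]
  else [disjointUnion (.snake G₁) (.snake G₂)]

/-! ### The map for crossings -/

/-- The pair `(Q₃, Q₄)` of matchings of `G_3`, `G_4` arises from the pair `(P₁, P₂)` of matchings of
`G`, `H` by switching at the tile `G_j = H_j'` of the overlap: before this tile `Q₃` follows `P₁` and
`Q₄` follows `P₂`, after it `Q₃` follows `P₂` and `Q₄` follows `P₁`, and the edges of the tile that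
occur in `P₁` and `P₂` (with multiplicities) are distributed anew among `Q₃` and `Q₄`. -/
def SwitchAt (G H : SnakeGraph) (t t' : ℕ) (P₁ P₂ : Set Edge) (j j' : ℕ) (Q₃ Q₄ : Set Edge) :
    Prop :=
  Q₃ ∈ perfectMatchings (Piece.snake (switchGraph G H t t')).graph ∧
  Q₄ ∈ perfectMatchings (Piece.snake (switchGraph H G t' t)).graph ∧
  Q₃ \ tileEdges (G.tile j) =
    (P₁ ∩ G.edgesOf 1 (j - 1) ∪ P₂ ∩ H.edgesOf (j' + 1) H.d) \ tileEdges (G.tile j) ∧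
  Q₄ \ tileEdges (G.tile j) =
    (P₂ ∩ H.edgesOf 1 (j' - 1) ∪ P₁ ∩ G.edgesOf (j + 1) G.d) \ tileEdges (G.tile j) ∧
  (Q₃ ∩ Q₄) ∩ tileEdges (G.tile j) = (P₁ ∩ P₂) ∩ tileEdges (G.tile j) ∧
  (Q₃ ∪ Q₄) ∩ tileEdges (G.tile j) = (P₁ ∪ P₂) ∩ tileEdges (G.tile j)

/-- A switch is possible at the `i`-th tile of the overlap (counted from `i = 0`). -/
def CanSwitch (G H : SnakeGraph) (s t s' t' : ℕ) (P₁ P₂ : Set Edge) (i : ℕ) : Prop :=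
  ∃ Q₃ Q₄, SwitchAt G H t t' P₁ P₂ (s + i) (s' + i) Q₃ Q₄

/-- The matching induced by `(P₁, P₂)` on `G_5`: restriction, without the gluing edge. -/
def restrictFive (G H : SnakeGraph) (f₁ f₂ : Edge → ℤˣ) (s s' : ℕ) (P₁ P₂ : Set Edge) : Set Edge :=
  if 1 < s ∧ 1 < s' then
    glueMatching (G.sub 1 (s - 1)) (G.dir (s - 1)).other (H.sub 1 (s' - 1)).bar
      (P₁ ∩ G.edgesOf 1 (s - 1)) (barEdge '' (P₂ ∩ H.edgesOf 1 (s' - 1)))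
  else if s' = 1 then P₁ ∩ (resFive G H f₁ f₂ s s').edges
  else barEdge '' P₂ ∩ (resFive G H f₁ f₂ s s').edges

/-- The matching induced by `(P₁, P₂)` on `G_6`: restriction, without the gluing edge. -/
def restrictSix (G H : SnakeGraph) (f₁ f₂ : Edge → ℤˣ) (t t' : ℕ) (P₁ P₂ : Set Edge) : Set Edge :=
  if t < G.d ∧ t' < H.d then
    glueMatching (H.sub (t' + 1) H.d).bar (G.dir t).other (G.sub (t + 1) G.d)
      (barEdge '' (P₂ ∩ H.edgesOf (t' + 1) H.d)) (P₁ ∩ G.edgesOf (t + 1) G.d)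
  else if t = G.d then barEdge '' P₂ ∩ (resSix G H f₁ f₂ t t').edges
  else P₁ ∩ (resSix G H f₁ f₂ t t').edges

/-- The rule that describes the bijection for a crossing: look for the first tile of the overlap at
which the two matchings can be switched, and switch there; if there is no such tile, restrict to
`G_5` and `G_6`. Here `k = 0` means that the image `(Q, Q')` is a matching of `G_3 ⊔ G_4`, and `k = 1`
that it is a matching of `G_5 ⊔ G_6`. -/
def CrossingRule (G H : SnakeGraph) (f₁ f₂ : Edge → ℤˣ) (s t s' t' : ℕ) (P₁ P₂ : Set Edge)
    (k : ℕ) (Q Q' : Set Edge) : Prop :=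
  (k = 0 ∧ ∃ i ≤ t - s, SwitchAt G H t t' P₁ P₂ (s + i) (s' + i) Q Q' ∧
    ∀ l < i, ¬ CanSwitch G H s t s' t' P₁ P₂ l) ∨
  (k = 1 ∧ (∀ i ≤ t - s, ¬ CanSwitch G H s t s' t' P₁ P₂ i) ∧
    Q = restrictFive G H f₁ f₂ s s' P₁ P₂ ∧ Q' = restrictSix G H f₁ f₂ t t' P₁ P₂)

/-- The description of the image `Q`, a matching of the `k`-th member of the resolution, of a matching
`P` of `G₁ ⊔ G₂`: the crossing rule if there is a crossing, the identity otherwise. -/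
def ResolutionRule (G₁ G₂ : SnakeGraph) (m : Motion) (f₁ f₂ : Edge → ℤˣ) (s t s' t' : ℕ)
    (P : Set (Sym2 (Pt ⊕ Pt))) (k : ℕ) (Q : Set (Sym2 (Pt ⊕ Pt))) : Prop :=
  (Crosses G₁ (m.onSnake G₂) f₁ f₂ s t s' t' →
    CrossingRule G₁ (m.onSnake G₂) f₁ f₂ s t s' t' (fstPart P) (m.onEdge '' sndPart P)
      k (fstPart Q) (sndPart Q)) ∧
  (¬ Crosses G₁ (m.onSnake G₂) f₁ f₂ s t s' t' → Q = P)

/-! ### Grafting -/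

/-- The resolution of the grafting of `G₂` on `G₁` in `G_s`, for `s < d`. The gluing edges `δ_3`
of `G_s` and `δ_5` of `G_{s+1}` are determined by the side of `G_s` on which `G_{s+1}` does not lie. -/
noncomputable def graft (G₁ G₂ : SnakeGraph) (f₁ : Edge → ℤˣ) (s : ℕ) :
    List (SimpleGraph (Pt ⊕ Pt)) :=
  [disjointUnion (.snake (glue (G₁.sub 1 s) (G₁.dir s).other G₂))
      (finalPiece G₁ f₁ (-f₁ (G₁.inner s)) (s + 1)),
    disjointUnion (initialPiece G₁ f₁ (-f₁ (G₁.inner s)) (s - 1))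
      (.snake (glue G₂.bar (G₁.dir s).other (G₁.sub (s + 1) G₁.d)))]

/-- The rule that describes the bijection for a grafting with `s < d`. -/
def GraftRule (G₁ G₂ : SnakeGraph) (f₁ : Edge → ℤˣ) (s : ℕ) (P₁ P₂ : Set Edge)
    (k : ℕ) (Q Q' : Set Edge) : Prop :=
  let a := (G₁.dir s).other
  let toThreeFour := sideOut (G₁.tile s) a ∈ P₁ ∨ (G₁.inner s ∈ P₁ ∧ sideIn (G₂.tile 1) a ∈ P₂)
  (k = 0 ∧ toThreeFour ∧
    Q = glueMatching (G₁.sub 1 s) a G₂ (P₁ ∩ G₁.edgesOf 1 s) P₂ ∧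
    Q' = P₁ ∩ (finalPiece G₁ f₁ (-f₁ (G₁.inner s)) (s + 1)).edges) ∨
  (k = 1 ∧ ¬ toThreeFour ∧
    Q = P₁ ∩ (initialPiece G₁ f₁ (-f₁ (G₁.inner s)) (s - 1)).edges ∧
    Q' = glueMatching G₂.bar a (G₁.sub (s + 1) G₁.d) (barEdge '' P₂)
      (P₁ ∩ G₁.edgesOf (s + 1) G₁.d))

/-- The resolution of the grafting of `G₂` on `G₁` in the last tile `G_d`, where `δ_3` is the edge of
`G_d` on the side `a` and `δ'_3` the opposite edge of `G'_1`. -/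
noncomputable def graftLast (G₁ G₂ : SnakeGraph) (f₁ f₂ : Edge → ℤˣ) (a : Dir) :
    List (SimpleGraph (Pt ⊕ Pt)) :=
  [disjointUnion (.snake (glue G₁ a G₂)) (.single (sideOut G₁.last a)),
    disjointUnion (initialPiece G₁ f₁ (f₁ (sideOut G₁.last a)) (G₁.d - 1))
      (finalPiece G₂ f₂ (f₁ (sideOut G₁.last a)) 1).bar]

/-- The rule that describes the bijection for a grafting in the last tile. -/
def GraftLastRule (G₁ G₂ : SnakeGraph) (f₁ f₂ : Edge → ℤˣ) (a : Dir) (P₁ P₂ : Set Edge)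
    (k : ℕ) (Q Q' : Set Edge) : Prop :=
  let toThreeFour := sideOut G₁.last a ∈ P₁ ∨ sideIn (G₂.tile 1) a ∈ P₂
  (k = 0 ∧ toThreeFour ∧ Q = glueMatching G₁ a G₂ P₁ P₂ ∧ Q' = {sideOut G₁.last a}) ∨
  (k = 1 ∧ ¬ toThreeFour ∧
    Q = P₁ ∩ (initialPiece G₁ f₁ (f₁ (sideOut G₁.last a)) (G₁.d - 1)).edges ∧
    Q' = barEdge '' P₂ ∩ (finalPiece G₂ f₂ (f₁ (sideOut G₁.last a)) 1).bar.edges)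

end SnakeCalculus

open SnakeCalculus

namespace SnakeCalculus

/-! ### Segments of the grid and tile sets -/

/-! A perfect matching of a snake graph is the same thing as a word: a choice of an orientation `h
p` (horizontal or vertical, coded by `north` or `east`) for every tile `p`, such that of two tiles
adjacent in the direction `a` at least one has the value `a`. An edge lies in the matching iff all
tiles of the graph that contain it choose its orientation (`SnakeGraph.isPM_iff`). The theorem thus
becomes a statement about pairs of binary words with a constraint on neighbours.

Crossing. The tiles are ordered by antidiagonals. Two words can be cut at an antidiagonal and their
tails exchanged if the new adjacencies across the cut are admissible; switching at a tile is cutting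
just before or just after it (`Overlapping.switchRel`, `Overlapping.switchable_of_switchRel`).
Exchanging tails twice at the same place does nothing, and an exchange does not affect which earlier
cuts are possible; hence exchanging at the first possible cut is reversible
(`Overlapping.isFirstCut_swap`).

Two words without a possible cut have opposite values on the overlap and therefore alternate along
it. A sign function is such an alternating pattern in disguise (`IsSign.exists_signPat`), and a
crossing says that a pattern fits both ends of the overlap (`CrossPattern`). After the tails of the
graphs are exchanged, the two ends ask for opposite patterns, so a cut always exists there
(`Overlapping.canSwap_swap`): all matchings of `G_3`, `G_4` are reached. On the original graphs the
pairs without a cut are the alternating ones for which both ends block a cut as well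
(`Overlapping.not_canSwap_iff`). Their values in the overlap carry no information, and the condition
at each end is the adjacency condition of the glued graphs `G_5` and `G_6` (`endModel_resFive`,
`endModel_resSix`). If only one graph continues beyond an end, the condition fixes one value of its
word; this value propagates up to the next edge of the right sign, which is why a truncated graph or
a single edge appears (`initialPiece_forced`, `finalPiece_forced`).

Grafting. The values at the tiles next to the gluing edges decide between two cases; in each of them
the adjacency condition of the glued graph holds and the remaining parts start with a forced value.
-/

instance : DecidableEq Dir := fun a b => by
  cases a <;> cases b <;> first | exact isTrue rfl | exact isFalse nofun

theorem Dir.other_ne (a : Dir) : a.other ≠ a := by cases a <;> nofun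

@[simp] theorem Dir.other_other (a : Dir) : a.other.other = a := by cases a <;> rfl

theorem Dir.ne_iff {a b : Dir} : a ≠ b ↔ a = b.other := by
  cases a <;> cases b <;> simp [Dir.other]

theorem Dir.other_eq_iff {a b : Dir} : a.other = b ↔ a ≠ b := by
  cases a <;> cases b <;> simp [Dir.other]

theorem Dir.eq_of_ne_of_ne {a b c : Dir} (h : a ≠ c) (h' : b ≠ c) : a = b := by
  rw [Dir.ne_iff] at h h'; rw [h, h']

/-- The antidiagonal on which a point of the grid lies. -/
def lev (p : Pt) : ℤ := p.1 + p.2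

@[simp] theorem lev_add_step (p : Pt) (a : Dir) : lev (p + a.step) = lev p + 1 := by
  cases a <;> simp [lev, Dir.step] <;> ring

@[simp] theorem lev_sub_step (p : Pt) (a : Dir) : lev (p - a.step) = lev p - 1 := by
  cases a <;> simp [lev, Dir.step] <;> ring

theorem Dir.step_injective : Function.Injective Dir.step := by
  intro a b; cases a <;> cases b <;> simp [Dir.step]

/-- The segment of orientation `a` (`north` for horizontal, `east` for vertical ones) that is the
south or west edge of the tile `p`. -/
def seg (p : Pt) (a : Dir) : Edge := sideIn p a

theorem sideIn_eq_seg (p : Pt) (a : Dir) : sideIn p a = seg p a := rfl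

theorem sideOut_eq_seg (p : Pt) (a : Dir) : sideOut p a = seg (p + a.step) a := by
  cases a <;> simp [seg, sideIn, sideOut, Dir.step, northE, southE, eastE, westE, add_assoc]

/-- The pair `(p, a)` is a normal form of an edge: the only tiles of the grid that contain `seg p a`
are `p` and `p - a.step`. All computations with edges are reduced to questions about these two
tiles. -/
theorem seg_inj {p q : Pt} {a b : Dir} : seg p a = seg q b ↔ p = q ∧ a = b := by
  obtain ⟨p1, p2⟩ := p
  obtain ⟨q1, q2⟩ := q
  cases a <;> cases b <;> simp [seg, sideIn, southE, westE] <;> omega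

theorem mem_tileEdges {e : Edge} {q : Pt} :
    e ∈ tileEdges q ↔ ∃ p a, e = seg p a ∧ (p = q ∨ p - a.step = q) := by
  have h : e ∈ tileEdges q ↔ ∃ a, e = sideIn q a ∨ e = sideOut q a := by
    constructor
    · rintro (h | h | h | h)
      exacts [⟨.north, .inl h⟩, ⟨.east, .inl h⟩, ⟨.north, .inr h⟩, ⟨.east, .inr h⟩]
    · rintro ⟨a, h⟩
      cases a <;> rcases h with h | h <;> simp [tileEdges, h, sideIn, sideOut]
  rw [h]
  constructor
  · rintro ⟨a, h | h⟩
    · exact ⟨q, a, h, .inl rfl⟩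
    · exact ⟨q + a.step, a, h.trans (sideOut_eq_seg q a), .inr (by simp)⟩
  · rintro ⟨p, a, rfl, h | rfl⟩
    · subst h; exact ⟨a, .inl rfl⟩
    · exact ⟨a, .inr (by simp [sideOut_eq_seg])⟩

theorem seg_mem_tileEdges {p q : Pt} {a : Dir} :
    seg p a ∈ tileEdges q ↔ p = q ∨ p - a.step = q := by
  rw [mem_tileEdges]
  constructor
  · rintro ⟨p', a', h, h'⟩
    obtain ⟨rfl, rfl⟩ := seg_inj.1 h
    exact h'
  · exact fun h => ⟨p, a, rfl, h⟩

/-- The edges of a set of tiles. -/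
def tileSetEdges (T : Set Pt) : Set Edge :=
  {e | ∃ p a, e = seg p a ∧ (p ∈ T ∨ p - a.step ∈ T)}

theorem seg_mem_tileSetEdges {T : Set Pt} {p : Pt} {a : Dir} :
    seg p a ∈ tileSetEdges T ↔ p ∈ T ∨ p - a.step ∈ T := by
  constructor
  · rintro ⟨p', a', h, h'⟩
    obtain ⟨rfl, rfl⟩ := seg_inj.1 h
    exact h'
  · exact fun h => ⟨p, a, rfl, h⟩

theorem mem_tileSetEdges_iff {T : Set Pt} {e : Edge} :
    e ∈ tileSetEdges T ↔ ∃ q ∈ T, e ∈ tileEdges q := by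
  constructor
  · rintro ⟨p, a, rfl, h | h⟩
    · exact ⟨p, h, seg_mem_tileEdges.2 (.inl rfl)⟩
    · exact ⟨_, h, seg_mem_tileEdges.2 (.inr rfl)⟩
  · rintro ⟨q, hq, h⟩
    obtain ⟨p, a, rfl, rfl | rfl⟩ := mem_tileEdges.1 h
    · exact ⟨_, _, rfl, .inl hq⟩
    · exact ⟨_, _, rfl, .inr hq⟩

theorem tileEdges_eq (q : Pt) : tileEdges q = tileSetEdges {q} := by
  ext e; simp [mem_tileSetEdges_iff]

/-- The set of edges given by a word, i.e. by the choice of an orientation for each tile: an edge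
belongs to it if its orientation is the one chosen for all tiles that contain the edge. -/
def wordEdges (T : Set Pt) (h : Pt → Dir) : Set Edge :=
  {e | ∃ p a, e = seg p a ∧ (p ∈ T ∨ p - a.step ∈ T) ∧
    (p ∈ T → h p = a) ∧ (p - a.step ∈ T → h (p - a.step) = a)}

theorem seg_mem_wordEdges {T : Set Pt} {h : Pt → Dir} {p : Pt} {a : Dir} :
    seg p a ∈ wordEdges T h ↔ (p ∈ T ∨ p - a.step ∈ T) ∧
      (p ∈ T → h p = a) ∧ (p - a.step ∈ T → h (p - a.step) = a) := by
  constructor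
  · rintro ⟨p', a', h, h'⟩
    obtain ⟨rfl, rfl⟩ := seg_inj.1 h
    exact h'
  · exact fun h => ⟨p, a, rfl, h⟩

theorem wordEdges_subset (T : Set Pt) (h : Pt → Dir) : wordEdges T h ⊆ tileSetEdges T := by
  rintro e ⟨p, a, he, h, -⟩
  exact ⟨p, a, he, h⟩

/-- All segments of the grid. -/
def segs : Set Edge := {e | ∃ p a, e = seg p a}

theorem tileSetEdges_subset_segs (T : Set Pt) : tileSetEdges T ⊆ segs := by
  rintro e ⟨p, a, he, -⟩
  exact ⟨p, a, he⟩

theorem wordEdges_subset_segs (T : Set Pt) (h : Pt → Dir) : wordEdges T h ⊆ segs :=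
  (wordEdges_subset T h).trans (tileSetEdges_subset_segs T)

theorem segs_ext {A B : Set Edge} (hA : A ⊆ segs) (hB : B ⊆ segs)
    (h : ∀ p a, seg p a ∈ A ↔ seg p a ∈ B) : A = B := by
  ext e
  constructor
  · intro he
    obtain ⟨p, a, rfl⟩ := hA he
    exact (h p a).1 he
  · intro he
    obtain ⟨p, a, rfl⟩ := hB he
    exact (h p a).2 he

theorem wordEdges_congr {T : Set Pt} {h k : Pt → Dir} (H : Set.EqOn h k T) :
    wordEdges T h = wordEdges T k := by
  refine segs_ext (wordEdges_subset_segs _ _) (wordEdges_subset_segs _ _) fun p a => ?_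
  simp only [seg_mem_wordEdges]
  have h1 := @H p
  have h2 := @H (p - a.step)
  grind

/-- Compatibility of a word with the adjacency of tiles. -/
def IsWord (T : Set Pt) (h : Pt → Dir) : Prop :=
  ∀ p a, p ∈ T → p + a.step ∈ T → h p = a ∨ h (p + a.step) = a

theorem IsWord.mono {T T' : Set Pt} {h : Pt → Dir} (H : IsWord T h) (hT : T' ⊆ T) :
    IsWord T' h := fun p a hp hp' => H p a (hT hp) (hT hp')

theorem IsWord.congr {T : Set Pt} {h k : Pt → Dir} (H : IsWord T h) (hk : Set.EqOn h k T) :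
    IsWord T k := fun p a hp hp' => by
  rw [← hk hp, ← hk hp']; exact H p a hp hp'

/-- A set of tiles with at most one tile on each antidiagonal. -/
def IsThin (T : Set Pt) : Prop := ∀ p ∈ T, ∀ q ∈ T, lev p = lev q → p = q

theorem IsThin.step_unique {T : Set Pt} (H : IsThin T) {p : Pt} {a b : Dir}
    (ha : p + a.step ∈ T) (hb : p + b.step ∈ T) : a = b :=
  Dir.step_injective (add_left_cancel (H _ ha _ hb (by simp)))

theorem IsThin.sub_step_unique {T : Set Pt} (H : IsThin T) {p : Pt} {a b : Dir}
    (ha : p - a.step ∈ T) (hb : p - b.step ∈ T) : a = b :=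
  Dir.step_injective (sub_right_injective (H _ ha _ hb (by simp)))

/-- A tile of a thin set has at most one successor, so one of its north and east sides, say `a`,
lies on the boundary. Whether this boundary edge is present tells whether the value is `a`, and
there are only two values. -/
theorem eqOn_of_wordEdges_eq {T : Set Pt} (hT : IsThin T) {h k : Pt → Dir}
    (H : wordEdges T h = wordEdges T k) : Set.EqOn h k T := by
  intro p hp
  have key : ∀ a : Dir, p + a.step ∉ T → (h p = a ↔ k p = a) := by
    intro a ha
    have := Set.ext_iff.1 H (seg (p + a.step) a)
    simpa [seg_mem_wordEdges, ha, hp] using this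
  have : ∃ a : Dir, p + a.step ∉ T := by
    by_contra! hc
    exact absurd (hT.step_unique (hc .north) (hc .east)) nofun
  obtain ⟨a, ha⟩ := this
  have := key a ha
  by_cases h1 : h p = a
  · rw [h1, this.1 h1]
  · exact Dir.eq_of_ne_of_ne h1 (mt this.2 h1)

/-- Restriction of a matching to a part of the tiles. -/
theorem wordEdges_inter {T T' : Set Pt} (hT : T' ⊆ T) {h : Pt → Dir}
    (h1 : ∀ p a, p ∈ T' → p + a.step ∈ T → p + a.step ∉ T' → h p = a → h (p + a.step) = a)
    (h2 : ∀ p a, p ∈ T' → p - a.step ∈ T → p - a.step ∉ T' → h p = a → h (p - a.step) = a) :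
    wordEdges T h ∩ tileSetEdges T' = wordEdges T' h := by
  -- Only edges between a tile of `T'` and a tile of `T \ T'` are in question: in `T'` they depend
  -- on the inner tile alone, in `T` on both. The hypotheses make the outer tile agree whenever the
  -- inner one chooses the edge.
  refine segs_ext (Set.inter_subset_left.trans (wordEdges_subset_segs _ _))
    (wordEdges_subset_segs _ _) fun p a => ?_
  simp only [Set.mem_inter_iff, seg_mem_wordEdges, seg_mem_tileSetEdges]
  have h1 := h1 (p - a.step) a
  have h2 := h2 p a
  have h3 := @hT p
  have h4 := @hT (p - a.step)
  simp only [sub_add_cancel] at h1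
  by_cases c1 : p ∈ T' <;> by_cases c2 : p - a.step ∈ T' <;>
    by_cases c3 : h p = a <;> by_cases c4 : h (p - a.step) = a <;> simp_all

/-- Gluing of matchings of disjoint sets of tiles. -/
theorem wordEdges_union {T T' : Set Pt} (hd : Disjoint T T') (h : Pt → Dir) :
    wordEdges (T ∪ T') h = {e | e ∈ wordEdges T h ∪ wordEdges T' h ∧
      (e ∈ tileSetEdges T ∩ tileSetEdges T' → e ∈ wordEdges T h ∩ wordEdges T' h)} := by
  -- By disjointness an edge common to both parts has one tile in each, so it needs the consent of
  -- both words; any other edge is seen by one part only.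
  refine segs_ext (wordEdges_subset_segs _ _) ?_ fun p a => ?_
  · rintro e ⟨h | h, -⟩ <;> exact wordEdges_subset_segs _ _ h
  simp only [Set.mem_inter_iff, seg_mem_wordEdges, seg_mem_tileSetEdges, Set.mem_union,
    Set.mem_ofPred_eq]
  have h1 : p ∈ T → p ∉ T' := fun h => Set.disjoint_left.1 hd h
  have h2 : p - a.step ∈ T → p - a.step ∉ T' := fun h => Set.disjoint_left.1 hd h
  by_cases c1 : p ∈ T <;> by_cases c2 : p - a.step ∈ T <;> by_cases c3 : p ∈ T' <;>
    by_cases c4 : p - a.step ∈ T' <;> simp_all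
  tauto

/-! ### Perfect matchings of sets of edges -/

section PerfectMatchings

variable {V W : Type*}

/-- Perfect matchings of the graph with the set of edges `E`. -/
def IsPM (E P : Set (Sym2 V)) : Prop :=
  P ⊆ E ∧ ∀ v, (∃ e ∈ E, v ∈ e) → ∃! e, e ∈ P ∧ v ∈ e

theorem mem_support_fromEdgeSet {E : Set (Sym2 V)} (hE : ∀ e ∈ E, ¬ e.IsDiag) (v : V) :
    v ∈ (SimpleGraph.fromEdgeSet E).support ↔ ∃ e ∈ E, v ∈ e := by
  rw [SimpleGraph.mem_support]
  simp only [SimpleGraph.fromEdgeSet_adj]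
  constructor
  · rintro ⟨w, h, -⟩
    exact ⟨_, h, Sym2.mem_mk_left _ _⟩
  · rintro ⟨e, he, hv⟩
    obtain ⟨w, rfl⟩ := hv
    exact ⟨w, he, fun h => hE _ he (by simp [h])⟩

/-- Without loops nothing is lost in passing from a set of edges to the graph, so that all later
work can be done with sets of edges. -/
theorem mem_perfectMatchings_fromEdgeSet {E : Set (Sym2 V)} (hE : ∀ e ∈ E, ¬ e.IsDiag)
    (P : Set (Sym2 V)) :
    P ∈ perfectMatchings (SimpleGraph.fromEdgeSet E) ↔ IsPM E P := by
  have h : (SimpleGraph.fromEdgeSet E).edgeSet = E := by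
    rw [SimpleGraph.edgeSet_fromEdgeSet]
    ext e
    simp only [Set.mem_sdiff]
    exact ⟨fun h => h.1, fun h => ⟨h, hE e h⟩⟩
  simp only [perfectMatchings, IsPM, Set.mem_ofPred_eq, h, mem_support_fromEdgeSet hE]

theorem isPM_image {g : V → W} (hg : Function.Injective g) (E P : Set (Sym2 V)) :
    IsPM (Sym2.map g '' E) (Sym2.map g '' P) ↔ IsPM E P := by
  have hinj := Sym2.map.injective hg
  have hmem : ∀ (v : V) (e : Sym2 V), g v ∈ e.map g ↔ v ∈ e := by
    intro v e
    rw [Sym2.mem_map]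
    exact ⟨fun ⟨w, hw, h⟩ => hg h ▸ hw, fun h => ⟨v, h, rfl⟩⟩
  unfold IsPM
  rw [Set.image_subset_image_iff hinj]
  refine and_congr_right fun _ => ⟨fun H v hv => ?_, fun H w hw => ?_⟩
  · obtain ⟨e, he, hv⟩ := hv
    obtain ⟨e', ⟨⟨e₁, he₁, rfl⟩, hv₁⟩, hu⟩ := H (g v) ⟨_, ⟨e, he, rfl⟩, (hmem v e).2 hv⟩
    refine ⟨e₁, ⟨he₁, (hmem _ _).1 hv₁⟩, fun y hy => ?_⟩
    exact hinj (hu _ ⟨⟨y, hy.1, rfl⟩, (hmem _ _).2 hy.2⟩)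
  · obtain ⟨_, ⟨e, he, rfl⟩, hw⟩ := hw
    obtain ⟨v, hv, rfl⟩ := Sym2.mem_map.1 hw
    obtain ⟨e₁, ⟨he₁, hv₁⟩, hu⟩ := H v ⟨e, he, hv⟩
    refine ⟨e₁.map g, ⟨⟨e₁, he₁, rfl⟩, (hmem _ _).2 hv₁⟩, ?_⟩
    rintro _ ⟨⟨y, hy, rfl⟩, hy'⟩
    rw [hu y ⟨hy, (hmem _ _).1 hy'⟩]

theorem isPM_image_iff {g : V → W} (hg : Function.Injective g) (E : Set (Sym2 V))
    (Q : Set (Sym2 W)) :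
    IsPM (Sym2.map g '' E) Q ↔ ∃ P, IsPM E P ∧ Sym2.map g '' P = Q := by
  constructor
  · intro h
    obtain ⟨P, -, rfl⟩ := Set.subset_image_iff.1 h.1
    exact ⟨P, (isPM_image hg E P).1 h, rfl⟩
  · rintro ⟨P, h, rfl⟩
    exact (isPM_image hg E P).2 h

theorem isPM_singleton {e : Sym2 V} {P : Set (Sym2 V)} : IsPM {e} P ↔ P = {e} := by
  constructor
  · rintro ⟨h, H⟩
    refine Set.Subset.antisymm h ?_
    intro e' he
    obtain rfl := Set.mem_singleton_iff.1 he
    rename' e' => e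
    obtain ⟨v, hv⟩ : ∃ v, v ∈ e := by
      induction e with | _ x y => exact ⟨x, Sym2.mem_mk_left _ _⟩
    obtain ⟨e', ⟨h1, -⟩, -⟩ := H v ⟨_, rfl, hv⟩
    rwa [← Set.mem_singleton_iff.1 (h h1)]
  · rintro rfl
    refine ⟨subset_rfl, ?_⟩
    rintro v ⟨e', he', hv⟩
    exact ⟨e', ⟨he', hv⟩, fun y hy => (Set.mem_singleton_iff.1 hy.1).trans
      (Set.mem_singleton_iff.1 he').symm⟩

/-- The effect on perfect matchings of attaching a quadrilateral to an edge. -/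
theorem isPM_attach {E : Set (Sym2 V)} {u v u' v' : V} (huv : s(u, v) ∈ E) (hne : u ≠ v)
    (hne' : u' ≠ v') (hu' : ∀ e ∈ E, u' ∉ e) (hv' : ∀ e ∈ E, v' ∉ e) (P : Set (Sym2 V)) :
    IsPM (E ∪ {s(u, u'), s(v, v'), s(u', v')}) P ↔
      (∃ Q, IsPM E Q ∧ P = Q ∪ {s(u', v')}) ∨
      (∃ Q, IsPM E Q ∧ s(u, v) ∈ Q ∧ P = Q \ {s(u, v)} ∪ {s(u, u'), s(v, v')}) := by
  have hu1 : u ≠ u' := fun h => hu' _ huv (h ▸ Sym2.mem_mk_left _ _)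
  have hu2 : u ≠ v' := fun h => hv' _ huv (h ▸ Sym2.mem_mk_left _ _)
  have hv1 : v ≠ u' := fun h => hu' _ huv (h ▸ Sym2.mem_mk_right _ _)
  have hv2 : v ≠ v' := fun h => hv' _ huv (h ▸ Sym2.mem_mk_right _ _)
  have ht : s(u', v') ∉ E := fun h => hu' _ h (Sym2.mem_mk_left _ _)
  have ha : s(u, u') ∉ E := fun h => hu' _ h (Sym2.mem_mk_right _ _)
  have hb : s(v, v') ∉ E := fun h => hv' _ h (Sym2.mem_mk_right _ _)
  have hmu : ∀ w, w ∈ s(u, v) ↔ w = u ∨ w = v := fun w => Sym2.mem_iff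
  constructor
  · rintro ⟨hP, H⟩
    have Hu' := H u' ⟨s(u', v'), by simp, Sym2.mem_mk_left _ _⟩
    have Hv' := H v' ⟨s(u', v'), by simp, Sym2.mem_mk_right _ _⟩
    have Hu := H u ⟨s(u, v), .inl huv, Sym2.mem_mk_left _ _⟩
    have Hv := H v ⟨s(u, v), .inl huv, Sym2.mem_mk_right _ _⟩
    have hP' : ∀ e ∈ P, e ∈ E ∨ e = s(u, u') ∨ e = s(v, v') ∨ e = s(u', v') := fun e he => by
      rcases hP he with h | h | h | h
      exacts [.inl h, .inr (.inl h), .inr (.inr (.inl h)), .inr (.inr (.inr h))]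
    -- The new vertices lie on three edges only. Either the far edge covers both of them and the
    -- side edges are excluded, or both side edges are used.
    by_cases htop : s(u', v') ∈ P
    · have na : s(u, u') ∉ P := fun h => by
        have := Hu'.unique ⟨h, Sym2.mem_mk_right _ _⟩ ⟨htop, Sym2.mem_mk_left _ _⟩
        simp [hu1, hu2] at this
      have nb : s(v, v') ∉ P := fun h => by
        have := Hv'.unique ⟨h, Sym2.mem_mk_right _ _⟩ ⟨htop, Sym2.mem_mk_right _ _⟩
        simp [hv1, hv2] at this
      refine .inl ⟨P ∩ E, ⟨Set.inter_subset_right, fun w hw => ?_⟩, ?_⟩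
      · obtain ⟨e₀, he₀, hw₀⟩ := hw
        obtain ⟨e, ⟨he, hwe⟩, hun⟩ := H w ⟨e₀, .inl he₀, hw₀⟩
        refine ⟨e, ⟨⟨he, ?_⟩, hwe⟩, fun y hy => hun y ⟨hy.1.1, hy.2⟩⟩
        rcases hP' e he with h | rfl | rfl | rfl
        · exact h
        · exact absurd he na
        · exact absurd he nb
        · rcases Sym2.mem_iff.1 hwe with rfl | rfl
          · exact absurd hw₀ (hu' _ he₀)
          · exact absurd hw₀ (hv' _ he₀)
      · ext e
        simp only [Set.mem_union, Set.mem_inter_iff, Set.mem_singleton_iff]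
        constructor
        · intro he
          rcases hP' e he with h | rfl | rfl | rfl
          · exact .inl ⟨he, h⟩
          · exact absurd he na
          · exact absurd he nb
          · exact .inr rfl
        · rintro (h | rfl)
          exacts [h.1, htop]
    · have ma : s(u, u') ∈ P := by
        obtain ⟨e, ⟨he, hw⟩, -⟩ := Hu'
        rcases hP' e he with h | rfl | rfl | rfl
        · exact absurd hw (hu' _ h)
        · exact he
        · rcases Sym2.mem_iff.1 hw with h | h
          exacts [absurd h.symm hv1, absurd h hne']
        · exact absurd he htop
      have mb : s(v, v') ∈ P := by
        obtain ⟨e, ⟨he, hw⟩, -⟩ := Hv'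
        rcases hP' e he with h | rfl | rfl | rfl
        · exact absurd hw (hv' _ h)
        · rcases Sym2.mem_iff.1 hw with h | h
          exacts [absurd h.symm hu2, absurd h.symm hne']
        · exact he
        · exact absurd he htop
      have nuv : s(u, v) ∉ P := fun h => by
        have := Hu.unique ⟨h, Sym2.mem_mk_left _ _⟩ ⟨ma, Sym2.mem_mk_left _ _⟩
        exact ha (this ▸ huv)
      -- The side edges cover `u` and `v` in `P`, so no edge of `P ∩ E` does; the edge `s(u, v)`
      -- repairs this.
      refine .inr ⟨P ∩ E ∪ {s(u, v)}, ⟨?_, fun w hw => ?_⟩, by simp, ?_⟩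
      · rintro e (h | rfl)
        exacts [h.2, huv]
      · obtain ⟨e₀, he₀, hw₀⟩ := hw
        obtain ⟨e, ⟨he, hwe⟩, hun⟩ := H w ⟨e₀, .inl he₀, hw₀⟩
        have hwu' : w ≠ u' := fun h => hu' _ he₀ (h ▸ hw₀)
        have hwv' : w ≠ v' := fun h => hv' _ he₀ (h ▸ hw₀)
        by_cases hw : w = u ∨ w = v
        · refine ⟨s(u, v), ⟨.inr rfl, (hmu w).2 hw⟩, ?_⟩
          rintro y ⟨⟨hy1, hy2⟩ | hy, hy'⟩
          · rcases hw with rfl | rfl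
            · exact absurd (Hu.unique ⟨hy1, hy'⟩ ⟨ma, Sym2.mem_mk_left _ _⟩ ▸ hy2) ha
            · exact absurd (Hv.unique ⟨hy1, hy'⟩ ⟨mb, Sym2.mem_mk_left _ _⟩ ▸ hy2) hb
          · exact hy
        · push Not at hw
          refine ⟨e, ⟨.inl ⟨he, ?_⟩, hwe⟩, ?_⟩
          · rcases hP' e he with h | rfl | rfl | rfl
            · exact h
            · rcases Sym2.mem_iff.1 hwe with h | h
              exacts [absurd h hw.1, absurd h hwu']
            · rcases Sym2.mem_iff.1 hwe with h | h
              exacts [absurd h hw.2, absurd h hwv']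
            · exact absurd he htop
          · rintro y ⟨⟨hy1, hy2⟩ | rfl, hy'⟩
            · exact hun y ⟨hy1, hy'⟩
            · rcases (hmu w).1 hy' with h | h
              exacts [absurd h hw.1, absurd h hw.2]
      · ext e
        simp only [Set.mem_union, Set.mem_inter_iff, Set.mem_singleton_iff, Set.mem_sdiff,
          Set.mem_insert_iff]
        constructor
        · intro he
          rcases hP' e he with h | rfl | rfl | rfl
          · exact .inl ⟨.inl ⟨he, h⟩, fun h => nuv (h ▸ he)⟩
          · exact .inr (.inl rfl)
          · exact .inr (.inr rfl)
          · exact absurd he htop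
        · rintro (⟨h | h, h'⟩ | rfl | rfl)
          exacts [h.1, absurd h h', ma, mb]
  · rintro (⟨Q, ⟨hQ, H⟩, rfl⟩ | ⟨Q, ⟨hQ, H⟩, huvQ, rfl⟩)
    · refine ⟨Set.union_subset_union hQ (by simp), fun w hw => ?_⟩
      by_cases hwt : w = u' ∨ w = v'
      · refine ⟨s(u', v'), ⟨.inr rfl, Sym2.mem_iff.2 hwt⟩, ?_⟩
        rintro y ⟨hy | hy, hy'⟩
        · rcases hwt with rfl | rfl
          exacts [absurd hy' (hu' _ (hQ hy)), absurd hy' (hv' _ (hQ hy))]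
        · exact hy
      · have hwE : ∃ e ∈ E, w ∈ e := by
          push Not at hwt
          obtain ⟨e, he | rfl | rfl | rfl, hwe⟩ := hw
          · exact ⟨e, he, hwe⟩
          · rcases Sym2.mem_iff.1 hwe with h | h
            exacts [⟨_, huv, h ▸ Sym2.mem_mk_left _ _⟩, absurd h hwt.1]
          · rcases Sym2.mem_iff.1 hwe with h | h
            exacts [⟨_, huv, h ▸ Sym2.mem_mk_right _ _⟩, absurd h hwt.2]
          · rcases Sym2.mem_iff.1 hwe with h | h
            exacts [absurd h hwt.1, absurd h hwt.2]
        obtain ⟨e, ⟨he, hwe⟩, hun⟩ := H w hwE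
        refine ⟨e, ⟨.inl he, hwe⟩, ?_⟩
        rintro y ⟨hy | rfl, hy'⟩
        · exact hun y ⟨hy, hy'⟩
        · exact absurd (Sym2.mem_iff.1 hy') hwt
    · refine ⟨?_, fun w hw => ?_⟩
      · rintro e (h | rfl | rfl)
        · exact .inl (hQ h.1)
        · simp
        · simp
      · by_cases h1 : w = u ∨ w = u'
        · refine ⟨s(u, u'), ⟨.inr (.inl rfl), Sym2.mem_iff.2 h1⟩, ?_⟩
          rintro y ⟨⟨hy, hyn⟩ | rfl | rfl, hy'⟩
          · rcases h1 with rfl | rfl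
            · exact absurd ((H w ⟨_, huv, Sym2.mem_mk_left _ _⟩).unique ⟨hy, hy'⟩
                ⟨huvQ, Sym2.mem_mk_left _ _⟩) hyn
            · exact absurd hy' (hu' _ (hQ hy))
          · rfl
          · rcases Sym2.mem_iff.1 hy' with rfl | rfl <;> rcases h1 with h | h <;>
              first | exact absurd h.symm hne | exact absurd h hv1 | exact absurd h.symm hu2 |
                exact absurd h.symm hne'
        · by_cases h2 : w = v ∨ w = v'
          · refine ⟨s(v, v'), ⟨.inr (.inr rfl), Sym2.mem_iff.2 h2⟩, ?_⟩
            rintro y ⟨⟨hy, hyn⟩ | rfl | rfl, hy'⟩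
            · rcases h2 with rfl | rfl
              · exact absurd ((H w ⟨_, huv, Sym2.mem_mk_right _ _⟩).unique ⟨hy, hy'⟩
                  ⟨huvQ, Sym2.mem_mk_right _ _⟩) hyn
              · exact absurd hy' (hv' _ (hQ hy))
            · exact absurd (Sym2.mem_iff.1 hy') h1
            · rfl
          · push Not at h1 h2
            have hwE : ∃ e ∈ E, w ∈ e := by
              obtain ⟨e, he | rfl | rfl | rfl, hwe⟩ := hw
              · exact ⟨e, he, hwe⟩
              · rcases Sym2.mem_iff.1 hwe with h | h
                exacts [absurd h h1.1, absurd h h1.2]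
              · rcases Sym2.mem_iff.1 hwe with h | h
                exacts [absurd h h2.1, absurd h h2.2]
              · rcases Sym2.mem_iff.1 hwe with h | h
                exacts [absurd h h1.2, absurd h h2.2]
            obtain ⟨e, ⟨he, hwe⟩, hun⟩ := H w hwE
            refine ⟨e, ⟨.inl ⟨he, ?_⟩, hwe⟩, ?_⟩
            · rintro rfl
              rcases (hmu w).1 hwe with h | h
              exacts [h1.1 h, h2.1 h]
            · rintro y ⟨⟨hy, -⟩ | rfl | rfl, hy'⟩
              · exact hun y ⟨hy, hy'⟩
              · rcases Sym2.mem_iff.1 hy' with h | h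
                exacts [absurd h h1.1, absurd h h1.2]
              · rcases Sym2.mem_iff.1 hy' with h | h
                exacts [absurd h h2.1, absurd h h2.2]

/-! ### Disjoint unions -/

/-- The union of sets of edges in a disjoint union. -/
def unionPart (P : Set (Sym2 V)) (Q : Set (Sym2 W)) : Set (Sym2 (V ⊕ W)) :=
  Sym2.map Sum.inl '' P ∪ Sym2.map Sum.inr '' Q

theorem map_inl_ne_map_inr (e : Sym2 V) (e' : Sym2 W) :
    e.map Sum.inl ≠ e'.map (Sum.inr : W → V ⊕ W) := by
  intro h
  induction e with | _ x y =>
  have hx : (Sum.inl x : V ⊕ W) ∈ e'.map (Sum.inr : W → V ⊕ W) := by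
    rw [← h]; exact Sym2.mem_mk_left _ _
  obtain ⟨w, -, hw⟩ := Sym2.mem_map.1 hx
  cases hw

@[simp] theorem fstPart_unionPart (P : Set (Sym2 V)) (Q : Set (Sym2 W)) :
    fstPart (unionPart P Q) = P := by
  ext e
  simp only [fstPart, unionPart, Set.mem_ofPred_eq, Set.mem_union, Set.mem_image]
  constructor
  · rintro (⟨x, hx, h⟩ | ⟨x, hx, h⟩)
    · rwa [← Sym2.map.injective Sum.inl_injective h]
    · exact absurd h.symm (map_inl_ne_map_inr _ _)
  · exact fun h => .inl ⟨e, h, rfl⟩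

@[simp] theorem sndPart_unionPart (P : Set (Sym2 V)) (Q : Set (Sym2 W)) :
    sndPart (unionPart P Q) = Q := by
  ext e
  simp only [sndPart, unionPart, Set.mem_ofPred_eq, Set.mem_union, Set.mem_image]
  constructor
  · rintro (⟨x, hx, h⟩ | ⟨x, hx, h⟩)
    · exact absurd h (map_inl_ne_map_inr _ _)
    · rwa [← Sym2.map.injective Sum.inr_injective h]
  · exact fun h => .inr ⟨e, h, rfl⟩

theorem unionPart_inj {P P' : Set (Sym2 V)} {Q Q' : Set (Sym2 W)} :
    unionPart P Q = unionPart P' Q' ↔ P = P' ∧ Q = Q' := by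
  constructor
  · intro h
    exact ⟨by simpa using congrArg fstPart h, by simpa using congrArg sndPart h⟩
  · rintro ⟨rfl, rfl⟩; rfl

theorem edgeSet_sum (G : SimpleGraph V) (H : SimpleGraph W) :
    (SimpleGraph.sum G H).edgeSet = unionPart G.edgeSet H.edgeSet := by
  ext e
  induction e with | _ x y =>
  simp only [unionPart, Set.mem_union, Set.mem_image, SimpleGraph.mem_edgeSet]
  rcases x with x | x <;> rcases y with y | y
  · constructor
    · exact fun h => .inl ⟨s(x, y), h, rfl⟩
    · rintro (⟨e, he, h⟩ | ⟨e, he, h⟩)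
      · rwa [Sym2.map.injective Sum.inl_injective (h.trans (Sym2.map_mk Sum.inl x y).symm)] at he
      · exact absurd (h.trans (Sym2.map_mk Sum.inl x y).symm).symm (map_inl_ne_map_inr _ _)
  · simp only [SimpleGraph.sum_adj, false_iff]
    rintro (⟨e, he, h⟩ | ⟨e, he, h⟩) <;> induction e <;> simp at h
  · simp only [SimpleGraph.sum_adj, false_iff]
    rintro (⟨e, he, h⟩ | ⟨e, he, h⟩) <;> induction e <;> simp at h
  · constructor
    · exact fun h => .inr ⟨s(x, y), h, rfl⟩
    · rintro (⟨e, he, h⟩ | ⟨e, he, h⟩)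
      · exact absurd (h.trans (Sym2.map_mk Sum.inr x y).symm) (map_inl_ne_map_inr _ _)
      · rwa [Sym2.map.injective Sum.inr_injective (h.trans (Sym2.map_mk Sum.inr x y).symm)] at he

theorem perfectMatchings_eq (G : SimpleGraph V) (P : Set (Sym2 V)) :
    P ∈ perfectMatchings G ↔ IsPM G.edgeSet P := by
  conv_lhs => rw [← SimpleGraph.fromEdgeSet_edgeSet G]
  exact mem_perfectMatchings_fromEdgeSet (fun e he => G.not_isDiag_of_mem_edgeSet he) P

theorem isPM_unionPart {E P : Set (Sym2 V)} {F Q : Set (Sym2 W)} :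
    IsPM (unionPart E F) (unionPart P Q) ↔ IsPM E P ∧ IsPM F Q := by
  have hl : ∀ (v : V) (e : Sym2 V), (Sum.inl v : V ⊕ W) ∈ e.map Sum.inl ↔ v ∈ e := by
    intro v e; simp [Sym2.mem_map]
  have hr : ∀ (v : W) (e : Sym2 W), (Sum.inr v : V ⊕ W) ∈ e.map Sum.inr ↔ v ∈ e := by
    intro v e; simp [Sym2.mem_map]
  have hlr : ∀ (v : V) (e : Sym2 W), (Sum.inl v : V ⊕ W) ∉ e.map Sum.inr := by
    intro v e; simp [Sym2.mem_map]
  have hrl : ∀ (v : W) (e : Sym2 V), (Sum.inr v : V ⊕ W) ∉ e.map Sum.inl := by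
    intro v e; simp [Sym2.mem_map]
  constructor
  · rintro ⟨hs, H⟩
    refine ⟨⟨fun e he => ?_, ?_⟩, ⟨fun e he => ?_, ?_⟩⟩
    · have : e ∈ fstPart (unionPart E F) := hs (.inl ⟨e, he, rfl⟩)
      simpa using this
    · rintro v ⟨e, he, hv⟩
      obtain ⟨e', ⟨⟨x, hx, rfl⟩ | ⟨x, hx, rfl⟩, h'⟩, hu⟩ :=
        H (.inl v) ⟨_, .inl ⟨e, he, rfl⟩, (hl v e).2 hv⟩
      · refine ⟨x, ⟨hx, (hl _ _).1 h'⟩, fun y hy => ?_⟩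
        exact Sym2.map.injective Sum.inl_injective (hu _ ⟨.inl ⟨y, hy.1, rfl⟩, (hl _ _).2 hy.2⟩)
      · exact absurd h' (hlr _ _)
    · have : e ∈ sndPart (unionPart E F) := hs (.inr ⟨e, he, rfl⟩)
      simpa using this
    · rintro v ⟨e, he, hv⟩
      obtain ⟨e', ⟨⟨x, hx, rfl⟩ | ⟨x, hx, rfl⟩, h'⟩, hu⟩ :=
        H (.inr v) ⟨_, .inr ⟨e, he, rfl⟩, (hr v e).2 hv⟩
      · exact absurd h' (hrl _ _)
      · refine ⟨x, ⟨hx, (hr _ _).1 h'⟩, fun y hy => ?_⟩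
        exact Sym2.map.injective Sum.inr_injective (hu _ ⟨.inr ⟨y, hy.1, rfl⟩, (hr _ _).2 hy.2⟩)
  · rintro ⟨⟨h1, H1⟩, ⟨h2, H2⟩⟩
    refine ⟨Set.union_subset_union (Set.image_mono h1) (Set.image_mono h2), ?_⟩
    rintro (v | v) ⟨_, ⟨e, he, rfl⟩ | ⟨e, he, rfl⟩, hv⟩
    · obtain ⟨x, ⟨hx, hx'⟩, hu⟩ := H1 v ⟨e, he, (hl _ _).1 hv⟩
      refine ⟨_, ⟨.inl ⟨x, hx, rfl⟩, (hl _ _).2 hx'⟩, ?_⟩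
      rintro _ ⟨⟨y, hy, rfl⟩ | ⟨y, hy, rfl⟩, hy'⟩
      · rw [hu y ⟨hy, (hl _ _).1 hy'⟩]
      · exact absurd hy' (hlr _ _)
    · exact absurd hv (hlr _ _)
    · exact absurd hv (hrl _ _)
    · obtain ⟨x, ⟨hx, hx'⟩, hu⟩ := H2 v ⟨e, he, (hr _ _).1 hv⟩
      refine ⟨_, ⟨.inr ⟨x, hx, rfl⟩, (hr _ _).2 hx'⟩, ?_⟩
      rintro _ ⟨⟨y, hy, rfl⟩ | ⟨y, hy, rfl⟩, hy'⟩
      · exact absurd hy' (hrl _ _)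
      · rw [hu y ⟨hy, (hr _ _).1 hy'⟩]

theorem mem_perfectMatchings_sum {G : SimpleGraph V} {H : SimpleGraph W}
    {P : Set (Sym2 (V ⊕ W))} :
    P ∈ perfectMatchings (SimpleGraph.sum G H) ↔
      ∃ P₁ ∈ perfectMatchings G, ∃ P₂ ∈ perfectMatchings H, unionPart P₁ P₂ = P := by
  simp only [perfectMatchings_eq, edgeSet_sum]
  constructor
  · intro h
    have hP : unionPart (fstPart P) (sndPart P) = P := by
      refine Set.Subset.antisymm ?_ fun e he => ?_
      · rintro _ (⟨e, he, rfl⟩ | ⟨e, he, rfl⟩) <;> exact he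
      · rcases h.1 he with ⟨x, -, rfl⟩ | ⟨x, -, rfl⟩
        exacts [.inl ⟨x, he, rfl⟩, .inr ⟨x, he, rfl⟩]
    rw [← hP] at h
    exact ⟨_, (isPM_unionPart.1 h).1, _, (isPM_unionPart.1 h).2, hP⟩
  · rintro ⟨P₁, h₁, P₂, h₂, rfl⟩
    exact isPM_unionPart.2 ⟨h₁, h₂⟩

end PerfectMatchings

/-! ### The tiles of a snake graph -/

namespace SnakeGraph

/-- The set of the tiles `G_i, ..., G_j`. -/
def tilesOf (G : SnakeGraph) (i j : ℕ) : Set Pt := {p | ∃ k, i ≤ k ∧ k ≤ j ∧ G.tile k = p}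

/-- The set of all tiles. -/
def tiles (G : SnakeGraph) : Set Pt := G.tilesOf 1 G.d

theorem edgesOf_eq (G : SnakeGraph) (i j : ℕ) : G.edgesOf i j = tileSetEdges (G.tilesOf i j) := by
  ext e
  rw [mem_tileSetEdges_iff]
  constructor
  · rintro ⟨k, h1, h2, h⟩
    exact ⟨_, ⟨k, h1, h2, rfl⟩, h⟩
  · rintro ⟨_, ⟨k, h1, h2, rfl⟩, h⟩
    exact ⟨k, h1, h2, h⟩

theorem edges_eq (G : SnakeGraph) : G.edges = tileSetEdges G.tiles := G.edgesOf_eq 1 G.d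

theorem one_le_d (G : SnakeGraph) : 1 ≤ G.d := by simp [d]

@[simp] theorem tile_one (G : SnakeGraph) : G.tile 1 = G.base := by simp [tile]

theorem tile_succ (G : SnakeGraph) {k : ℕ} (h1 : 1 ≤ k) (h2 : k < G.d) :
    G.tile (k + 1) = G.tile k + (G.dir k).step := by
  obtain ⟨k, rfl⟩ : ∃ j, k = j + 1 := ⟨k - 1, by omega⟩
  have hk : k < G.dirs.length := by simpa [d] using h2
  simp only [tile, dir, Nat.add_sub_cancel]
  rw [List.take_succ_eq_append_getElem hk]
  simp only [List.map_append, List.sum_append, List.map_cons, List.map_nil, List.sum_cons,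
    List.sum_nil, add_zero, add_assoc, List.getD_eq_getElem?_getD, List.getElem?_eq_getElem hk,
    Option.getD_some]

theorem lev_tile (G : SnakeGraph) {k : ℕ} (h1 : 1 ≤ k) (h2 : k ≤ G.d) :
    lev (G.tile k) = lev G.base + k - 1 := by
  induction k, h1 using Nat.le_induction with
  | base => simp
  | succ k hk ih =>
    rw [G.tile_succ hk (by omega), lev_add_step, ih (by omega)]
    push_cast; ring

theorem tile_mem (G : SnakeGraph) {k : ℕ} (h1 : 1 ≤ k) (h2 : k ≤ G.d) : G.tile k ∈ G.tiles :=
  ⟨k, h1, h2, rfl⟩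

theorem tile_inj (G : SnakeGraph) {k l : ℕ} (h1 : 1 ≤ k) (h2 : k ≤ G.d) (h3 : 1 ≤ l)
    (h4 : l ≤ G.d) (h : G.tile k = G.tile l) : k = l := by
  have := congrArg lev h
  rw [G.lev_tile h1 h2, G.lev_tile h3 h4] at this
  omega

theorem thin (G : SnakeGraph) : IsThin G.tiles := by
  rintro _ ⟨k, h1, h2, rfl⟩ _ ⟨l, h3, h4, rfl⟩ h
  rw [G.lev_tile h1 h2, G.lev_tile h3 h4] at h
  obtain rfl : k = l := by omega
  rfl

theorem tilesOf_mono (G : SnakeGraph) {i j i' j' : ℕ} (h : i' ≤ i) (h' : j ≤ j') :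
    G.tilesOf i j ⊆ G.tilesOf i' j' := by
  rintro p ⟨k, h1, h2, hp⟩
  exact ⟨k, by omega, by omega, hp⟩

theorem tile_mem_tilesOf (G : SnakeGraph) {i j k : ℕ} (hi : 1 ≤ i) (hj : j ≤ G.d) (h1 : 1 ≤ k)
    (h2 : k ≤ G.d) : G.tile k ∈ G.tilesOf i j ↔ i ≤ k ∧ k ≤ j := by
  constructor
  · rintro ⟨l, h3, h4, h⟩
    obtain rfl := G.tile_inj (by omega) (by omega) h1 h2 h
    exact ⟨h3, h4⟩
  · exact fun h => ⟨k, h.1, h.2, rfl⟩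

/-- The neighbour of a tile in the direction `a` is its successor, if it belongs to the graph. -/
theorem tile_add_step_mem (G : SnakeGraph) {k : ℕ} (h1 : 1 ≤ k) (h2 : k ≤ G.d) {a : Dir} :
    G.tile k + a.step ∈ G.tiles ↔ k < G.d ∧ a = G.dir k := by
  constructor
  · rintro ⟨l, h3, h4, h⟩
    have := congrArg lev h
    rw [lev_add_step, G.lev_tile h1 h2, G.lev_tile h3 h4] at this
    obtain rfl : l = k + 1 := by omega
    refine ⟨by omega, ?_⟩
    rw [G.tile_succ h1 (by omega)] at h
    exact (Dir.step_injective (add_left_cancel h)).symm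
  · rintro ⟨h, rfl⟩
    exact ⟨k + 1, by omega, by omega, G.tile_succ h1 h⟩

theorem tile_sub_step_mem (G : SnakeGraph) {k : ℕ} (h1 : 1 ≤ k) (h2 : k ≤ G.d) {a : Dir} :
    G.tile k - a.step ∈ G.tiles ↔ 1 < k ∧ a = G.dir (k - 1) := by
  constructor
  · rintro ⟨l, h3, h4, h⟩
    have := congrArg lev h
    rw [lev_sub_step, G.lev_tile h1 h2, G.lev_tile h3 h4] at this
    obtain rfl : k = l + 1 := by omega
    refine ⟨by omega, ?_⟩
    rw [G.tile_succ h3 (by omega), add_sub_assoc] at h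
    have : (G.dir l).step - a.step = 0 := by simpa using h.symm
    exact (Dir.step_injective (sub_eq_zero.1 this)).symm
  · rintro ⟨h, rfl⟩
    obtain ⟨k, rfl⟩ : ∃ j, k = j + 1 := ⟨k - 1, by omega⟩
    refine ⟨k, by omega, by omega, ?_⟩
    rw [G.tile_succ (by omega) (by omega)]; simp

theorem tile_pred (G : SnakeGraph) {k : ℕ} (h1 : 1 < k) (h2 : k ≤ G.d) :
    G.tile (k - 1) = G.tile k - (G.dir (k - 1)).step := by
  obtain ⟨k, rfl⟩ : ∃ j, k = j + 1 := ⟨k - 1, by omega⟩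
  rw [G.tile_succ (by omega) (by omega)]; simp

/-- A sequence of tiles is determined by its beginning and its directions. -/
theorem tile_eq_of_step (G : SnakeGraph) {τ : ℕ → Pt} {n : ℕ} (h1 : τ 1 = G.base)
    (h : ∀ k, 1 ≤ k → k < n → τ (k + 1) = τ k + (G.dir k).step) (hn : n ≤ G.d) {k : ℕ}
    (hk : 1 ≤ k) (hk' : k ≤ n) : G.tile k = τ k := by
  induction k, hk using Nat.le_induction with
  | base => simp [h1]
  | succ k hk ih => rw [G.tile_succ hk (by omega), h k hk (by omega), ih (by omega)]

theorem dir_eq_getD (b : Pt) (l : List Dir) (k : ℕ) :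
    (⟨b, l⟩ : SnakeGraph).dir k = (l[k - 1]?).getD .east := by
  simp [dir, List.getD_eq_getElem?_getD]

/-! #### Subgraphs -/

theorem sub_d (G : SnakeGraph) {i j : ℕ} (h1 : 1 ≤ i) (h2 : i ≤ j) (h3 : j ≤ G.d) :
    (G.sub i j).d = j - i + 1 := by
  simp only [d, sub, List.length_take, List.length_drop] at *
  omega

theorem sub_dir (G : SnakeGraph) {i j k : ℕ} (h1 : 1 ≤ i) (hk : 1 ≤ k) (hk' : k ≤ j - i) :
    (G.sub i j).dir k = G.dir (i + k - 1) := by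
  rw [sub, dir_eq_getD, List.getElem?_take_of_lt (by omega), List.getElem?_drop,
    show i - 1 + (k - 1) = i + k - 1 - 1 by omega]
  exact (dir_eq_getD G.base G.dirs _).symm

theorem sub_tile (G : SnakeGraph) {i j k : ℕ} (h1 : 1 ≤ i) (h2 : i ≤ j) (h3 : j ≤ G.d)
    (hk : 1 ≤ k) (hk' : k ≤ j - i + 1) : (G.sub i j).tile k = G.tile (i + k - 1) := by
  refine (G.sub i j).tile_eq_of_step (τ := fun k => G.tile (i + k - 1)) (n := j - i + 1) ?_ ?_
    (G.sub_d h1 h2 h3).ge hk hk'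
  · simp [sub]
  · intro k hk hk'
    rw [G.sub_dir h1 hk (by omega), ← G.tile_succ (by omega) (by omega)]
    congr 1
    omega

theorem sub_tiles (G : SnakeGraph) {i j : ℕ} (h1 : 1 ≤ i) (h2 : i ≤ j) (h3 : j ≤ G.d) :
    (G.sub i j).tiles = G.tilesOf i j := by
  ext p
  rw [tiles, G.sub_d h1 h2 h3]
  constructor
  · rintro ⟨k, h4, h5, rfl⟩
    exact ⟨i + k - 1, by omega, by omega, (G.sub_tile h1 h2 h3 h4 h5).symm⟩
  · rintro ⟨k, h4, h5, rfl⟩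
    refine ⟨k - i + 1, by omega, by omega, ?_⟩
    rw [G.sub_tile h1 h2 h3 (by omega) (by omega)]
    congr 1
    omega

theorem sub_last (G : SnakeGraph) {i j : ℕ} (h1 : 1 ≤ i) (h2 : i ≤ j) (h3 : j ≤ G.d) :
    (G.sub i j).last = G.tile j := by
  rw [last, G.sub_d h1 h2 h3, G.sub_tile h1 h2 h3 (by omega) le_rfl]
  congr 1
  omega

/-! #### Gluing -/

theorem glue_d (A : SnakeGraph) (a : Dir) (B : SnakeGraph) : (glue A a B).d = A.d + B.d := by
  simp only [glue, d, List.length_append, List.length_cons]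
  omega

theorem glue_dir_left (A : SnakeGraph) (a : Dir) (B : SnakeGraph) {k : ℕ} (hk : 1 ≤ k)
    (hk' : k < A.d) : (glue A a B).dir k = A.dir k := by
  simp only [d] at hk'
  rw [glue, dir_eq_getD, List.getElem?_append_left (by omega)]
  exact (dir_eq_getD A.base A.dirs k).symm

theorem glue_dir_mid (A : SnakeGraph) (a : Dir) (B : SnakeGraph) : (glue A a B).dir A.d = a := by
  rw [glue, dir_eq_getD, d, List.getElem?_append_right (by omega)]
  simp

theorem glue_dir_right (A : SnakeGraph) (a : Dir) (B : SnakeGraph) {k : ℕ} (hk : 1 ≤ k) :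
    (glue A a B).dir (A.d + k) = B.dir k := by
  rw [glue, dir_eq_getD, d, List.getElem?_append_right (by omega),
    show A.dirs.length + 1 + k - 1 - A.dirs.length = (k - 1) + 1 by omega, List.getElem?_cons_succ]
  exact (dir_eq_getD B.base B.dirs k).symm

theorem glue_tile_left (A : SnakeGraph) (a : Dir) (B : SnakeGraph) {k : ℕ} (hk : 1 ≤ k)
    (hk' : k ≤ A.d) : (glue A a B).tile k = A.tile k := by
  refine (glue A a B).tile_eq_of_step (τ := A.tile) (n := A.d) ?_ ?_
    (by rw [glue_d]; omega) hk hk'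
  · simp [glue]
  · intro k hk hk'
    rw [glue_dir_left A a B hk hk', A.tile_succ hk hk']

theorem glue_tile_right (A : SnakeGraph) (a : Dir) (B : SnakeGraph) {k : ℕ} (hk : 1 ≤ k)
    (hk' : k ≤ B.d) :
    (glue A a B).tile (A.d + k) = B.tile k + (A.last + a.step - B.base) := by
  induction k, hk using Nat.le_induction with
  | base =>
    rw [(glue A a B).tile_succ A.one_le_d (by rw [glue_d]; omega), glue_dir_mid,
      glue_tile_left A a B A.one_le_d le_rfl, tile_one, last]
    abel
  | succ k hk ih =>
    rw [← add_assoc, (glue A a B).tile_succ (by omega) (by rw [glue_d]; omega),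
      glue_dir_right A a B hk, ih (by omega), B.tile_succ hk (by omega)]
    abel

theorem glue_tiles (A : SnakeGraph) (a : Dir) (B : SnakeGraph) :
    (glue A a B).tiles = A.tiles ∪ (fun p => p + (A.last + a.step - B.base)) '' B.tiles := by
  ext p
  constructor
  · rintro ⟨k, h1, h2, rfl⟩
    rw [glue_d] at h2
    by_cases hk : k ≤ A.d
    · exact .inl ⟨k, h1, hk, (glue_tile_left A a B h1 hk).symm⟩
    · refine .inr ⟨B.tile (k - A.d), ⟨k - A.d, by omega, by omega, rfl⟩, ?_⟩
      simp only
      rw [← glue_tile_right A a B (by omega) (by omega)]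
      congr 1
      omega
  · rintro (⟨k, h1, h2, rfl⟩ | ⟨_, ⟨k, h1, h2, rfl⟩, rfl⟩)
    · exact ⟨k, h1, by rw [glue_d]; omega, glue_tile_left A a B h1 h2⟩
    · exact ⟨A.d + k, by omega, by rw [glue_d]; omega, glue_tile_right A a B h1 h2⟩

/-! #### Switching -/

section Switch

variable {G H : SnakeGraph} {t t' : ℕ} (ht : 1 ≤ t) (htd : t ≤ G.d) (ht' : 1 ≤ t')
  (htd' : t' ≤ H.d)

include ht htd ht' htd' in
theorem switchGraph_d : (switchGraph G H t t').d = t + (H.d - t') := by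
  simp only [switchGraph, d, List.length_append, List.length_take, List.length_drop] at *
  omega

include htd in
theorem switchGraph_dir_left {k : ℕ} (hk : 1 ≤ k) (hk' : k < t) :
    (switchGraph G H t t').dir k = G.dir k := by
  simp only [d] at htd
  rw [switchGraph, dir_eq_getD, List.getElem?_append_left (by simp; omega),
    List.getElem?_take_of_lt (by omega)]
  exact (dir_eq_getD G.base G.dirs k).symm

-- The list of `G` is cut before the step that leaves `G_t`, so this step is already taken from `H`.
-- No upper bound on `k` is needed, since beyond the last tile both sides take the same default
-- value.
include ht htd ht' in
theorem switchGraph_dir_right (k : ℕ) :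
    (switchGraph G H t t').dir (t + k) = H.dir (t' + k) := by
  simp only [d] at htd
  rw [switchGraph, dir_eq_getD, List.getElem?_append_right (by simp; omega), List.getElem?_drop,
    List.length_take, show t' - 1 + (t + k - 1 - min (t - 1) G.dirs.length) = t' + k - 1 by omega]
  exact (dir_eq_getD H.base H.dirs _).symm

include ht htd ht' htd' in
theorem switchGraph_tile_left {k : ℕ} (hk : 1 ≤ k) (hk' : k ≤ t) :
    (switchGraph G H t t').tile k = G.tile k := by
  refine (switchGraph G H t t').tile_eq_of_step (τ := G.tile) (n := t) ?_ ?_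
    (by rw [switchGraph_d ht htd ht' htd']; omega) hk hk'
  · simp [switchGraph]
  · intro k hk hk'
    rw [switchGraph_dir_left htd hk hk', G.tile_succ hk (by omega)]

include ht htd ht' htd' in
theorem switchGraph_tile_right (h : G.tile t = H.tile t') {k : ℕ} (hk : k ≤ H.d - t') :
    (switchGraph G H t t').tile (t + k) = H.tile (t' + k) := by
  induction k with
  | zero => exact (switchGraph_tile_left ht htd ht' htd' ht le_rfl).trans h
  | succ k ih =>
    rw [← add_assoc, (switchGraph G H t t').tile_succ (by omega)
      (by rw [switchGraph_d ht htd ht' htd']; omega), switchGraph_dir_right ht htd ht',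
      ih (by omega), ← add_assoc, H.tile_succ (by omega) (by omega)]

include ht htd ht' htd' in
theorem switchGraph_tiles (h : G.tile t = H.tile t') :
    (switchGraph G H t t').tiles = G.tilesOf 1 t ∪ H.tilesOf (t' + 1) H.d := by
  ext p
  constructor
  · rintro ⟨k, h1, h2, rfl⟩
    rw [switchGraph_d ht htd ht' htd'] at h2
    by_cases hk : k ≤ t
    · exact .inl ⟨k, h1, hk, (switchGraph_tile_left ht htd ht' htd' h1 hk).symm⟩
    · refine .inr ⟨t' + (k - t), by omega, by omega, ?_⟩
      rw [← switchGraph_tile_right ht htd ht' htd' h (by omega)]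
      congr 1
      omega
  · rintro (⟨k, h1, h2, rfl⟩ | ⟨k, h1, h2, rfl⟩)
    · exact ⟨k, h1, by rw [switchGraph_d ht htd ht' htd']; omega,
        switchGraph_tile_left ht htd ht' htd' h1 h2⟩
    · refine ⟨t + (k - t'), by omega, by rw [switchGraph_d ht htd ht' htd']; omega, ?_⟩
      rw [switchGraph_tile_right ht htd ht' htd' h (by omega)]
      congr 1
      omega

end Switch

end SnakeGraph

/-! #### Reflections -/

/-- The effect of the reflection in the line `y = -x` on tiles. -/
def barTile (q : Pt) : Pt := barPt (q + (1, 1))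

@[simp] theorem barTile_barTile (q : Pt) : barTile (barTile q) = q := by
  simp [barTile, barPt]

theorem barTile_injective : Function.Injective barTile :=
  Function.LeftInverse.injective barTile_barTile

/-- The reflection carries the north-east corner of a tile to the south-west corner of its image,
whence the shift by `(1, 1)` in `barTile`. It reverses the order of the tiles and interchanges the
two directions. -/
theorem barTile_add_step (q : Pt) (a : Dir) : barTile (q + a.step) = barTile q - a.other.step := by
  cases a <;> simp [barTile, barPt, Dir.step, Dir.other] <;> ring

theorem barPt_injective : Function.Injective barPt := fun p q h => by
  simp only [barPt, Prod.mk.injEq, neg_inj] at h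
  exact Prod.ext h.2 h.1

@[simp] theorem barPt_barPt (q : Pt) : barPt (barPt q) = q := by simp [barPt]

@[simp] theorem barEdge_barEdge (e : Edge) : barEdge (barEdge e) = e := by
  simp [barEdge, Sym2.map_map, Sym2.map_id']

/-- South and west edges become east and north edges of the reflected tile, so the normal form is
based at the next tile. -/
theorem barEdge_seg (p : Pt) (a : Dir) : barEdge (seg p a) = seg (barTile p + a.other.step) a.other := by
  rw [← sideOut_eq_seg]
  cases a <;> simp [barEdge, seg, sideIn, sideOut, southE, westE, northE, eastE, barTile, barPt,
    Dir.other, Sym2.eq_swap]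

namespace SnakeGraph

theorem bar_d (G : SnakeGraph) : G.bar.d = G.d := by simp [bar, d]

theorem bar_dir (G : SnakeGraph) {k : ℕ} (h1 : 1 ≤ k) (h2 : k < G.d) :
    G.bar.dir k = (G.dir (G.d - k)).other := by
  simp only [d] at h2 ⊢
  rw [bar, dir_eq_getD, List.getElem?_reverse (by simp; omega), List.getElem?_map,
    List.length_map, List.getElem?_eq_getElem (by omega)]
  simp only [dir, Option.map_some, Option.getD_some, List.getD_eq_getElem?_getD]
  rw [List.getElem?_eq_getElem (by omega)]
  simp only [Option.getD_some]
  congr 2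
  omega

theorem bar_tile (G : SnakeGraph) {k : ℕ} (h1 : 1 ≤ k) (h2 : k ≤ G.d) :
    G.bar.tile k = barTile (G.tile (G.d + 1 - k)) := by
  refine G.bar.tile_eq_of_step (τ := fun k => barTile (G.tile (G.d + 1 - k))) (n := G.d) ?_ ?_
    G.bar_d.ge h1 h2
  · simp [bar, barTile, last]
  · intro k hk hk'
    rw [G.bar_dir hk hk', show G.d + 1 - k = (G.d - k) + 1 by omega,
      show G.d + 1 - (k + 1) = G.d - k by omega, G.tile_succ (k := G.d - k) (by omega) (by omega),
      barTile_add_step]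
    simp

theorem bar_tiles (G : SnakeGraph) : G.bar.tiles = barTile '' G.tiles := by
  ext p
  rw [tiles, bar_d]
  constructor
  · rintro ⟨k, h1, h2, rfl⟩
    exact ⟨_, ⟨G.d + 1 - k, by omega, by omega, rfl⟩, (G.bar_tile h1 h2).symm⟩
  · rintro ⟨_, ⟨k, h1, h2, rfl⟩, rfl⟩
    refine ⟨G.d + 1 - k, by omega, by omega, ?_⟩
    rw [G.bar_tile (by omega) (by omega)]
    congr 2
    omega

end SnakeGraph

/-! ### Perfect matchings of snake graphs -/

@[simp] theorem Dir.step_ne_zero (a : Dir) : a.step ≠ 0 := by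
  cases a <;> simp [Dir.step]

theorem not_isDiag_seg (p : Pt) (a : Dir) : ¬ (seg p a).IsDiag := by
  cases a <;> simp [seg, sideIn, southE, westE]

theorem not_isDiag_of_mem_segs {e : Edge} (he : e ∈ segs) : ¬ e.IsDiag := by
  obtain ⟨p, a, rfl⟩ := he
  exact not_isDiag_seg p a

theorem le_of_mem_tileEdges {q v : Pt} {e : Edge} (he : e ∈ tileEdges q) (hv : v ∈ e) :
    v ≤ q + (1, 1) := by
  obtain ⟨q1, q2⟩ := q
  rcases he with rfl | rfl | rfl | rfl <;> rcases Sym2.mem_iff.1 hv with rfl | rfl <;>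
    simp [Prod.le_def]

theorem SnakeGraph.tile_le_tile (G : SnakeGraph) {k l : ℕ} (h1 : 1 ≤ k) (hkl : k ≤ l)
    (hl : l ≤ G.d) : G.tile k ≤ G.tile l := by
  induction l, hkl using Nat.le_induction with
  | base => rfl
  | succ l hkl ih =>
    refine (ih (by omega)).trans ?_
    rw [G.tile_succ (by omega) (by omega)]
    refine le_add_of_nonneg_right ?_
    cases G.dir l <;> simp [Dir.step, Prod.le_def]

/-- This bound shows that a tile appended to the last one brings two new vertices. -/
theorem SnakeGraph.le_of_mem_edges (G : SnakeGraph) {v : Pt} {e : Edge} (he : e ∈ G.edges)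
    (hv : v ∈ e) : v ≤ G.last + (1, 1) := by
  obtain ⟨k, h1, h2, h⟩ := he
  exact (le_of_mem_tileEdges h hv).trans (add_le_add_left (G.tile_le_tile h1 h2 le_rfl) _)

/-- Attaching a tile along its edge `seg r c`. -/
theorem isPM_attach_tile {E : Set Edge} {r : Pt} {c : Dir} (hE : seg r c ∈ E)
    (h : ∀ e ∈ E, ∀ v ∈ e, ¬ r + c.step ≤ v) (P : Set Edge) :
    IsPM (E ∪ tileEdges r) P ↔
      (∃ Q, IsPM E Q ∧ P = Q ∪ {seg (r + c.step) c}) ∨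
      (∃ Q, IsPM E Q ∧ seg r c ∈ Q ∧
        P = Q \ {seg r c} ∪ {seg r c.other, seg (r + c.other.step) c.other}) := by
  -- The tile is attached along the edge from `r` to `r + c.other.step`; its new vertices are `r +
  -- c.step` and `r + (1, 1)`.
  have e1 : seg r c = s(r, r + c.other.step) := by cases c <;> rfl
  have e2 : seg r c.other = s(r, r + c.step) := by cases c <;> rfl
  have e3 : seg (r + c.other.step) c.other = s(r + c.other.step, r + (1, 1)) := by
    cases c <;> simp [seg, sideIn, southE, westE, Dir.other, Dir.step, add_assoc]
  have e4 : seg (r + c.step) c = s(r + c.step, r + (1, 1)) := by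
    cases c <;> simp [seg, sideIn, southE, westE, Dir.step, add_assoc]
  have hset : E ∪ tileEdges r = E ∪ {seg r c.other, seg (r + c.other.step) c.other,
      seg (r + c.step) c} := by
    ext e
    simp only [Set.mem_union, mem_tileEdges, Set.mem_insert_iff, Set.mem_singleton_iff]
    constructor
    · rintro (he | ⟨p, a, rfl, h | rfl⟩)
      · exact .inl he
      · subst h
        by_cases hac : a = c
        · exact .inl (hac ▸ hE)
        · exact .inr (.inl (by rw [Dir.ne_iff.1 hac]))
      · by_cases hac : a = c
        · exact .inr (.inr (.inr (by simp [hac])))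
        · exact .inr (.inr (.inl (by simp [Dir.ne_iff.1 hac])))
    · rintro (he | rfl | rfl | rfl)
      · exact .inl he
      · exact .inr ⟨_, _, rfl, .inl rfl⟩
      · exact .inr ⟨_, _, rfl, .inr (by simp)⟩
      · exact .inr ⟨_, _, rfl, .inr (by simp)⟩
  rw [hset, e2, e3, e4, e1]
  refine isPM_attach (e1 ▸ hE) ?_ ?_ (fun e he hv => h e he _ hv le_rfl)
    (fun e he hv => h e he _ hv ?_) P
  · cases c <;> simp [Dir.other, Dir.step]
  · cases c <;> simp [Dir.step]
  · cases c <;> simp [Dir.step, Prod.le_def]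

/-- Attaching a tile to a set of tiles, in terms of words. -/
theorem isPM_insert_iff {T : Set Pt} {q r : Pt} {c : Dir} (hr : r = q + c.step)
    (hq : q ∈ T) (hT : ∀ p ∈ T, lev p < lev r) (hthin : IsThin T)
    (h : ∀ e ∈ tileSetEdges T, ∀ v ∈ e, ¬ r + c.step ≤ v)
    (ih : ∀ P, IsPM (tileSetEdges T) P ↔ ∃ h, IsWord T h ∧ P = wordEdges T h) (P : Set Edge) :
    IsPM (tileSetEdges (insert r T)) P ↔
      ∃ h, IsWord (insert r T) h ∧ P = wordEdges (insert r T) h := by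
  have hrT : r ∉ T := fun h => (hT r h).false
  have hrcT : ∀ a : Dir, r + a.step ∉ T := fun a h => by have := hT _ h; simp at this
  have hne : ∀ a : Dir, r + a.step ≠ r := fun a h => by have := congrArg lev h; simp at this
  have hne' : ∀ a : Dir, r - a.step ≠ r := fun a h => by have := congrArg lev h; simp at this
  have hrm : r - c.step = q := by simp [hr]
  -- The two possible predecessors of `r` lie on the same antidiagonal, and a thin set contains only
  -- one of them.
  have hrcm : r - c.other.step ∉ T := fun h => by
    have := hthin _ hq _ h (by rw [← hrm]; simp)
    rw [← hrm] at this
    exact c.other_ne (Dir.step_injective (sub_right_injective this.symm))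
  have hset : tileSetEdges (insert r T) = tileSetEdges T ∪ tileEdges r := by
    ext e
    simp only [mem_tileSetEdges_iff, Set.mem_insert_iff, Set.mem_union]
    constructor
    · rintro ⟨q, rfl | hq, he⟩
      exacts [.inr he, .inl ⟨q, hq, he⟩]
    · rintro (⟨q, hq, he⟩ | he)
      exacts [⟨q, .inr hq, he⟩, ⟨_, .inl rfl, he⟩]
  have hedge : seg r c ∈ tileSetEdges T := seg_mem_tileSetEdges.2 (.inr (by rwa [hrm]))
  -- the two ways in which a word can be continued
  have hcont1 : ∀ k : Pt → Dir, k r = c →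
      wordEdges (insert r T) k = wordEdges T k ∪ {seg (r + c.step) c} := by
    intro k hk
    refine segs_ext (wordEdges_subset_segs _ _) ?_ fun p a => ?_
    · exact Set.union_subset (wordEdges_subset_segs _ _) (by rintro _ rfl; exact ⟨_, _, rfl⟩)
    simp only [seg_mem_wordEdges, Set.mem_union, Set.mem_insert_iff, Set.mem_singleton_iff, seg_inj]
    by_cases hp : p = r
    · subst hp
      have h1 := hne' a
      by_cases hac : a = c
      · subst hac
        have h0 := a.step_ne_zero.symm
        simp [h0, hrT, hk, hrm, hq, eq_comm]
      · have hac' := Dir.ne_iff.1 hac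
        subst hac'
        simp [hrT, hk, hrcm, c.other_ne.symm, c.other_ne]
    · by_cases hp' : p - a.step = r
      · have : p = r + a.step := by rw [← hp']; simp
        subst this
        simp [hrcT, hk, hne, hrT]
        constructor
        · rintro rfl; simp
        · exact fun h => h.2.symm
      · have : ¬ (p = r + c.step ∧ a = c) := by
          rintro ⟨rfl, rfl⟩; simp at hp'
        simp [hp, hp', this]
  have hcont2 : ∀ k : Pt → Dir, k r = c.other → k q = c →
      wordEdges (insert r T) k =
        wordEdges T k \ {seg r c} ∪ {seg r c.other, seg (r + c.other.step) c.other} := by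
    intro k hk hkq
    refine segs_ext (wordEdges_subset_segs _ _) ?_ fun p a => ?_
    · refine Set.union_subset (Set.sdiff_subset.trans (wordEdges_subset_segs _ _)) ?_
      rintro _ (rfl | rfl) <;> exact ⟨_, _, rfl⟩
    simp only [seg_mem_wordEdges, Set.mem_union, Set.mem_insert_iff, Set.mem_singleton_iff, seg_inj,
      Set.mem_sdiff]
    by_cases hp : p = r
    · subst hp
      have h1 := hne' a
      by_cases hac : a = c
      · subst hac
        simp [hrT, hk, hrm, hq, a.other_ne, a.other_ne.symm]
      · have hac' := Dir.ne_iff.1 hac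
        subst hac'
        simp [hrT, hk, hrcm]
    · by_cases hp' : p - a.step = r
      · have : p = r + a.step := by rw [← hp']; simp
        subst this
        simp [hrcT, hk, hne, hrT]
        constructor
        · rintro rfl; simp
        · exact fun h => h.2.symm
      · have : ¬ (p = r + c.other.step ∧ a = c.other) := by
          rintro ⟨rfl, rfl⟩; simp at hp'
        simp [hp, hp', this]
  have hword : ∀ k : Pt → Dir, IsWord (insert r T) k ↔ IsWord T k ∧ (k q = c ∨ k r = c) := by
    intro k
    constructor
    · intro H
      refine ⟨H.mono (Set.subset_insert _ _), ?_⟩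
      rw [hr]
      exact H q c (.inr hq) (.inl hr.symm)
    · rintro ⟨H, H'⟩ p a (rfl | hp) (hpa | hpa)
      · exact absurd hpa (hne a)
      · exact absurd hpa (hrcT a)
      · have : p = r - a.step := by rw [← hpa]; simp
        subst this
        by_cases hac : a = c
        · subst hac
          rw [hpa, hrm]; exact H'
        · rw [Dir.ne_iff.1 hac] at hp
          exact absurd hp hrcm
      · exact H p a hp hpa
  have hupd : ∀ (k : Pt → Dir) (x : Dir), Set.EqOn k (Function.update k r x) T := by
    intro k x p hp
    rw [Function.update_of_ne]
    rintro rfl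
    exact hrT hp
  have hqr : q ≠ r := fun h => hrT (h ▸ hq)
  have hqc : ∀ k : Pt → Dir, seg r c ∈ wordEdges T k ↔ k q = c := by
    intro k
    simp [seg_mem_wordEdges, hrT, hrm, hq]
  -- Using the far edge of the new tile corresponds to the value `c` at `r`. Using the two side
  -- edges corresponds to the other value, and the required presence of `seg r c` in the old
  -- matching is the condition `k q = c`, which is the adjacency condition in that case.
  rw [hset, isPM_attach_tile hedge h]
  constructor
  · rintro (⟨Q, hQ, rfl⟩ | ⟨Q, hQ, hQe, rfl⟩)
    · obtain ⟨k, hk, rfl⟩ := (ih Q).1 hQ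
      refine ⟨Function.update k r c, (hword _).2 ⟨hk.congr (hupd k c), .inr (by simp)⟩, ?_⟩
      rw [hcont1 _ (by simp), ← wordEdges_congr (hupd k c)]
    · obtain ⟨k, hk, rfl⟩ := (ih Q).1 hQ
      have hkq := (hqc k).1 hQe
      have hkq' : Function.update k r c.other q = c := by rwa [Function.update_of_ne hqr]
      refine ⟨Function.update k r c.other,
        (hword _).2 ⟨hk.congr (hupd k c.other), .inl hkq'⟩, ?_⟩
      rw [hcont2 _ (by simp) hkq', ← wordEdges_congr (hupd k c.other)]
  · rintro ⟨k, hk, rfl⟩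
    obtain ⟨hk, hk'⟩ := (hword k).1 hk
    by_cases hkr : k r = c
    · exact .inl ⟨_, (ih _).2 ⟨k, hk, rfl⟩, hcont1 k hkr⟩
    · have hkq := hk'.resolve_right hkr
      exact .inr ⟨_, (ih _).2 ⟨k, hk, rfl⟩, (hqc k).2 hkq, hcont2 k (Dir.ne_iff.1 hkr) hkq⟩

/-- A tile arises by attaching it to its own south edge, which has a single matching; the two ways
of continuing it are the two orientations. -/
theorem isPM_singleton_tile (q : Pt) (P : Set Edge) :
    IsPM (tileSetEdges {q}) P ↔ ∃ h, IsWord {q} h ∧ P = wordEdges {q} h := by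
  have hset : tileSetEdges {q} = {seg q .north} ∪ tileEdges q := by
    rw [← tileEdges_eq, Set.union_eq_self_of_subset_left]
    rintro _ rfl
    exact seg_mem_tileEdges.2 (.inl rfl)
  have hword : ∀ k : Pt → Dir, IsWord {q} k := by
    rintro k _ a rfl h
    have := congrArg lev (Set.mem_singleton_iff.1 h)
    simp at this
  have hne : ∀ a : Dir, q - a.step ≠ q := fun a h => by have := congrArg lev h; simp at this
  have hne' : ∀ a : Dir, q + a.step ≠ q := fun a h => by have := congrArg lev h; simp at this
  have hc : ∀ k : Pt → Dir, wordEdges {q} k = {seg q (k q), seg (q + (k q).step) (k q)} := by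
    intro k
    refine segs_ext (wordEdges_subset_segs _ _) ?_ fun p a => ?_
    · rintro _ (rfl | rfl) <;> exact ⟨_, _, rfl⟩
    simp only [seg_mem_wordEdges, Set.mem_insert_iff, Set.mem_singleton_iff, seg_inj]
    constructor
    · rintro ⟨rfl | rfl, h1, h2⟩
      · exact .inl ⟨rfl, (h1 rfl).symm⟩
      · have h := h2 rfl
        rw [h]
        simp
    · rintro (⟨rfl, rfl⟩ | ⟨rfl, rfl⟩)
      · simp [hne]
      · simp [hne']
  rw [hset, isPM_attach_tile (E := {seg q .north}) (Set.mem_singleton _)]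
  · simp only [isPM_singleton]
    constructor
    · rintro (⟨_, rfl, rfl⟩ | ⟨_, rfl, -, rfl⟩)
      · exact ⟨fun _ => .north, hword _, by rw [hc]; rfl⟩
      · refine ⟨fun _ => .east, hword _, ?_⟩
        rw [hc]
        simp [Dir.other]
    · rintro ⟨k, -, rfl⟩
      rw [hc]
      cases k q
      · exact .inl ⟨_, rfl, rfl⟩
      · exact .inr ⟨_, rfl, rfl, by simp [Dir.other]⟩
  · rintro _ rfl v hv hle
    rcases Sym2.mem_iff.1 hv with rfl | rfl <;> simp [Dir.step, Prod.le_def] at hle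

/-- The perfect matchings of a snake graph are given by words. -/
theorem SnakeGraph.isPM_iff (G : SnakeGraph) (P : Set Edge) :
    IsPM G.edges P ↔ ∃ h, IsWord G.tiles h ∧ P = wordEdges G.tiles h := by
  obtain ⟨b, l⟩ := G
  rw [edges_eq]
  -- Tiles are appended at the end; appending one is gluing a one-tile snake graph, whose base may
  -- be chosen arbitrarily.
  induction l using List.reverseRecOn generalizing P with
  | nil =>
    have : (⟨b, []⟩ : SnakeGraph).tiles = {b} := by
      ext p
      constructor
      · rintro ⟨k, h1, h2, rfl⟩
        obtain rfl : k = 1 := le_antisymm h2 h1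
        simp
      · rintro rfl
        exact ⟨1, le_rfl, le_rfl, by simp⟩
    rw [this]
    exact isPM_singleton_tile b P
  | append_singleton l c ih =>
    set A : SnakeGraph := ⟨b, l⟩ with hA
    have hd : (⟨b, l ++ [c]⟩ : SnakeGraph).d = A.d + 1 := by simp [d, hA]
    have htile : ∀ k, 1 ≤ k → k ≤ A.d → (⟨b, l ++ [c]⟩ : SnakeGraph).tile k = A.tile k :=
      fun k h1 h2 => glue_tile_left A c ⟨b, []⟩ h1 h2
    have hlast : (⟨b, l ++ [c]⟩ : SnakeGraph).tile (A.d + 1) = A.last + c.step := by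
      have := glue_tile_right A c ⟨b, []⟩ (k := 1) le_rfl le_rfl
      simp only [tile_one] at this
      refine this.trans ?_
      abel
    have htiles : (⟨b, l ++ [c]⟩ : SnakeGraph).tiles = insert (A.last + c.step) A.tiles := by
      ext p
      rw [tiles, hd]
      constructor
      · rintro ⟨k, h1, h2, rfl⟩
        rcases Nat.lt_or_ge A.d k with h | h
        · obtain rfl : k = A.d + 1 := by omega
          exact .inl hlast
        · exact .inr ⟨k, h1, h, (htile k h1 h).symm⟩
      · rintro (rfl | ⟨k, h1, h2, rfl⟩)
        · exact ⟨_, by omega, le_rfl, hlast⟩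
        · exact ⟨k, h1, by omega, htile k h1 h2⟩
    rw [htiles]
    refine isPM_insert_iff (q := A.last) rfl (A.tile_mem A.one_le_d le_rfl) ?_ A.thin ?_ ih P
    · rintro _ ⟨k, h1, h2, rfl⟩
      rw [lev_add_step, show A.last = A.tile A.d from rfl, A.lev_tile h1 h2, A.lev_tile A.one_le_d le_rfl]
      omega
    · intro e he v hv hle
      rw [← edges_eq] at he
      have := hle.trans (A.le_of_mem_edges he hv)
      cases c <;> simp [Dir.step, Prod.le_def] at this

/-! ### Switching of words on two overlapping sets of tiles -/

/-- Two sets of tiles with the maximal common part between the tiles `r₀` and `r₁`. -/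
structure Overlapping (T₁ T₂ : Set Pt) (r₀ r₁ : Pt) : Prop where
  thin₁ : IsThin T₁
  thin₂ : IsThin T₂
  mem₀ : r₀ ∈ T₁
  mem₁ : r₁ ∈ T₁
  le : lev r₀ ≤ lev r₁
  agree : ∀ p, lev r₀ ≤ lev p → lev p ≤ lev r₁ → (p ∈ T₁ ↔ p ∈ T₂)
  left : ∀ a, r₀ - Dir.step a ∈ T₁ → r₀ - Dir.step a ∉ T₂
  right : ∀ a, r₁ + Dir.step a ∈ T₁ → r₁ + Dir.step a ∉ T₂
  succ : ∀ p ∈ T₁, lev r₀ ≤ lev p → lev p < lev r₁ → ∃ a, p + Dir.step a ∈ T₁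

/-- The tiles of `T₁` up to the antidiagonal `c` and the tiles of `T₂` after it. -/
def swapTiles (c : ℤ) (T₁ T₂ : Set Pt) : Set Pt :=
  {p | (lev p ≤ c ∧ p ∈ T₁) ∨ (c < lev p ∧ p ∈ T₂)}

/-- The word that follows `h` up to the antidiagonal `c` and `k` after it. -/
def swapWord (c : ℤ) (h k : Pt → Dir) : Pt → Dir := fun p => if lev p ≤ c then h p else k p

theorem swapWord_of_le {c : ℤ} {h k : Pt → Dir} {p : Pt} (hp : lev p ≤ c) :
    swapWord c h k p = h p := if_pos hp

theorem swapWord_of_lt {c : ℤ} {h k : Pt → Dir} {p : Pt} (hp : c < lev p) :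
    swapWord c h k p = k p := if_neg hp.not_ge

theorem mem_swapTiles_of_le {c : ℤ} {T₁ T₂ : Set Pt} {p : Pt} (hp : lev p ≤ c) :
    p ∈ swapTiles c T₁ T₂ ↔ p ∈ T₁ := by
  simp [swapTiles, hp, hp.not_gt]

theorem mem_swapTiles_of_lt {c : ℤ} {T₁ T₂ : Set Pt} {p : Pt} (hp : c < lev p) :
    p ∈ swapTiles c T₁ T₂ ↔ p ∈ T₂ := by
  simp [swapTiles, hp, hp.not_ge]

/-- Together with the analogous statement for words this makes the exchange of tails its own
inverse, the source of the bijection onto the matchings of `G_3` and `G_4`. -/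
theorem swapTiles_swapTiles (c : ℤ) (T₁ T₂ : Set Pt) :
    swapTiles c (swapTiles c T₁ T₂) (swapTiles c T₂ T₁) = T₁ := by
  ext p
  rcases le_or_gt (lev p) c with hp | hp
  · rw [mem_swapTiles_of_le hp, mem_swapTiles_of_le hp]
  · rw [mem_swapTiles_of_lt hp, mem_swapTiles_of_lt hp]

theorem swapWord_swapWord (c : ℤ) (h k : Pt → Dir) :
    swapWord c (swapWord c h k) (swapWord c k h) = h := by
  ext p
  unfold swapWord
  split_ifs <;> rfl

theorem seg_add_step_mem_wordEdges {T : Set Pt} {h : Pt → Dir} {r : Pt} {a : Dir} (hr : r ∈ T) :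
    seg (r + a.step) a ∈ wordEdges T h ↔ h r = a ∧ (r + a.step ∈ T → h (r + a.step) = a) := by
  simp [seg_mem_wordEdges, hr, and_comm]

theorem seg_self_mem_wordEdges {T : Set Pt} {h : Pt → Dir} {r : Pt} {a : Dir} (hr : r ∈ T) :
    seg r a ∈ wordEdges T h ↔ h r = a ∧ (r - a.step ∈ T → h (r - a.step) = a) := by
  simp [seg_mem_wordEdges, hr]

theorem inter_tileEdges_eq_iff {A B : Set Edge} {r : Pt} :
    A ∩ tileEdges r = B ∩ tileEdges r ↔
      ∀ a, (seg r a ∈ A ↔ seg r a ∈ B) ∧ (seg (r + a.step) a ∈ A ↔ seg (r + a.step) a ∈ B) := by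
  constructor
  · intro h a
    constructor
    · have := Set.ext_iff.1 h (seg r a)
      simpa [seg_mem_tileEdges] using this
    · have := Set.ext_iff.1 h (seg (r + a.step) a)
      simpa [seg_mem_tileEdges] using this
  · intro h
    ext e
    refine and_congr_left fun he => ?_
    obtain ⟨p, a, rfl, h' | h'⟩ := mem_tileEdges.1 he
    · rw [h']; exact (h a).1
    · obtain rfl : p = r + a.step := by rw [← h']; simp
      exact (h a).2

/-- `p` and `q` say that the two words have the value `a` at a tile, `B` and `C` that the neighbours
across one side, if present, have it too; thus `p ∧ B` means that the edge on this side is in the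
matching. Unless `p` and `q` both hold, the conditions force `B` and `C`; if both hold, the two
memberships are merely interchanged. -/
theorem count_switch {p q B C : Prop} (h1 : p ∨ B) (h2 : q ∨ C) (h3 : p ∨ C) (h4 : q ∨ B) :
    ((p ∧ C) ∧ (q ∧ B) ↔ (p ∧ B) ∧ (q ∧ C)) ∧ (((p ∧ C) ∨ (q ∧ B)) ↔ ((p ∧ B) ∨ (q ∧ C))) := by
  tauto

/-- The converse: the number of occurrences of an edge before and after the switch determines how
often the value occurs at the tile. If `B` fails, `p` and `q'` hold; if `C` fails, `q` and `p'` do;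
so an absent edge causes no ambiguity. -/
theorem count_of_switch {p q p' q' B C : Prop} (h1 : p ∨ B) (h2 : q ∨ C) (h3 : p' ∨ C)
    (h4 : q' ∨ B) (h5 : (p' ∧ C) ∧ (q' ∧ B) ↔ (p ∧ B) ∧ (q ∧ C))
    (h6 : (p' ∧ C) ∨ (q' ∧ B) ↔ (p ∧ B) ∨ (q ∧ C)) :
    (p ∧ q ↔ p' ∧ q') ∧ (p ∨ q ↔ p' ∨ q') := by
  by_cases B <;> by_cases C <;> simp_all

/-- The relation `SwitchAt` for tile sets. -/
def SwitchRel (T₁ T₂ : Set Pt) (P₁ P₂ : Set Edge) (r : Pt) (Q₃ Q₄ : Set Edge) : Prop :=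
  Q₃ \ tileEdges r = (P₁ ∩ tileSetEdges {p ∈ T₁ | lev p < lev r} ∪
    P₂ ∩ tileSetEdges {p ∈ T₂ | lev r < lev p}) \ tileEdges r ∧
  Q₄ \ tileEdges r = (P₂ ∩ tileSetEdges {p ∈ T₂ | lev p < lev r} ∪
    P₁ ∩ tileSetEdges {p ∈ T₁ | lev r < lev p}) \ tileEdges r ∧
  (Q₃ ∩ Q₄) ∩ tileEdges r = (P₁ ∩ P₂) ∩ tileEdges r ∧
  (Q₃ ∪ Q₄) ∩ tileEdges r = (P₁ ∪ P₂) ∩ tileEdges r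

namespace Overlapping

variable {T₁ T₂ : Set Pt} {r₀ r₁ : Pt}

/-- The tile sets agree on the overlap, so all cuts in or next to it lead to the same switched tile
set; `lev r₀ - 1` is the cut just before the overlap and `lev r₁` the one just after it. -/
theorem swapTiles_eq (O : Overlapping T₁ T₂ r₀ r₁) {c c' : ℤ} (h : lev r₀ - 1 ≤ c)
    (h' : c ≤ lev r₁) (g : lev r₀ - 1 ≤ c') (g' : c' ≤ lev r₁) :
    swapTiles c T₁ T₂ = swapTiles c' T₁ T₂ := by
  ext p
  have := O.agree p
  rcases le_or_gt (lev p) c with hp | hp <;> rcases le_or_gt (lev p) c' with hp' | hp'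
  · rw [mem_swapTiles_of_le hp, mem_swapTiles_of_le hp']
  · rw [mem_swapTiles_of_le hp, mem_swapTiles_of_lt hp', this (by omega) (by omega)]
  · rw [mem_swapTiles_of_lt hp, mem_swapTiles_of_le hp', this (by omega) (by omega)]
  · rw [mem_swapTiles_of_lt hp, mem_swapTiles_of_lt hp']

theorem symm (O : Overlapping T₁ T₂ r₀ r₁) : Overlapping T₂ T₁ r₀ r₁ where
  thin₁ := O.thin₂
  thin₂ := O.thin₁
  mem₀ := (O.agree _ le_rfl O.le).1 O.mem₀
  mem₁ := (O.agree _ O.le le_rfl).1 O.mem₁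
  le := O.le
  agree p h h' := (O.agree p h h').symm
  left a h h' := O.left a h' h
  right a h h' := O.right a h' h
  succ p hp h h' := by
    obtain ⟨a, ha⟩ := O.succ p ((O.agree p h h'.le).2 hp) h h'
    exact ⟨a, (O.agree _ (by simp; omega) (by simp; omega)).1 ha⟩

/-- Membership in the tile set obtained by switching. -/
theorem mem_swap_of_le (_O : Overlapping T₁ T₂ r₀ r₁) {p : Pt} (hp : lev p ≤ lev r₁) :
    p ∈ swapTiles (lev r₁) T₁ T₂ ↔ p ∈ T₁ := mem_swapTiles_of_le hp

theorem mem_swap_of_ge (O : Overlapping T₁ T₂ r₀ r₁) {p : Pt} (hp : lev r₀ ≤ lev p) :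
    p ∈ swapTiles (lev r₁) T₁ T₂ ↔ p ∈ T₂ := by
  rw [O.swapTiles_eq (c' := lev r₀ - 1) (by have := O.le; omega) le_rfl le_rfl
    (by have := O.le; omega), mem_swapTiles_of_lt (by omega)]

theorem thin_swap (O : Overlapping T₁ T₂ r₀ r₁) (c : ℤ) : IsThin (swapTiles c T₁ T₂) := by
  rintro p hp q hq h
  rcases le_or_gt (lev p) c with hp' | hp'
  · rw [mem_swapTiles_of_le hp'] at hp
    rw [mem_swapTiles_of_le (by omega)] at hq
    exact O.thin₁ p hp q hq h
  · rw [mem_swapTiles_of_lt hp'] at hp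
    rw [mem_swapTiles_of_lt (by omega)] at hq
    exact O.thin₂ p hp q hq h

/-- The switched tile sets have the same overlap, with the continuations on the right exchanged.
Hence everything about overlapping pairs also applies to the graphs `G_3` and `G_4`. -/
theorem swap (O : Overlapping T₁ T₂ r₀ r₁) :
    Overlapping (swapTiles (lev r₁) T₁ T₂) (swapTiles (lev r₁) T₂ T₁) r₀ r₁ where
  thin₁ := O.thin_swap _
  thin₂ := O.symm.thin_swap _
  mem₀ := (O.mem_swap_of_le O.le).2 O.mem₀
  mem₁ := (O.mem_swap_of_le le_rfl).2 O.mem₁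
  le := O.le
  agree p h h' := by rw [O.mem_swap_of_le h', O.symm.mem_swap_of_le h', O.agree p h h']
  left a := by
    have := O.le
    rw [O.mem_swap_of_le (by simp; omega), O.symm.mem_swap_of_le (by simp; omega)]
    exact O.left a
  right a := by
    have := O.le
    rw [O.mem_swap_of_ge (by simp; omega), O.symm.mem_swap_of_ge (by simp; omega)]
    exact O.symm.right a
  succ p hp h h' := by
    rw [O.mem_swap_of_le h'.le] at hp
    obtain ⟨a, ha⟩ := O.succ p hp h h'
    exact ⟨a, (O.mem_swap_of_le (by simp; omega)).2 ha⟩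

end Overlapping

/-- The two words can be switched after the antidiagonal `c`. -/
def Switchable (T₁ T₂ : Set Pt) (h k : Pt → Dir) (c : ℤ) : Prop :=
  IsWord (swapTiles c T₁ T₂) (swapWord c h k) ∧ IsWord (swapTiles c T₂ T₁) (swapWord c k h)

/-- The only new adjacency is the one across the cut. -/
theorem isWord_swap_iff {T₁ T₂ : Set Pt} {h k : Pt → Dir} (hh : IsWord T₁ h) (hk : IsWord T₂ k)
    (c : ℤ) : IsWord (swapTiles c T₁ T₂) (swapWord c h k) ↔
      ∀ p a, lev p = c → p ∈ T₁ → p + a.step ∈ T₂ → h p = a ∨ k (p + a.step) = a := by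
  constructor
  · intro H p a hp h1 h2
    have := H p a ((mem_swapTiles_of_le hp.le).2 h1) ((mem_swapTiles_of_lt (by simp [hp])).2 h2)
    rwa [swapWord_of_le hp.le, swapWord_of_lt (by simp [hp])] at this
  · intro H p a h1 h2
    rcases lt_trichotomy (lev p) c with hp | hp | hp
    · rw [mem_swapTiles_of_le hp.le] at h1
      rw [mem_swapTiles_of_le (by simp; omega)] at h2
      rw [swapWord_of_le hp.le, swapWord_of_le (by simp; omega)]
      exact hh p a h1 h2
    · rw [mem_swapTiles_of_le hp.le] at h1
      rw [mem_swapTiles_of_lt (by simp; omega)] at h2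
      rw [swapWord_of_le hp.le, swapWord_of_lt (by simp; omega)]
      exact H p a hp h1 h2
    · rw [mem_swapTiles_of_lt hp] at h1
      rw [mem_swapTiles_of_lt (by simp; omega)] at h2
      rw [swapWord_of_lt hp, swapWord_of_lt (by simp; omega)]
      exact hk p a h1 h2

/-! ### Switching at a tile is the same as cutting next to it -/

namespace Overlapping

variable {T₁ T₂ : Set Pt} {r₀ r₁ : Pt}

/-- The edges outside of the tile `r` after a switch before or after this tile. -/
theorem wordEdges_swap_diff (O : Overlapping T₁ T₂ r₀ r₁) {h k : Pt → Dir} {r : Pt} (hr : r ∈ T₁)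
    (h0 : lev r₀ ≤ lev r) (h1 : lev r ≤ lev r₁) {q : Pt → Dir}
    (hq : ∀ p ∈ T₁, lev p < lev r → q p = h p) (hq' : ∀ p ∈ T₂, lev r < lev p → q p = k p) :
    wordEdges (swapTiles (lev r₁) T₁ T₂) q \ tileEdges r =
      (wordEdges T₁ h ∩ tileSetEdges {p ∈ T₁ | lev p < lev r} ∪
        wordEdges T₂ k ∩ tileSetEdges {p ∈ T₂ | lev r < lev p}) \ tileEdges r := by
  have hr2 := (O.agree r h0 h1).1 hr
  have hr3 := (O.mem_swap_of_le h1).2 hr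
  refine segs_ext (Set.sdiff_subset.trans (wordEdges_subset_segs _ _))
    (Set.sdiff_subset.trans (Set.union_subset (Set.inter_subset_left.trans (wordEdges_subset_segs _ _))
      (Set.inter_subset_left.trans (wordEdges_subset_segs _ _)))) fun p a => ?_
  simp only [Set.mem_sdiff, Set.mem_union, Set.mem_inter_iff, seg_mem_tileEdges]
  refine and_congr_left fun hp => ?_
  push Not at hp
  obtain ⟨hp1, hp2⟩ := hp
  have hlev : lev (p - a.step) = lev p - 1 := lev_sub_step p a
  simp only [seg_mem_wordEdges, seg_mem_tileSetEdges, Set.mem_ofPred_eq, hlev]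
  have tlow : ∀ x, lev x ≤ lev r → (x ∈ swapTiles (lev r₁) T₁ T₂ ↔ x ∈ T₁) := fun x hx =>
    O.mem_swap_of_le (by omega)
  have thigh : ∀ x, lev r ≤ lev x → (x ∈ swapTiles (lev r₁) T₁ T₂ ↔ x ∈ T₂) := fun x hx =>
    O.mem_swap_of_ge (by omega)
  -- The edge can only belong to tiles on two consecutive antidiagonals, and on the antidiagonal of
  -- `r` there is no tile but `r`, which does not contain it. So all its tiles are before `r` or all
  -- are after `r`.
  rcases lt_trichotomy (lev p) (lev r) with hlt | heq | hgt
  · rw [tlow p hlt.le, tlow (p - a.step) (by omega)]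
    have e1 := hq p
    have e2 := hq (p - a.step)
    have : ¬ lev r < lev p := by omega
    have : ¬ lev r < lev p - 1 := by omega
    have : lev p - 1 < lev r := by omega
    by_cases c1 : p ∈ T₁ <;> by_cases c2 : p - a.step ∈ T₁ <;> simp_all
  · have c1 : p ∉ T₁ := fun h => hp1 (O.thin₁ _ h _ hr heq)
    have c2 : p ∉ T₂ := fun h => hp1 (O.thin₂ _ h _ hr2 heq)
    have c3 : p ∉ swapTiles (lev r₁) T₁ T₂ := by rwa [tlow p heq.le]
    rw [tlow (p - a.step) (by omega)]
    have e2 := hq (p - a.step)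
    by_cases c4 : p - a.step ∈ T₁ <;> simp_all
  · rcases eq_or_ne (lev p) (lev r + 1) with heq | hne
    · have c1 : p - a.step ∉ T₁ := fun h => hp2 (O.thin₁ _ h _ hr (by omega))
      have c2 : p - a.step ∉ T₂ := fun h => hp2 (O.thin₂ _ h _ hr2 (by omega))
      have c3 : p - a.step ∉ swapTiles (lev r₁) T₁ T₂ := by rwa [tlow _ (by omega)]
      rw [thigh p (by omega)]
      have e2 := hq' p
      have : ¬ lev r + 1 < lev r := by omega
      by_cases c4 : p ∈ T₂ <;> simp_all
    · rw [thigh p (by omega), thigh (p - a.step) (by omega)]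
      have e1 := hq' p
      have e2 := hq' (p - a.step)
      have : ¬ lev p < lev r := by omega
      have : ¬ lev p - 1 < lev r := by omega
      have : lev r < lev p - 1 := by omega
      by_cases c1 : p ∈ T₂ <;> by_cases c2 : p - a.step ∈ T₂ <;> simp_all

/-- Switching next to a tile is switching at this tile. -/
theorem switchRel (O : Overlapping T₁ T₂ r₀ r₁) {h k : Pt → Dir} (hh : IsWord T₁ h)
    (hk : IsWord T₂ k) {r : Pt} (hr : r ∈ T₁) (h0 : lev r₀ ≤ lev r) (h1 : lev r ≤ lev r₁) {c : ℤ}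
    (hc : c = lev r ∨ c = lev r - 1) (hs : Switchable T₁ T₂ h k c) :
    SwitchRel T₁ T₂ (wordEdges T₁ h) (wordEdges T₂ k) r
      (wordEdges (swapTiles (lev r₁) T₁ T₂) (swapWord c h k))
      (wordEdges (swapTiles (lev r₁) T₂ T₁) (swapWord c k h)) := by
  have hr2 := (O.agree r h0 h1).1 hr
  refine ⟨?_, ?_, ?_⟩
  · exact O.wordEdges_swap_diff hr h0 h1 (fun p _ hp => swapWord_of_le (by omega))
      (fun p _ hp => swapWord_of_lt (by omega))
  · exact O.symm.wordEdges_swap_diff hr2 h0 h1 (fun p _ hp => swapWord_of_le (by omega))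
      (fun p _ hp => swapWord_of_lt (by omega))
  · have hr3 := (O.mem_swap_of_le h1).2 hr
    have hr4 := (O.symm.mem_swap_of_le h1).2 hr2
    rw [inter_tileEdges_eq_iff, inter_tileEdges_eq_iff, ← forall_and]
    intro a
    simp only [Set.mem_inter_iff, Set.mem_union, seg_self_mem_wordEdges hr,
      seg_self_mem_wordEdges hr2, seg_self_mem_wordEdges hr3, seg_self_mem_wordEdges hr4,
      seg_add_step_mem_wordEdges hr, seg_add_step_mem_wordEdges hr2,
      seg_add_step_mem_wordEdges hr3, seg_add_step_mem_wordEdges hr4]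
    rw [O.mem_swap_of_le (p := r - a.step) (by simp; omega),
      O.symm.mem_swap_of_le (p := r - a.step) (by simp; omega),
      O.mem_swap_of_ge (p := r + a.step) (by simp; omega),
      O.symm.mem_swap_of_ge (p := r + a.step) (by simp; omega)]
    rw [swapWord_of_le (p := r - a.step) (by simp; omega),
      swapWord_of_le (p := r - a.step) (by simp; omega),
      swapWord_of_lt (p := r + a.step) (by simp; omega),
      swapWord_of_lt (p := r + a.step) (by simp; omega)]
    have w1 := (isWord_swap_iff hh hk c).1 hs.1
    have w2 := (isWord_swap_iff hk hh c).1 hs.2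
    -- For a cut after `r` the values at `r` stay and the following neighbours are exchanged: the
    -- south and west sides are untouched, the other sides are counted by `count_switch`.
    rcases hc with rfl | rfl
    · rw [swapWord_of_le le_rfl, swapWord_of_le le_rfl]
      have := count_switch (or_iff_not_imp_left.2 fun g g' => (hh r a hr g').resolve_left g)
        (or_iff_not_imp_left.2 fun g g' => (hk r a hr2 g').resolve_left g)
        (or_iff_not_imp_left.2 fun g g' => (w1 r a rfl hr g').resolve_left g)
        (or_iff_not_imp_left.2 fun g g' => (w2 r a rfl hr2 g').resolve_left g)
      exact ⟨⟨Iff.rfl, this.1⟩, ⟨Iff.rfl, this.2⟩⟩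
    -- For a cut before `r` the values at `r` are exchanged together with all that follows: the
    -- memberships on the north and east sides are just interchanged, and the count concerns the
    -- preceding neighbours.
    · rw [swapWord_of_lt (by omega), swapWord_of_lt (by omega)]
      have v1 := hh (r - a.step) a
      have v2 := hk (r - a.step) a
      have w1 := w1 (r - a.step) a (by simp)
      have w2 := w2 (r - a.step) a (by simp)
      simp only [sub_add_cancel] at v1 v2 w1 w2
      have := count_switch (or_iff_not_imp_left.2 fun g g' => (w2 g' hr).resolve_right g)
        (or_iff_not_imp_left.2 fun g g' => (w1 g' hr2).resolve_right g)
        (or_iff_not_imp_left.2 fun g g' => (v1 g' hr).resolve_right g)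
        (or_iff_not_imp_left.2 fun g g' => (v2 g' hr2).resolve_right g)
      refine ⟨⟨?_, and_comm⟩, ⟨?_, or_comm⟩⟩
      · rw [and_comm, ← this.1]
      · rw [or_comm, ← this.2]

/-- One of the north and east sides of `x` is a boundary edge, and it is not an edge of `r`; its
presence in both sets reveals the value at `x`. For tiles after `r` a south or west side plays this
role. -/
theorem eq_before_of_diff (O : Overlapping T₁ T₂ r₀ r₁) {h k q : Pt → Dir} {r : Pt} (hr : r ∈ T₁)
    (h1 : lev r ≤ lev r₁)
    (H : wordEdges (swapTiles (lev r₁) T₁ T₂) q \ tileEdges r =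
      (wordEdges T₁ h ∩ tileSetEdges {p ∈ T₁ | lev p < lev r} ∪
        wordEdges T₂ k ∩ tileSetEdges {p ∈ T₂ | lev r < lev p}) \ tileEdges r)
    {x : Pt} (hx : x ∈ T₁) (hxr : lev x < lev r) : q x = h x := by
  have hxr' : x ≠ r := fun h => by rw [h] at hxr; omega
  have hx3 := (O.mem_swap_of_le (p := x) (by omega)).2 hx
  have key : ∀ a : Dir, x + a.step ∉ T₁ → (q x = a ↔ h x = a) := by
    intro a ha
    have ha3 : x + a.step ∉ swapTiles (lev r₁) T₁ T₂ := by
      rwa [O.mem_swap_of_le (by simp; omega)]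
    have hne : x + a.step ≠ r := fun h => ha (h ▸ hr)
    have hl : ¬ lev r < lev x + 1 := by omega
    have hl' : ¬ lev r < lev x := by omega
    have := Set.ext_iff.1 H (seg (x + a.step) a)
    simpa [seg_add_step_mem_wordEdges hx3, seg_add_step_mem_wordEdges hx, seg_mem_tileEdges, ha3,
      ha, hne, hxr', seg_mem_tileSetEdges, hx, hxr, hl, hl'] using this
  have : ∃ a : Dir, x + a.step ∉ T₁ := by
    by_contra! hc
    exact absurd (O.thin₁.step_unique (hc .north) (hc .east)) nofun
  obtain ⟨a, ha⟩ := this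
  have := key a ha
  by_cases h1 : q x = a
  · rw [h1, this.1 h1]
  · exact Dir.eq_of_ne_of_ne h1 (mt this.2 h1)

theorem eq_after_of_diff (O : Overlapping T₁ T₂ r₀ r₁) {h k q : Pt → Dir} {r : Pt} (hr : r ∈ T₂)
    (h0 : lev r₀ ≤ lev r)
    (H : wordEdges (swapTiles (lev r₁) T₁ T₂) q \ tileEdges r =
      (wordEdges T₁ h ∩ tileSetEdges {p ∈ T₁ | lev p < lev r} ∪
        wordEdges T₂ k ∩ tileSetEdges {p ∈ T₂ | lev r < lev p}) \ tileEdges r)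
    {x : Pt} (hx : x ∈ T₂) (hxr : lev r < lev x) : q x = k x := by
  have hxr' : x ≠ r := fun h => by rw [h] at hxr; omega
  have hx3 := (O.mem_swap_of_ge (p := x) (by omega)).2 hx
  have key : ∀ a : Dir, x - a.step ∉ T₂ → (q x = a ↔ k x = a) := by
    intro a ha
    have ha3 : x - a.step ∉ swapTiles (lev r₁) T₁ T₂ := by
      rwa [O.mem_swap_of_ge (by simp; omega)]
    have hne : x - a.step ≠ r := fun h => ha (h ▸ hr)
    have hl : ¬ lev x - 1 < lev r := by omega
    have hl' : ¬ lev x < lev r := by omega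
    have := Set.ext_iff.1 H (seg x a)
    simpa [seg_self_mem_wordEdges hx3, seg_self_mem_wordEdges hx, seg_mem_tileEdges, ha3,
      ha, hne, hxr', seg_mem_tileSetEdges, hx, hxr, hl, hl'] using this
  have : ∃ a : Dir, x - a.step ∉ T₂ := by
    by_contra! hc
    exact absurd (O.thin₂.sub_step_unique (hc .north) (hc .east)) nofun
  obtain ⟨a, ha⟩ := this
  have := key a ha
  by_cases h1 : q x = a
  · rw [h1, this.1 h1]
  · exact Dir.eq_of_ne_of_ne h1 (mt this.2 h1)

/-- Away from `r` the new words are determined by the old ones. Counting the north side of `r` shows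
that the values at `r` are the old ones in some order, since there are only two values. The same
order means a cut after `r`, the opposite order a cut before `r`. -/
theorem switchable_of_switchRel (O : Overlapping T₁ T₂ r₀ r₁) {h k q q' : Pt → Dir}
    (hh : IsWord T₁ h) (hk : IsWord T₂ k) (hq : IsWord (swapTiles (lev r₁) T₁ T₂) q)
    (hq' : IsWord (swapTiles (lev r₁) T₂ T₁) q') {r : Pt} (hr : r ∈ T₁) (h0 : lev r₀ ≤ lev r)
    (h1 : lev r ≤ lev r₁)
    (hs : SwitchRel T₁ T₂ (wordEdges T₁ h) (wordEdges T₂ k) r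
      (wordEdges (swapTiles (lev r₁) T₁ T₂) q) (wordEdges (swapTiles (lev r₁) T₂ T₁) q')) :
    Switchable T₁ T₂ h k (lev r - 1) ∨ Switchable T₁ T₂ h k (lev r) := by
  obtain ⟨s1, s2, s3, s4⟩ := hs
  have hr2 := (O.agree r h0 h1).1 hr
  have hr3 := (O.mem_swap_of_le h1).2 hr
  have hr4 := (O.symm.mem_swap_of_le h1).2 hr2
  have b1 : ∀ x ∈ T₁, lev x < lev r → q x = h x := fun x => O.eq_before_of_diff hr h1 s1
  have b2 : ∀ x ∈ T₂, lev r < lev x → q x = k x := fun x => O.eq_after_of_diff hr2 h0 s1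
  have b3 : ∀ x ∈ T₂, lev x < lev r → q' x = k x := fun x => O.symm.eq_before_of_diff hr2 h1 s2
  have b4 : ∀ x ∈ T₁, lev r < lev x → q' x = h x := fun x => O.symm.eq_after_of_diff hr h0 s2
  have count : (h r = .north ∧ k r = .north ↔ q r = .north ∧ q' r = .north) ∧
      (h r = .north ∨ k r = .north ↔ q r = .north ∨ q' r = .north) := by
    have s3 := (inter_tileEdges_eq_iff.1 s3 .north).2
    have s4 := (inter_tileEdges_eq_iff.1 s4 .north).2
    simp only [Set.mem_inter_iff, Set.mem_union,
      seg_add_step_mem_wordEdges hr, seg_add_step_mem_wordEdges hr2,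
      seg_add_step_mem_wordEdges hr3, seg_add_step_mem_wordEdges hr4] at s3 s4
    have m1 := O.mem_swap_of_ge (p := r + Dir.north.step) (by simp; omega)
    have m2 := O.symm.mem_swap_of_ge (p := r + Dir.north.step) (by simp; omega)
    have v3 := hq r .north hr3
    have v4 := hq' r .north hr4
    rw [m1] at s3 s4 v3
    rw [m2] at s3 s4 v4
    have hl : lev r < lev (r + Dir.north.step) := by simp
    have c2 : (r + Dir.north.step ∈ T₂ → q (r + Dir.north.step) = .north) ↔
        (r + Dir.north.step ∈ T₂ → k (r + Dir.north.step) = .north) :=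
      forall_congr' fun h => by rw [b2 _ h hl]
    have c4 : (r + Dir.north.step ∈ T₁ → q' (r + Dir.north.step) = .north) ↔
        (r + Dir.north.step ∈ T₁ → h (r + Dir.north.step) = .north) :=
      forall_congr' fun h => by rw [b4 _ h hl]
    rw [c2, c4] at s3 s4
    exact count_of_switch (or_iff_not_imp_left.2 fun g g' => (hh r _ hr g').resolve_left g)
      (or_iff_not_imp_left.2 fun g g' => (hk r _ hr2 g').resolve_left g)
      (or_iff_not_imp_left.2 fun g => c2.1 fun g' => (v3 g').resolve_left g)
      (or_iff_not_imp_left.2 fun g => c4.1 fun g' => (v4 g').resolve_left g) s3 s4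
  have hcases : (q r = h r ∧ q' r = k r) ∨ (q r = k r ∧ q' r = h r) := by
    revert count
    cases h r <;> cases k r <;> cases q r <;> cases q' r <;> simp
  have hle := O.le
  rcases hcases with ⟨hc1, hc2⟩ | ⟨hc1, hc2⟩
  · refine .inr ⟨?_, ?_⟩
    · rw [O.swapTiles_eq (c' := lev r₁) (by omega) h1 (by omega) le_rfl]
      refine hq.congr fun x hx => ?_
      rcases lt_trichotomy (lev x) (lev r) with hl | hl | hl
      · rw [swapWord_of_le hl.le, b1 x ((O.mem_swap_of_le (by omega)).1 hx) hl]
      · rw [(O.thin_swap _) x hx r hr3 hl, swapWord_of_le le_rfl, hc1]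
      · rw [swapWord_of_lt hl, b2 x ((O.mem_swap_of_ge (by omega)).1 hx) hl]
    · rw [O.symm.swapTiles_eq (c' := lev r₁) (by omega) h1 (by omega) le_rfl]
      refine hq'.congr fun x hx => ?_
      rcases lt_trichotomy (lev x) (lev r) with hl | hl | hl
      · rw [swapWord_of_le hl.le, b3 x ((O.symm.mem_swap_of_le (by omega)).1 hx) hl]
      · rw [(O.symm.thin_swap _) x hx r hr4 hl, swapWord_of_le le_rfl, hc2]
      · rw [swapWord_of_lt hl, b4 x ((O.symm.mem_swap_of_ge (by omega)).1 hx) hl]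
  · refine .inl ⟨?_, ?_⟩
    · rw [O.swapTiles_eq (c' := lev r₁) (by omega) (by omega) (by omega) le_rfl]
      refine hq.congr fun x hx => ?_
      rcases lt_trichotomy (lev x) (lev r) with hl | hl | hl
      · rw [swapWord_of_le (by omega), b1 x ((O.mem_swap_of_le (by omega)).1 hx) hl]
      · rw [(O.thin_swap _) x hx r hr3 hl, swapWord_of_lt (by omega), hc1]
      · rw [swapWord_of_lt (by omega), b2 x ((O.mem_swap_of_ge (by omega)).1 hx) hl]
    · rw [O.symm.swapTiles_eq (c' := lev r₁) (by omega) (by omega) (by omega) le_rfl]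
      refine hq'.congr fun x hx => ?_
      rcases lt_trichotomy (lev x) (lev r) with hl | hl | hl
      · rw [swapWord_of_le (by omega), b3 x ((O.symm.mem_swap_of_le (by omega)).1 hx) hl]
      · rw [(O.symm.thin_swap _) x hx r hr4 hl, swapWord_of_lt (by omega), hc2]
      · rw [swapWord_of_lt (by omega), b4 x ((O.symm.mem_swap_of_ge (by omega)).1 hx) hl]

end Overlapping

/-! ### Alternating patterns -/

open Classical in
/-- The two words that alternate along every antidiagonal strip. -/
noncomputable def pat (b : Bool) (p : Pt) : Dir :=
  if (Even (lev p) ↔ b = true) then .north else .east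

theorem pat_not (b : Bool) (p : Pt) : pat (!b) p = (pat b p).other := by
  unfold pat
  by_cases h : Even (lev p) <;> cases b <;> simp [h, Dir.other]

@[simp] theorem pat_add_step (b : Bool) (p : Pt) (a : Dir) : pat b (p + a.step) = (pat b p).other := by
  simp only [pat, lev_add_step, Int.even_add_one]
  by_cases h : Even (lev p) <;> cases b <;> simp [h, Dir.other]

theorem exists_pat_eq (p : Pt) (a : Dir) : ∃ b, pat b p = a := by
  by_cases h : pat true p = a
  · exact ⟨_, h⟩
  · exact ⟨!true, by rw [pat_not, Dir.other_eq_iff]; exact h⟩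

theorem eq_of_pat_eq {b b' : Bool} {p : Pt} (h : pat b p = pat b' p) : b = b' := by
  by_contra hne
  obtain rfl : b' = !b := by cases b <;> cases b' <;> simp_all
  rw [pat_not] at h
  exact (pat b p).other_ne h.symm

/-- Neighbouring tiles have different values, so one of them has any prescribed value. -/
theorem isWord_pat (b : Bool) (T : Set Pt) : IsWord T (pat b) := by
  intro p a _ _
  rw [pat_add_step, Dir.other_eq_iff]
  exact em _

/-- The ends of the overlap are compatible with the pattern: this expresses a crossing. -/
structure CrossPattern (T₁ T₂ : Set Pt) (r₀ r₁ : Pt) (b : Bool) : Prop where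
  left₁ : ∀ a, r₀ - Dir.step a ∈ T₁ → pat b r₀ = a
  left₂ : ∀ a, r₀ - Dir.step a ∈ T₂ → pat b r₀ ≠ a
  right₁ : ∀ a, r₁ + Dir.step a ∈ T₁ → pat b r₁ = a
  right₂ : ∀ a, r₁ + Dir.step a ∈ T₂ → pat b r₁ ≠ a
  left : ∃ a, r₀ - Dir.step a ∈ T₁ ∨ r₀ - Dir.step a ∈ T₂
  right : ∃ a, r₁ + Dir.step a ∈ T₁ ∨ r₁ + Dir.step a ∈ T₂

/-- The condition under which words may be switched before the first tile of the overlap. -/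
def OpenLeft (T₁ T₂ : Set Pt) (r₀ : Pt) (h k : Pt → Dir) : Prop :=
  ∀ a, (r₀ - Dir.step a ∈ T₁ → h (r₀ - a.step) = a) ∧ (r₀ - Dir.step a ∈ T₂ → k (r₀ - a.step) = a)

/-- The condition under which words may be switched after the last tile of the overlap. -/
def OpenRight (T₁ T₂ : Set Pt) (r₁ : Pt) (h k : Pt → Dir) : Prop :=
  ∀ a, (r₁ + Dir.step a ∈ T₁ → h (r₁ + a.step) = a) ∧ (r₁ + Dir.step a ∈ T₂ → k (r₁ + a.step) = a)

/-- The words can be switched somewhere in or next to the overlap. -/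
def CanSwap (T₁ T₂ : Set Pt) (r₀ r₁ : Pt) (h k : Pt → Dir) : Prop :=
  ∃ c, lev r₀ - 1 ≤ c ∧ c ≤ lev r₁ ∧ Switchable T₁ T₂ h k c

namespace Overlapping

variable {T₁ T₂ : Set Pt} {r₀ r₁ : Pt}

theorem mem_step (O : Overlapping T₁ T₂ r₀ r₁) {p q : Pt} (hp : p ∈ T₁) (h0 : lev r₀ ≤ lev p)
    (hq : q ∈ T₁) (h1 : lev q ≤ lev r₁) (h : lev q = lev p + 1) : ∃ a, q = p + Dir.step a := by
  obtain ⟨a, ha⟩ := O.succ p hp h0 (by omega)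
  exact ⟨a, O.thin₁ _ hq _ ha (by simp [h])⟩

/-- If the words agree at a tile of the overlap, they can be cut right after it: the adjacencies
across the cut are then those of the original words. -/
theorem ne_of_not_canSwap (O : Overlapping T₁ T₂ r₀ r₁) {h k : Pt → Dir} (hh : IsWord T₁ h)
    (hk : IsWord T₂ k) (H : ¬ CanSwap T₁ T₂ r₀ r₁ h k) {p : Pt} (hp : p ∈ T₁)
    (h0 : lev r₀ ≤ lev p) (h1 : lev p ≤ lev r₁) : k p = (h p).other := by
  rw [← Dir.ne_iff]
  intro heq
  have hp2 := (O.agree p h0 h1).1 hp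
  refine H ⟨lev p, by omega, h1, (isWord_swap_iff hh hk _).2 ?_, (isWord_swap_iff hk hh _).2 ?_⟩
  · intro x a hx hx1 hx2
    obtain rfl := O.thin₁ _ hx1 _ hp hx
    rw [← heq]
    exact hk x a hp2 hx2
  · intro x a hx hx1 hx2
    obtain rfl := O.thin₂ _ hx1 _ hp2 hx
    rw [heq]
    exact hh x a hp hx2

/-- Words that cannot be switched alternate along the overlap. -/
theorem eq_pat_of_not_canSwap (O : Overlapping T₁ T₂ r₀ r₁) {h k : Pt → Dir} (hh : IsWord T₁ h)
    (hk : IsWord T₂ k) (H : ¬ CanSwap T₁ T₂ r₀ r₁ h k) {b : Bool} (hb : pat b r₀ = h r₀) {p : Pt}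
    (hp : p ∈ T₁) (h0 : lev r₀ ≤ lev p) (h1 : lev p ≤ lev r₁) : h p = pat b p := by
  obtain ⟨n, hn⟩ : ∃ n : ℕ, lev p = lev r₀ + n := ⟨(lev p - lev r₀).toNat, by omega⟩
  induction n generalizing p with
  | zero =>
    obtain rfl := O.thin₁ _ hp _ O.mem₀ (by simpa using hn)
    exact hb.symm
  | succ n ih =>
    obtain ⟨x, hx, hxn⟩ : ∃ x ∈ T₁, lev x = lev r₀ + n := by
      clear ih
      have : ∀ m : ℕ, m ≤ n → ∃ x ∈ T₁, lev x = lev r₀ + m := by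
        intro m hm
        induction m with
        | zero => exact ⟨r₀, O.mem₀, by simp⟩
        | succ m ih =>
          obtain ⟨x, hx, hxm⟩ := ih (by omega)
          obtain ⟨a, ha⟩ := O.succ x hx (by omega) (by push_cast at hn; omega)
          exact ⟨_, ha, by rw [lev_add_step, hxm]; push_cast; ring⟩
      exact this n le_rfl
    push_cast at hn
    obtain ⟨a, rfl⟩ := O.mem_step hx (by omega) hp h1 (by omega)
    have ihx := ih hx (by omega) (by omega) hxn
    rw [pat_add_step, ← ihx]
    -- One of the two values of `h` equals `a`; since `k` has the opposite values, one of them also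
    -- differs from `a`. Hence `h` alternates.
    have w1 := hh x a hx hp
    have w2 := hk x a ((O.agree x (by omega) (by omega)).1 hx) ((O.agree _ h0 h1).1 hp)
    rw [O.ne_of_not_canSwap hh hk H hx (by omega) (by omega),
      O.ne_of_not_canSwap hh hk H hp (by omega) (by omega)] at w2
    revert w1 w2
    cases h x <;> cases h (x + a.step) <;> cases a <;> simp [Dir.other]

/-- Otherwise `k r₁ = a`, which admits the continuation in `T₁`, while `h r₁` is the other
direction, the only one in which `T₂` can continue by maximality of the overlap. So a cut after `r₁`
would be possible. -/
theorem right_of_not_canSwap (O : Overlapping T₁ T₂ r₀ r₁) {h k : Pt → Dir} (hh : IsWord T₁ h)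
    (hk : IsWord T₂ k) (H : ¬ CanSwap T₁ T₂ r₀ r₁ h k) {a : Dir} (ha : r₁ + a.step ∈ T₁) :
    h r₁ = a := by
  by_contra hne
  have hle := O.le
  have hkr := O.ne_of_not_canSwap hh hk H O.mem₁ O.le le_rfl
  refine H ⟨lev r₁, by omega, le_rfl, (isWord_swap_iff hh hk _).2 ?_, (isWord_swap_iff hk hh _).2 ?_⟩
  · intro x c hx hx1 hx2
    obtain rfl := O.thin₁ _ hx1 _ O.mem₁ hx
    refine .inl (Dir.eq_of_ne_of_ne hne ?_)
    rintro rfl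
    exact O.right _ ha hx2
  · intro x c hx hx1 hx2
    obtain rfl := O.thin₂ _ hx1 _ O.symm.mem₁ hx
    obtain rfl := O.thin₁.step_unique ha hx2
    exact .inl (by rw [hkr, Dir.other_eq_iff]; exact hne)

/-- The mirror image of the previous argument: otherwise the cut just before `r₀`, at `lev r₀ - 1`,
would be possible. -/
theorem left_of_not_canSwap (O : Overlapping T₁ T₂ r₀ r₁) {h k : Pt → Dir} (hh : IsWord T₁ h)
    (hk : IsWord T₂ k) (H : ¬ CanSwap T₁ T₂ r₀ r₁ h k) {a : Dir} (ha : r₀ - a.step ∈ T₁) :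
    h r₀ = a := by
  by_contra hne
  have hle := O.le
  have hkr := O.ne_of_not_canSwap hh hk H O.mem₀ le_rfl O.le
  have hkr' : k r₀ = a := by rw [hkr, Dir.other_eq_iff]; exact hne
  refine H ⟨lev r₀ - 1, le_rfl, by omega, (isWord_swap_iff hh hk _).2 ?_,
    (isWord_swap_iff hk hh _).2 ?_⟩
  · intro x c hx hx1 hx2
    obtain hx' := O.thin₂ _ hx2 _ O.symm.mem₀ (by simp [hx])
    obtain rfl : x = r₀ - c.step := by rw [← hx']; simp
    obtain rfl := O.thin₁.sub_step_unique ha hx1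
    simp [hkr']
  · intro x c hx hx1 hx2
    obtain hx' := O.thin₁ _ hx2 _ O.mem₀ (by simp [hx])
    obtain rfl : x = r₀ - c.step := by rw [← hx']; simp
    refine .inr ?_
    rw [sub_add_cancel]
    refine Dir.eq_of_ne_of_ne hne ?_
    rintro rfl
    exact O.left _ ha hx1

theorem canSwap_symm {h k : Pt → Dir} (H : CanSwap T₁ T₂ r₀ r₁ h k) : CanSwap T₂ T₁ r₀ r₁ k h := by
  obtain ⟨c, h0, h1, h2⟩ := H
  exact ⟨c, h0, h1, h2.2, h2.1⟩

/-- Characterization of the pairs of words that cannot be switched. -/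
theorem not_canSwap_iff (O : Overlapping T₁ T₂ r₀ r₁) {b : Bool} (X : CrossPattern T₁ T₂ r₀ r₁ b)
    {h k : Pt → Dir} (hh : IsWord T₁ h) (hk : IsWord T₂ k) :
    ¬ CanSwap T₁ T₂ r₀ r₁ h k ↔
      (∀ p ∈ T₁, lev r₀ ≤ lev p → lev p ≤ lev r₁ → h p = pat b p ∧ k p = (pat b p).other) ∧
        ¬ OpenLeft T₁ T₂ r₀ h k ∧ ¬ OpenRight T₁ T₂ r₁ h k := by
  have hle := O.le
  constructor
  · intro H
    have H' : ¬ CanSwap T₂ T₁ r₀ r₁ k h := fun h => H (canSwap_symm h)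
    -- The existing tile before the overlap fixes which of the two alternating patterns occurs.
    have hb : pat b r₀ = h r₀ := by
      obtain ⟨a, ha | ha⟩ := X.left
      · rw [X.left₁ a ha, O.left_of_not_canSwap hh hk H ha]
      · have h1 := O.symm.left_of_not_canSwap hk hh H' ha
        rw [O.ne_of_not_canSwap hh hk H O.mem₀ le_rfl O.le, Dir.other_eq_iff] at h1
        exact Dir.eq_of_ne_of_ne (X.left₂ a ha) h1
    have hp : ∀ p ∈ T₁, lev r₀ ≤ lev p → lev p ≤ lev r₁ →
        h p = pat b p ∧ k p = (pat b p).other := by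
      intro p hp h0 h1
      have := O.eq_pat_of_not_canSwap hh hk H hb hp h0 h1
      exact ⟨this, by rw [O.ne_of_not_canSwap hh hk H hp h0 h1, this]⟩
    refine ⟨hp, fun hL => H ⟨lev r₀ - 1, le_rfl, by omega, (isWord_swap_iff hh hk _).2 ?_,
      (isWord_swap_iff hk hh _).2 ?_⟩, fun hR => H ⟨lev r₁, by omega, le_rfl,
      (isWord_swap_iff hh hk _).2 ?_, (isWord_swap_iff hk hh _).2 ?_⟩⟩
    · intro x c hx hx1 hx2
      obtain hx' := O.thin₂ _ hx2 _ O.symm.mem₀ (by simp [hx])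
      obtain rfl : x = r₀ - c.step := by rw [← hx']; simp
      exact .inl ((hL c).1 hx1)
    · intro x c hx hx1 hx2
      obtain hx' := O.thin₁ _ hx2 _ O.mem₀ (by simp [hx])
      obtain rfl : x = r₀ - c.step := by rw [← hx']; simp
      exact .inl ((hL c).2 hx1)
    · intro x c hx hx1 hx2
      obtain rfl := O.thin₁ _ hx1 _ O.mem₁ hx
      exact .inr ((hR c).2 hx2)
    · intro x c hx hx1 hx2
      obtain rfl := O.thin₂ _ hx1 _ O.symm.mem₁ hx
      exact .inr ((hR c).1 hx2)
  · rintro ⟨hp, hL, hR⟩ ⟨c, hc0, hc1, hs1, hs2⟩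
    have s1 := (isWord_swap_iff hh hk _).1 hs1
    have s2 := (isWord_swap_iff hk hh _).1 hs2
    -- For a cut at an end of the overlap the pattern rules out that the tile of the overlap
    -- satisfies the adjacency condition. The outer tiles must do so, which means that this end is
    -- open.
    rcases hc0.eq_or_lt with rfl | hc0'
    · obtain ⟨e1, e2⟩ := hp r₀ O.mem₀ le_rfl O.le
      refine hL fun a => ⟨fun ha => ?_, fun ha => ?_⟩
      · have := s1 _ a (by simp) ha (by simpa using O.symm.mem₀)
        refine this.resolve_right ?_
        rw [sub_add_cancel, e2, Dir.other_eq_iff]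
        exact fun h => h (X.left₁ a ha)
      · have := s2 _ a (by simp) ha (by simpa using O.mem₀)
        refine this.resolve_right ?_
        rw [sub_add_cancel, e1]
        exact X.left₂ a ha
    · rcases hc1.eq_or_lt with rfl | hc1'
      · obtain ⟨e1, e2⟩ := hp r₁ O.mem₁ O.le le_rfl
        refine hR fun a => ⟨fun ha => ?_, fun ha => ?_⟩
        · refine (s2 r₁ a rfl O.symm.mem₁ ha).resolve_left ?_
          rw [e2, Dir.other_eq_iff]
          exact fun h => h (X.right₁ a ha)
        · refine (s1 r₁ a rfl O.mem₁ ha).resolve_left ?_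
          rw [e1]
          exact X.right₂ a ha
      · obtain ⟨x, hx, hxc⟩ : ∃ x ∈ T₁, lev x = c := by
          have : ∀ m : ℕ, lev r₀ + m ≤ lev r₁ → ∃ x ∈ T₁, lev x = lev r₀ + m := by
            intro m hm
            induction m with
            | zero => exact ⟨r₀, O.mem₀, by simp⟩
            | succ m ih =>
              push_cast at hm
              obtain ⟨x, hx, hxm⟩ := ih (by omega)
              obtain ⟨a, ha⟩ := O.succ x hx (by omega) (by omega)
              exact ⟨_, ha, by rw [lev_add_step, hxm]; push_cast; ring⟩
          obtain ⟨x, hx, h⟩ := this (c - lev r₀).toNat (by omega)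
          exact ⟨x, hx, by omega⟩
        obtain ⟨a, ha⟩ := O.succ x hx (by omega) (by omega)
        have hx2 := (O.agree x (by omega) (by omega)).1 hx
        have ha2 := (O.agree _ (by simp; omega) (by simp; omega)).1 ha
        have g1 := s1 x a hxc hx ha2
        have g2 := s2 x a hxc hx2 ha
        obtain ⟨e1, e2⟩ := hp x hx (by omega) (by omega)
        obtain ⟨e3, e4⟩ := hp _ ha (by simp; omega) (by simp; omega)
        -- Across an inner cut each switched word repeats its value, and the two words repeat
        -- opposite values; one of them violates the adjacency in the direction `a`.
        rw [e1, e4, pat_add_step] at g1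
        rw [e2, e3, pat_add_step] at g2
        revert g1 g2
        cases pat b x <;> cases a <;> simp [Dir.other]

/-- If the given words cross, then all pairs of words on the switched tiles can be switched. -/
theorem canSwap_swap (O : Overlapping T₁ T₂ r₀ r₁) {b : Bool} (X : CrossPattern T₁ T₂ r₀ r₁ b)
    {h k : Pt → Dir} (hh : IsWord (swapTiles (lev r₁) T₁ T₂) h)
    (hk : IsWord (swapTiles (lev r₁) T₂ T₁) k) :
    CanSwap (swapTiles (lev r₁) T₁ T₂) (swapTiles (lev r₁) T₂ T₁) r₀ r₁ h k := by
  -- Without a cut the words alternate. The left end, which is unchanged, prescribes the pattern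
  -- `b`; the right end, where the continuations are exchanged, prescribes the opposite pattern.
  by_contra H
  have hle := O.le
  have H' : ¬ CanSwap (swapTiles (lev r₁) T₂ T₁) (swapTiles (lev r₁) T₁ T₂) r₀ r₁ k h :=
    fun h => H (canSwap_symm h)
  have O' := O.swap
  have hb : pat b r₀ = h r₀ := by
    obtain ⟨a, ha | ha⟩ := X.left
    · rw [X.left₁ a ha, O'.left_of_not_canSwap hh hk H
        ((O.mem_swap_of_le (by simp; omega)).2 ha)]
    · have h1 := O'.symm.left_of_not_canSwap hk hh H'
        ((O.symm.mem_swap_of_le (by simp; omega)).2 ha)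
      rw [O'.ne_of_not_canSwap hh hk H O'.mem₀ le_rfl O.le, Dir.other_eq_iff] at h1
      exact Dir.eq_of_ne_of_ne (X.left₂ a ha) h1
  have hb1 := O'.eq_pat_of_not_canSwap hh hk H hb O'.mem₁ O.le le_rfl
  obtain ⟨a, ha | ha⟩ := X.right
  · have h1 := O'.symm.right_of_not_canSwap hk hh H'
      ((O.symm.mem_swap_of_ge (by simp; omega)).2 ha)
    rw [O'.ne_of_not_canSwap hh hk H O'.mem₁ O.le le_rfl, hb1, X.right₁ a ha] at h1
    exact a.other_ne h1
  · have h1 := O'.right_of_not_canSwap hh hk H ((O.mem_swap_of_ge (by simp; omega)).2 ha)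
    exact X.right₂ a ha (hb1 ▸ h1)

end Overlapping

/-! ### The first possible switch -/

theorem swapWord_eqOn {T₁ T₂ : Set Pt} {h h' k k' : Pt → Dir} (e : Set.EqOn h h' T₁)
    (e' : Set.EqOn k k' T₂) (c : ℤ) :
    Set.EqOn (swapWord c h k) (swapWord c h' k') (swapTiles c T₁ T₂) := by
  intro p hp
  rcases le_or_gt (lev p) c with hl | hl
  · rw [swapWord_of_le hl, swapWord_of_le hl, e ((mem_swapTiles_of_le hl).1 hp)]
  · rw [swapWord_of_lt hl, swapWord_of_lt hl, e' ((mem_swapTiles_of_lt hl).1 hp)]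

theorem Switchable.congr {T₁ T₂ : Set Pt} {h h' k k' : Pt → Dir} (e : Set.EqOn h h' T₁)
    (e' : Set.EqOn k k' T₂) {c : ℤ} (H : Switchable T₁ T₂ h k c) : Switchable T₁ T₂ h' k' c :=
  ⟨H.1.congr (swapWord_eqOn e e' c), H.2.congr (swapWord_eqOn e' e c)⟩

/-- The first antidiagonal after which the words can be switched. -/
noncomputable def firstCut (T₁ T₂ : Set Pt) (r₀ r₁ : Pt) (h k : Pt → Dir) : ℤ :=
  lev r₀ - 1 + (sInf {n : ℕ | lev r₀ - 1 + n ≤ lev r₁ ∧ Switchable T₁ T₂ h k (lev r₀ - 1 + n)} : ℕ)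

/-- `c` is the first antidiagonal after which the words can be switched. -/
def IsFirstCut (T₁ T₂ : Set Pt) (r₀ r₁ : Pt) (h k : Pt → Dir) (c : ℤ) : Prop :=
  lev r₀ - 1 ≤ c ∧ c ≤ lev r₁ ∧ Switchable T₁ T₂ h k c ∧
    ∀ c', lev r₀ - 1 ≤ c' → c' < c → ¬ Switchable T₁ T₂ h k c'

theorem IsFirstCut.unique {T₁ T₂ : Set Pt} {r₀ r₁ : Pt} {h k : Pt → Dir} {c c' : ℤ}
    (H : IsFirstCut T₁ T₂ r₀ r₁ h k c) (H' : IsFirstCut T₁ T₂ r₀ r₁ h k c') : c = c' := by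
  rcases lt_trichotomy c c' with hl | hl | hl
  · exact absurd H.2.2.1 (H'.2.2.2 c H.1 hl)
  · exact hl
  · exact absurd H'.2.2.1 (H.2.2.2 c' H'.1 hl)

theorem IsFirstCut.congr {T₁ T₂ : Set Pt} {r₀ r₁ : Pt} {h h' k k' : Pt → Dir}
    (e : Set.EqOn h h' T₁) (e' : Set.EqOn k k' T₂) {c : ℤ}
    (H : IsFirstCut T₁ T₂ r₀ r₁ h k c) : IsFirstCut T₁ T₂ r₀ r₁ h' k' c :=
  ⟨H.1, H.2.1, H.2.2.1.congr e e', fun c' h0 h1 hs =>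
    H.2.2.2 c' h0 h1 (hs.congr e.symm e'.symm)⟩

theorem CanSwap.isFirstCut {T₁ T₂ : Set Pt} {r₀ r₁ : Pt} {h k : Pt → Dir}
    (H : CanSwap T₁ T₂ r₀ r₁ h k) :
    IsFirstCut T₁ T₂ r₀ r₁ h k (firstCut T₁ T₂ r₀ r₁ h k) := by
  set S := {n : ℕ | lev r₀ - 1 + n ≤ lev r₁ ∧ Switchable T₁ T₂ h k (lev r₀ - 1 + n)} with hS
  have hne : S.Nonempty := by
    obtain ⟨c, h0, h1, hs⟩ := H
    have hc : lev r₀ - 1 + ((c - (lev r₀ - 1)).toNat : ℤ) = c := by omega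
    refine ⟨(c - (lev r₀ - 1)).toNat, ?_⟩
    rw [hS, Set.mem_ofPred_eq, hc]
    exact ⟨h1, hs⟩
  have hmem := Nat.sInf_mem hne
  refine ⟨by unfold firstCut; omega, hmem.1, hmem.2, fun c' h0 h1 hs => ?_⟩
  have hc : lev r₀ - 1 + ((c' - (lev r₀ - 1)).toNat : ℤ) = c' := by omega
  have hlt : (c' - (lev r₀ - 1)).toNat < sInf S := by
    have : c' < lev r₀ - 1 + (sInf S : ℕ) := h1
    omega
  refine Nat.notMem_of_lt_sInf hlt ?_
  have h2 : c' ≤ lev r₁ := h1.le.trans hmem.1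
  rw [hS, Set.mem_ofPred_eq, hc]
  exact ⟨h2, hs⟩

theorem IsFirstCut.canSwap {T₁ T₂ : Set Pt} {r₀ r₁ : Pt} {h k : Pt → Dir} {c : ℤ}
    (H : IsFirstCut T₁ T₂ r₀ r₁ h k c) : CanSwap T₁ T₂ r₀ r₁ h k := ⟨c, H.1, H.2.1, H.2.2.1⟩

theorem IsFirstCut.firstCut_eq {T₁ T₂ : Set Pt} {r₀ r₁ : Pt} {h k : Pt → Dir} {c : ℤ}
    (H : IsFirstCut T₁ T₂ r₀ r₁ h k c) : firstCut T₁ T₂ r₀ r₁ h k = c :=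
  H.canSwap.isFirstCut.unique H

namespace Overlapping

variable {T₁ T₂ : Set Pt} {r₀ r₁ : Pt}

/-- Switching does not change the first antidiagonal after which words can be switched. -/
theorem isFirstCut_swap (O : Overlapping T₁ T₂ r₀ r₁) {h k : Pt → Dir} (hh : IsWord T₁ h)
    (hk : IsWord T₂ k) {c : ℤ} (H : IsFirstCut T₁ T₂ r₀ r₁ h k c) :
    IsFirstCut (swapTiles (lev r₁) T₁ T₂) (swapTiles (lev r₁) T₂ T₁) r₀ r₁
      (swapWord c h k) (swapWord c k h) c := by
  obtain ⟨h0, h1, hs, hmin⟩ := H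
  have hle := O.le
  have e1 := O.swapTiles_eq h0 h1 (c' := lev r₁) (by omega) le_rfl
  have e2 := O.symm.swapTiles_eq h0 h1 (c' := lev r₁) (by omega) le_rfl
  rw [← e1, ← e2]
  refine ⟨h0, h1, ?_, fun c' h0' hlt hs' => hmin c' h0' hlt ?_⟩
  · unfold Switchable
    rw [swapTiles_swapTiles, swapTiles_swapTiles, swapWord_swapWord, swapWord_swapWord]
    exact ⟨hh, hk⟩
  -- Both tiles next to an earlier cut lie on antidiagonals up to `c`, where the exchange at `c` has
  -- changed nothing.
  · have s1 := (isWord_swap_iff hs.1 hs.2 c').1 hs'.1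
    have s2 := (isWord_swap_iff hs.2 hs.1 c').1 hs'.2
    refine ⟨(isWord_swap_iff hh hk c').2 ?_, (isWord_swap_iff hk hh c').2 ?_⟩
    · intro p a hp hp1 hp2
      have := s1 p a hp ((mem_swapTiles_of_le (by omega)).2 hp1)
        ((mem_swapTiles_of_le (by simp; omega)).2 hp2)
      rwa [swapWord_of_le (by omega), swapWord_of_le (by simp; omega)] at this
    · intro p a hp hp1 hp2
      have := s2 p a hp ((mem_swapTiles_of_le (by omega)).2 hp1)
        ((mem_swapTiles_of_le (by simp; omega)).2 hp2)
      rwa [swapWord_of_le (by omega), swapWord_of_le (by simp; omega)] at this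

/-- All pairs of words on the switched tiles arise from switching at the first possible place. -/
theorem exists_firstCut_swap (O : Overlapping T₁ T₂ r₀ r₁) {b : Bool}
    (X : CrossPattern T₁ T₂ r₀ r₁ b) {q q' : Pt → Dir}
    (hq : IsWord (swapTiles (lev r₁) T₁ T₂) q) (hq' : IsWord (swapTiles (lev r₁) T₂ T₁) q') :
    ∃ h k c, IsWord T₁ h ∧ IsWord T₂ k ∧ IsFirstCut T₁ T₂ r₀ r₁ h k c ∧
      swapWord c h k = q ∧ swapWord c k h = q' := by
  have hle := O.le
  have H := (O.canSwap_swap X hq hq').isFirstCut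
  set c := firstCut (swapTiles (lev r₁) T₁ T₂) (swapTiles (lev r₁) T₂ T₁) r₀ r₁ q q'
  -- The preimage is obtained by exchanging tails at the first cut of `q`, `q'`; this is the first
  -- cut of the result too, so the exchange there leads back.
  have H' := O.swap.isFirstCut_swap hq hq' H
  rw [swapTiles_swapTiles, swapTiles_swapTiles] at H'
  have hs := H.2.2.1
  have h0 := H.1
  unfold Switchable at hs
  rw [O.swap.swapTiles_eq H.1 H.2.1 (c' := lev r₁) (by omega) le_rfl,
    O.swap.symm.swapTiles_eq H.1 H.2.1 (c' := lev r₁) (by omega) le_rfl, swapTiles_swapTiles,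
    swapTiles_swapTiles] at hs
  exact ⟨_, _, c, hs.1, hs.2, H', swapWord_swapWord _ _ _, swapWord_swapWord _ _ _⟩

/-- Words are determined by the words that arise from switching at the first possible place. -/
theorem eqOn_of_swap_eqOn (O : Overlapping T₁ T₂ r₀ r₁) {h k h' k' : Pt → Dir} {c c' : ℤ}
    (hh : IsWord T₁ h) (hk : IsWord T₂ k) (hh' : IsWord T₁ h') (hk' : IsWord T₂ k')
    (H : IsFirstCut T₁ T₂ r₀ r₁ h k c) (H' : IsFirstCut T₁ T₂ r₀ r₁ h' k' c')
    (e : Set.EqOn (swapWord c h k) (swapWord c' h' k') (swapTiles (lev r₁) T₁ T₂))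
    (e' : Set.EqOn (swapWord c k h) (swapWord c' k' h') (swapTiles (lev r₁) T₂ T₁)) :
    Set.EqOn h h' T₁ ∧ Set.EqOn k k' T₂ := by
  have hle := O.le
  -- The position of the cut can be read off from the switched words, and then the exchange can be
  -- undone.
  have hc : c = c' := (((O.isFirstCut_swap hh hk H).congr e e').unique
    (O.isFirstCut_swap hh' hk' H'))
  subst hc
  have h0 := H.1
  have e1 := O.swapTiles_eq H.1 H.2.1 (c' := lev r₁) (by omega) le_rfl
  have e2 := O.symm.swapTiles_eq H.1 H.2.1 (c' := lev r₁) (by omega) le_rfl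
  rw [← e1] at e
  rw [← e2] at e'
  have f1 := swapWord_eqOn e e' c
  have f2 := swapWord_eqOn e' e c
  simp only [swapTiles_swapTiles, swapWord_swapWord] at f1 f2
  exact ⟨f1, f2⟩

end Overlapping

/-! ### Bijections between sets of matchings -/

/-- A bijection between the matchings of a graph and those of a pair of graphs, from a common
parametrization. -/
theorem exists_equiv_matchingsOf {ι V : Type*} {D A B : SimpleGraph V} {C K : ι → Prop}
    {p q₀ q₁ : ι → Set (Sym2 V)}
    (hp : ∀ P, P ∈ perfectMatchings D ↔ ∃ w, C w ∧ p w = P)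
    (h0 : ∀ Q, Q ∈ perfectMatchings A ↔ ∃ w, C w ∧ K w ∧ q₀ w = Q)
    (h1 : ∀ Q, Q ∈ perfectMatchings B ↔ ∃ w, C w ∧ ¬ K w ∧ q₁ w = Q)
    (i0 : ∀ w w', C w → C w' → K w → K w' → (p w = p w' ↔ q₀ w = q₀ w'))
    (i1 : ∀ w w', C w → C w' → ¬ K w → ¬ K w' → (p w = p w' ↔ q₁ w = q₁ w'))
    (hK : ∀ w w', C w → C w' → p w = p w' → (K w → K w')) :
    ∃ φ : perfectMatchings D ≃ MatchingsOf [A, B], ∀ P : perfectMatchings D, ∃ w, C w ∧ p w = P.1 ∧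
      ((K w ∧ ((φ P).1 : ℕ) = 0 ∧ (φ P).2.1 = q₀ w) ∨
        (¬ K w ∧ ((φ P).1 : ℕ) = 1 ∧ (φ P).2.1 = q₁ w)) := by
  classical
  -- The map is defined through an arbitrary parameter of each matching; `hK`, `i0` and `i1` say
  -- that neither the case nor the image depends on it.
  choose w hw using fun P : perfectMatchings D => (hp P.1).1 P.2
  let F : perfectMatchings D → MatchingsOf [A, B] := fun P =>
    if h : K (w P) then ⟨(0 : Fin 2), ⟨q₀ (w P), (h0 _).2 ⟨w P, (hw P).1, h, rfl⟩⟩⟩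
    else ⟨(1 : Fin 2), ⟨q₁ (w P), (h1 _).2 ⟨w P, (hw P).1, h, rfl⟩⟩⟩
  have F0 : ∀ P (h : K (w P)),
      F P = ⟨(0 : Fin 2), ⟨q₀ (w P), (h0 _).2 ⟨w P, (hw P).1, h, rfl⟩⟩⟩ := fun P h => dif_pos h
  have F1 : ∀ P (h : ¬ K (w P)),
      F P = ⟨(1 : Fin 2), ⟨q₁ (w P), (h1 _).2 ⟨w P, (hw P).1, h, rfl⟩⟩⟩ := fun P h => dif_neg h
  have hF : Function.Bijective F := by
    constructor
    · intro P P' h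
      by_cases hk : K (w P) <;> by_cases hk' : K (w P')
      · rw [F0 P hk, F0 P' hk'] at h
        have := congrArg Subtype.val (eq_of_heq (Sigma.mk.inj h).2)
        exact Subtype.ext ((hw P).2 ▸ (hw P').2 ▸
          (i0 _ _ (hw P).1 (hw P').1 hk hk').2 this)
      · rw [F0 P hk, F1 P' hk'] at h
        exact absurd (Sigma.mk.inj h).1 (by simp)
      · rw [F1 P hk, F0 P' hk'] at h
        exact absurd (Sigma.mk.inj h).1 (by simp)
      · rw [F1 P hk, F1 P' hk'] at h
        have := congrArg Subtype.val (eq_of_heq (Sigma.mk.inj h).2)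
        exact Subtype.ext ((hw P).2 ▸ (hw P').2 ▸
          (i1 _ _ (hw P).1 (hw P').1 hk hk').2 this)
    · rintro ⟨i, Q, hQ⟩
      change Fin 2 at i
      fin_cases i
      · obtain ⟨v, hv, hkv, rfl⟩ := (h0 Q).1 hQ
        let P : perfectMatchings D := ⟨p v, (hp _).2 ⟨v, hv, rfl⟩⟩
        have hk : K (w P) := hK v _ hv (hw P).1 (hw P).2.symm hkv
        refine ⟨P, (F0 P hk).trans ?_⟩
        have := (i0 _ _ (hw P).1 hv hk hkv).1 (hw P).2
        congr 1
        exact Subtype.ext this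
      · obtain ⟨v, hv, hkv, rfl⟩ := (h1 Q).1 hQ
        let P : perfectMatchings D := ⟨p v, (hp _).2 ⟨v, hv, rfl⟩⟩
        have hk : ¬ K (w P) := fun h => hkv (hK _ v (hw P).1 hv (hw P).2 h)
        refine ⟨P, (F1 P hk).trans ?_⟩
        have := (i1 _ _ (hw P).1 hv hk hkv).1 (hw P).2
        congr 1
        exact Subtype.ext this
  refine ⟨Equiv.ofBijective F hF, fun P => ⟨w P, (hw P).1, (hw P).2, ?_⟩⟩
  by_cases hk : K (w P)
  · refine .inl ⟨hk, ?_, ?_⟩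
    · rw [Equiv.ofBijective_apply, F0 P hk]; rfl
    · rw [Equiv.ofBijective_apply, F0 P hk]
  · refine .inr ⟨hk, ?_, ?_⟩
    · rw [Equiv.ofBijective_apply, F1 P hk]; rfl
    · rw [Equiv.ofBijective_apply, F1 P hk]

/-! ### Matchings of pieces, and reflections -/

theorem Piece.mem_perfectMatchings {A : Piece} (hA : ∀ e ∈ A.edges, ¬ e.IsDiag) (P : Set Edge) :
    P ∈ perfectMatchings A.graph ↔ IsPM A.edges P :=
  mem_perfectMatchings_fromEdgeSet hA P

theorem Piece.not_isDiag_snake (G : SnakeGraph) : ∀ e ∈ (Piece.snake G).edges, ¬ e.IsDiag := by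
  intro e he
  have he : e ∈ G.edges := he
  rw [G.edges_eq] at he
  exact not_isDiag_of_mem_segs (tileSetEdges_subset_segs _ he)

/-- The perfect matchings of a snake graph are given by words. -/
theorem mem_perfectMatchings_snake {G : SnakeGraph} {P : Set Edge} :
    P ∈ perfectMatchings (Piece.snake G).graph ↔ ∃ h, IsWord G.tiles h ∧ wordEdges G.tiles h = P := by
  rw [Piece.mem_perfectMatchings (Piece.not_isDiag_snake G)]
  refine (G.isPM_iff P).trans ?_
  simp only [eq_comm]

theorem mem_perfectMatchings_single {p : Pt} {a : Dir} {P : Set Edge} :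
    P ∈ perfectMatchings (Piece.single (seg p a)).graph ↔ P = {seg p a} := by
  rw [Piece.mem_perfectMatchings]
  · exact isPM_singleton
  · rintro e rfl
    exact not_isDiag_seg p a

theorem barEdge_injective : Function.Injective barEdge := Sym2.map.injective barPt_injective

theorem barTile_sub_step (q : Pt) (a : Dir) : barTile (q - a.step) = barTile q + a.other.step := by
  rw [← sub_add_cancel q a.step, barTile_add_step]; simp

theorem tileEdges_barTile (q : Pt) : tileEdges (barTile q) = barEdge '' tileEdges q := by
  have h : ∀ q, barEdge '' tileEdges q ⊆ tileEdges (barTile q) := by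
    rintro q _ ⟨e, he, rfl⟩
    obtain ⟨p, a, rfl, rfl | rfl⟩ := mem_tileEdges.1 he
    · rw [barEdge_seg]
      exact mem_tileEdges.2 ⟨_, _, rfl, .inr (by simp)⟩
    · rw [barEdge_seg]
      exact mem_tileEdges.2 ⟨_, _, rfl, .inl (barTile_sub_step p a).symm⟩
  refine Set.Subset.antisymm (fun e he => ⟨barEdge e, ?_, by simp⟩) (h q)
  have := h (barTile q) ⟨e, he, rfl⟩
  rwa [barTile_barTile] at this

theorem SnakeGraph.bar_edges (G : SnakeGraph) : G.bar.edges = barEdge '' G.edges := by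
  ext e
  rw [edges_eq, edges_eq, bar_tiles]
  simp only [mem_tileSetEdges_iff, Set.mem_image]
  constructor
  · rintro ⟨_, ⟨q, hq, rfl⟩, he⟩
    rw [tileEdges_barTile] at he
    obtain ⟨e', he', rfl⟩ := he
    exact ⟨e', ⟨q, hq, he'⟩, rfl⟩
  · rintro ⟨e', ⟨q, hq, he'⟩, rfl⟩
    exact ⟨_, ⟨q, hq, rfl⟩, by rw [tileEdges_barTile]; exact ⟨e', he', rfl⟩⟩

theorem Piece.bar_edges (A : Piece) : A.bar.edges = barEdge '' A.edges := by
  cases A with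
  | single e => simp [Piece.bar, Piece.edges]
  | snake G => exact G.bar_edges

theorem mem_perfectMatchings_bar {A : Piece} {Q : Set Edge} (hA : ∀ e ∈ A.edges, ¬ e.IsDiag) :
    Q ∈ perfectMatchings A.bar.graph ↔ ∃ P ∈ perfectMatchings A.graph, barEdge '' P = Q := by
  rw [Piece.mem_perfectMatchings]
  · simp only [Piece.mem_perfectMatchings hA, A.bar_edges]
    exact isPM_image_iff barPt_injective A.edges Q
  · rw [A.bar_edges]
    rintro _ ⟨e, he, rfl⟩
    rw [barEdge, Sym2.isDiag_map barPt_injective]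
    exact hA e he

/-- Words and reflections. -/
theorem barEdge_image_wordEdges (T : Set Pt) (h : Pt → Dir) :
    barEdge '' wordEdges T h = wordEdges (barTile '' T) (fun p => (h (barTile p)).other) := by
  -- The values are exchanged because horizontal edges become vertical. One inclusion suffices,
  -- since the reflection is an involution.
  have key : ∀ (T : Set Pt) (h : Pt → Dir), barEdge '' wordEdges T h ⊆
      wordEdges (barTile '' T) (fun p => (h (barTile p)).other) := by
    rintro T h _ ⟨e, ⟨p, a, rfl, h1, h2, h3⟩, rfl⟩
    rw [barEdge_seg, seg_mem_wordEdges, add_sub_cancel_right]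
    rw [← barTile_sub_step]
    simp only [barTile_injective.mem_set_image, barTile_barTile, Dir.other_eq_iff, ne_eq]
    refine ⟨h1.symm, fun h => ?_, fun h => ?_⟩
    · rw [h3 h]; exact a.other_ne.symm
    · rw [h2 h]; exact a.other_ne.symm
  refine Set.Subset.antisymm (key T h) fun e he => ⟨barEdge e, ?_, by simp⟩
  have := key _ _ ⟨e, he, rfl⟩
  rw [Set.image_image] at this
  simpa using this

theorem IsWord.bar {T : Set Pt} {h : Pt → Dir} (H : IsWord T h) :
    IsWord (barTile '' T) (fun p => (h (barTile p)).other) := by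
  rintro _ a ⟨p, hp, rfl⟩ ⟨q, hq, hqp⟩
  have e1 : p = q + a.other.step := by
    have := congrArg barTile hqp
    rw [barTile_add_step, barTile_barTile, barTile_barTile] at this
    rw [this]; simp
  subst e1
  have := H q a.other hq hp
  rw [← hqp]
  simp only [barTile_barTile, Dir.other_eq_iff]
  rcases this with h | h
  · exact .inr (by rw [h]; exact a.other_ne)
  · exact .inl (by rw [h]; exact a.other_ne)

/-! ### Motions -/

theorem sym2_image_tiles {g τ : Pt → Pt}
    (hg : ∀ q, Sym2.map g '' tileEdges q = tileEdges (τ q)) {G H : SnakeGraph}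
    (hGH : H.tiles = τ '' G.tiles) : H.edges = Sym2.map g '' G.edges := by
  ext e
  rw [G.edges_eq, H.edges_eq, hGH]
  simp only [mem_tileSetEdges_iff, Set.mem_image]
  constructor
  · rintro ⟨_, ⟨q, hq, rfl⟩, he⟩
    rw [← hg] at he
    obtain ⟨e', he', rfl⟩ := he
    exact ⟨e', ⟨q, hq, he'⟩, rfl⟩
  · rintro ⟨e', ⟨q, hq, he'⟩, rfl⟩
    exact ⟨_, ⟨q, hq, rfl⟩, by rw [← hg]; exact ⟨e', he', rfl⟩⟩

theorem SnakeGraph.flip_edges (G : SnakeGraph) :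
    (⟨G.base.swap, G.dirs.map Dir.other⟩ : SnakeGraph).edges = Sym2.map Prod.swap '' G.edges := by
  set H : SnakeGraph := ⟨G.base.swap, G.dirs.map Dir.other⟩ with hH
  have hd : H.d = G.d := by simp [hH, d]
  have htile : ∀ k, 1 ≤ k → k ≤ G.d → H.tile k = (G.tile k).swap := by
    intro k h1 h2
    refine H.tile_eq_of_step (τ := fun k => (G.tile k).swap) (n := G.d) ?_ ?_ hd.ge h1 h2
    · simp [hH]
    · intro k hk hk'
      have : H.dir k = (G.dir k).other := by
        have hk'' : k - 1 < G.dirs.length := by simp only [d] at hk'; omega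
        simp only [hH, dir, List.getD_eq_getElem?_getD, List.getElem?_map]
        rw [List.getElem?_eq_getElem hk'']
        rfl
      rw [this, G.tile_succ hk hk']
      cases G.dir k <;> simp [Dir.other, Dir.step, Prod.swap]
  refine sym2_image_tiles (τ := Prod.swap) ?_ ?_
  · rintro ⟨x, y⟩
    simp [tileEdges, Set.image_insert_eq, southE, westE, northE, eastE]
    ext e
    simp
    tauto
  · ext p
    rw [tiles, hd]
    constructor
    · rintro ⟨k, h1, h2, rfl⟩
      exact ⟨_, ⟨k, h1, h2, rfl⟩, (htile k h1 h2).symm⟩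
    · rintro ⟨_, ⟨k, h1, h2, rfl⟩, rfl⟩
      exact ⟨k, h1, h2, htile k h1 h2⟩

theorem SnakeGraph.shift_tile (G : SnakeGraph) (v : Pt) (k : ℕ) :
    (⟨G.base + v, G.dirs⟩ : SnakeGraph).tile k = G.tile k + v := by
  simp [tile, add_right_comm]

theorem map_add_tileEdges (v q : Pt) :
    Sym2.map (fun p => p + v) '' tileEdges q = tileEdges (q + v) := by
  simp only [tileEdges, Set.image_insert_eq, Set.image_singleton, southE, westE, northE, eastE,
    Sym2.map_mk, add_right_comm]

theorem SnakeGraph.shift_edges (G : SnakeGraph) (v : Pt) :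
    (⟨G.base + v, G.dirs⟩ : SnakeGraph).edges = Sym2.map (fun p => p + v) '' G.edges := by
  refine sym2_image_tiles (map_add_tileEdges v) ?_
  ext p
  constructor
  · rintro ⟨k, h1, h2, rfl⟩
    exact ⟨_, ⟨k, h1, h2, rfl⟩, (G.shift_tile v k).symm⟩
  · rintro ⟨_, ⟨k, h1, h2, rfl⟩, rfl⟩
    exact ⟨k, h1, h2, G.shift_tile v k⟩

theorem Motion.onPt_injective (m : Motion) : Function.Injective m.onPt := by
  obtain ⟨fl, rv, v⟩ := m
  intro p q h
  simp only [Motion.onPt, add_left_inj] at h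
  cases fl <;> cases rv <;> simp only [if_true, if_false, Bool.false_eq_true] at h
  · exact h
  · exact barPt_injective h
  · exact Prod.swap_injective h
  · exact Prod.swap_injective (barPt_injective h)

theorem Motion.onSnake_edges (m : Motion) (G : SnakeGraph) :
    (m.onSnake G).edges = m.onEdge '' G.edges := by
  obtain ⟨fl, rv, v⟩ := m
  have e1 : (if fl then ⟨G.base.swap, G.dirs.map Dir.other⟩ else G : SnakeGraph).edges =
      Sym2.map (fun p : Pt => if fl then p.swap else p) '' G.edges := by
    cases fl
    · simp [Sym2.map_id']
    · exact G.flip_edges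
  set G₁ : SnakeGraph := if fl then ⟨G.base.swap, G.dirs.map Dir.other⟩ else G with hG₁
  have e2 : (if rv then G₁.bar else G₁).edges =
      Sym2.map (fun p : Pt => if rv then barPt p else p) '' G₁.edges := by
    cases rv
    · simp [Sym2.map_id']
    · exact G₁.bar_edges
  refine ((if rv then G₁.bar else G₁).shift_edges v).trans ?_
  rw [e2, e1, Set.image_image, Set.image_image]
  refine Set.image_congr fun e _ => ?_
  simp only [Sym2.map_map, Motion.onEdge]
  rfl

theorem Motion.onEdge_injective (m : Motion) : Function.Injective m.onEdge :=
  Sym2.map.injective m.onPt_injective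

theorem mem_perfectMatchings_onSnake {m : Motion} {G : SnakeGraph} {P : Set Edge} :
    m.onEdge '' P ∈ perfectMatchings (Piece.snake (m.onSnake G)).graph ↔
      P ∈ perfectMatchings (Piece.snake G).graph := by
  rw [Piece.mem_perfectMatchings (Piece.not_isDiag_snake _),
    Piece.mem_perfectMatchings (Piece.not_isDiag_snake _)]
  change IsPM (m.onSnake G).edges _ ↔ IsPM G.edges P
  rw [m.onSnake_edges]
  exact isPM_image m.onPt_injective _ _

theorem exists_onEdge_image_eq {m : Motion} {G : SnakeGraph} {Q : Set Edge}
    (hQ : Q ∈ perfectMatchings (Piece.snake (m.onSnake G)).graph) :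
    ∃ P ∈ perfectMatchings (Piece.snake G).graph, m.onEdge '' P = Q := by
  obtain ⟨P, rfl⟩ : ∃ P, m.onEdge '' P = Q := by
    rw [Piece.mem_perfectMatchings (Piece.not_isDiag_snake _)] at hQ
    have := hQ.1
    change Q ⊆ (m.onSnake G).edges at this
    rw [m.onSnake_edges] at this
    obtain ⟨P, -, h⟩ := Set.subset_image_iff.1 this
    exact ⟨P, h⟩
  exact ⟨P, mem_perfectMatchings_onSnake.1 hQ, rfl⟩

/-! ### Sign functions -/

/-- The edges on which `f` has the value `c` follow the pattern `b`. -/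
def SignPat (G : SnakeGraph) (f : Edge → ℤˣ) (c : ℤˣ) (b : Bool) : Prop :=
  ∀ k, 1 ≤ k → k ≤ G.d → ∀ a, (f (sideOut (G.tile k) a) = c ↔ pat b (G.tile k) = a) ∧
    (f (sideIn (G.tile k) a) = c ↔ pat b (G.tile k) ≠ a)

theorem units_eq_neg_iff {x c : ℤˣ} : -x = c ↔ x ≠ c := by
  rcases Int.units_eq_one_or x with rfl | rfl <;> rcases Int.units_eq_one_or c with rfl | rfl <;>
    decide

/-- The sign of the north edge determines those of the other three edges of the tile. -/
theorem IsSign.sides {G : SnakeGraph} {f : Edge → ℤˣ} (hf : IsSign G f) {c : ℤˣ} {b : Bool} {k : ℕ}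
    (h1 : 1 ≤ k) (h2 : k ≤ G.d) (H : f (northE (G.tile k)) = c ↔ pat b (G.tile k) = .north) (a : Dir) :
    (f (sideOut (G.tile k) a) = c ↔ pat b (G.tile k) = a) ∧
      (f (sideIn (G.tile k) a) = c ↔ pat b (G.tile k) ≠ a) := by
  obtain ⟨s1, s2, s3⟩ := hf k h1 h2
  have s4 : f (southE (G.tile k)) = -f (northE (G.tile k)) := by rw [s3, neg_neg]
  have hne : ∀ x : Dir, x = .east ↔ ¬ x = .north := by intro x; cases x <;> simp
  have hne' : ∀ x : Dir, x ≠ .east ↔ x = .north := by intro x; cases x <;> simp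
  cases a
  · refine ⟨H, ?_⟩
    rw [sideIn, s4, units_eq_neg_iff, Ne, H]
  · refine ⟨?_, ?_⟩
    · rw [sideOut, ← s2, s4, units_eq_neg_iff, Ne, H, hne]
    · rw [sideIn, ← s1, H, hne']

/-- On each tile the sign `c` occurs on one of the sides north, east and on the non-parallel one of
south, west. An interior edge is of the former kind for one tile and of the latter for the next, so
the direction of the side of sign `c` alternates along the snake graph. -/
theorem IsSign.exists_signPat {G : SnakeGraph} {f : Edge → ℤˣ} (hf : IsSign G f) (c : ℤˣ) :
    ∃ b, SignPat G f c b := by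
  obtain ⟨b, hb⟩ : ∃ b, f (northE (G.tile 1)) = c ↔ pat b (G.tile 1) = .north := by
    by_cases h : f (northE (G.tile 1)) = c
    · obtain ⟨b, hb⟩ := exists_pat_eq (G.tile 1) .north
      exact ⟨b, by rw [hb]; simpa using h⟩
    · obtain ⟨b, hb⟩ := exists_pat_eq (G.tile 1) .east
      exact ⟨b, by rw [hb]; simpa using h⟩
  refine ⟨b, fun k h1 h2 a => hf.sides h1 h2 ?_ a⟩
  induction k, h1 using Nat.le_induction with
  | base => exact hb
  | succ k hk ih =>
    have hs := (hf.sides hk (by omega) (ih (by omega)) (G.dir k)).1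
    rw [sideOut_eq_seg, ← G.tile_succ hk (by omega), ← sideIn_eq_seg] at hs
    obtain ⟨s1, s2, s3⟩ := hf (k + 1) (by omega) h2
    have hp : pat b (G.tile (k + 1)) = (pat b (G.tile k)).other := by
      rw [G.tile_succ hk (by omega), pat_add_step]
    rw [hp, Dir.other_eq_iff]
    cases hd : G.dir k
    · rw [hd, sideIn] at hs
      rw [s3, units_eq_neg_iff, Ne, hs]
    · rw [hd, sideIn] at hs
      rw [s1, hs]
      cases pat b (G.tile k) <;> simp

theorem SignPat.inner {G : SnakeGraph} {f : Edge → ℤˣ} {c : ℤˣ} {b : Bool} (H : SignPat G f c b)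
    {k : ℕ} (h1 : 1 ≤ k) (h2 : k < G.d) : f (G.inner k) = c ↔ pat b (G.tile k) = G.dir k :=
  (H k h1 h2.le _).1

theorem SignPat.inner_succ {G : SnakeGraph} {f : Edge → ℤˣ} {c : ℤˣ} {b : Bool}
    (H : SignPat G f c b) {k : ℕ} (h1 : 1 ≤ k) (h2 : k < G.d) :
    f (G.inner k) = c ↔ pat b (G.tile (k + 1)) ≠ G.dir k := by
  rw [H.inner h1 h2, G.tile_succ h1 h2, pat_add_step, Ne, Dir.other_eq_iff, not_not]

/-! ### Initial and final pieces -/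

/-- The restriction to the piece `A` describes the words on the part `S` of the set of tiles `T` with
the value `x` at `r`. -/
structure ForcedPiece (A : Piece) (T S : Set Pt) (r : Pt) (x : Dir) : Prop where
  not_isDiag : ∀ e ∈ A.edges, ¬ e.IsDiag
  mem : ∀ h, IsWord T h → h r = x → wordEdges T h ∩ A.edges ∈ perfectMatchings A.graph
  inj : ∀ h h', IsWord T h → IsWord T h' → h r = x → h' r = x →
    (wordEdges T h ∩ A.edges = wordEdges T h' ∩ A.edges ↔ Set.EqOn h h' S)
  surj : ∀ Q ∈ perfectMatchings A.graph, ∃ h, IsWord S h ∧ h r = x ∧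
    ∀ k, IsWord T k → Set.EqOn k h S → wordEdges T k ∩ A.edges = Q

/-- A piece that is a snake graph; the values of the words outside of the piece are forced. -/
theorem forcedPiece_snake {G : SnakeGraph} {T S : Set Pt} {r : Pt} {b : Bool}
    (hG : G.tiles ⊆ S) (hS : S ⊆ T) (hr : r ∈ S) (hrG : r ∉ G.tiles)
    (h1 : ∀ p a, p ∈ G.tiles → p + Dir.step a ∈ T → p + a.step ∉ G.tiles →
      p + a.step ∈ S ∧ pat b (p + a.step) = a)
    (h2 : ∀ p a, p ∈ G.tiles → p - Dir.step a ∈ T → p - a.step ∉ G.tiles →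
      p - a.step ∈ S ∧ pat b (p - a.step) = a)
    (hforced : ∀ h, IsWord T h → h r = pat b r → ∀ p ∈ S, p ∉ G.tiles → h p = pat b p) :
    ForcedPiece (.snake G) T S r (pat b r) := by
  have key : ∀ h, IsWord T h → h r = pat b r →
      wordEdges T h ∩ (Piece.snake G).edges = wordEdges G.tiles h := by
    intro h hh hhr
    change wordEdges T h ∩ G.edges = _
    rw [G.edges_eq]
    refine wordEdges_inter (hG.trans hS) (fun p a hp hpa hpa' _ => ?_) (fun p a hp hpa hpa' _ => ?_)
    · rw [hforced h hh hhr _ (h1 p a hp hpa hpa').1 hpa']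
      exact (h1 p a hp hpa hpa').2
    · rw [hforced h hh hhr _ (h2 p a hp hpa hpa').1 hpa']
      exact (h2 p a hp hpa hpa').2
  refine ⟨Piece.not_isDiag_snake G, ?_, ?_, ?_⟩
  · intro h hh hhr
    rw [key h hh hhr]
    exact mem_perfectMatchings_snake.2 ⟨h, hh.mono (hG.trans hS), rfl⟩
  · intro h h' hh hh' hhr hhr'
    rw [key h hh hhr, key h' hh' hhr']
    constructor
    · intro e p hp
      by_cases hpG : p ∈ G.tiles
      · exact eqOn_of_wordEdges_eq G.thin e hpG
      · rw [hforced h hh hhr p hp hpG, hforced h' hh' hhr' p hp hpG]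
    · exact fun e => wordEdges_congr (e.mono hG)
  · intro Q hQ
    obtain ⟨g, hg, rfl⟩ := mem_perfectMatchings_snake.1 hQ
    classical
    -- Outside of the piece the word is the forced pattern; at its border the adjacency condition is
    -- met by the outer tile, so any word on the piece is allowed.
    let h : Pt → Dir := fun p => if p ∈ G.tiles then g p else pat b p
    have hin : ∀ p, p ∈ G.tiles → h p = g p := fun p hp => if_pos hp
    have hout : ∀ p, p ∉ G.tiles → h p = pat b p := fun p hp => if_neg hp
    refine ⟨h, ?_, hout r hrG, fun k hk e => ?_⟩
    · intro p a hp hpa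
      by_cases c1 : p ∈ G.tiles <;> by_cases c2 : p + a.step ∈ G.tiles
      · rw [hin p c1, hin _ c2]
        exact hg p a c1 c2
      · rw [hout _ c2]
        exact .inr (h1 p a c1 (hS hpa) c2).2
      · rw [hout _ c1]
        have := h2 (p + a.step) a c2
        simp only [add_sub_cancel_right] at this
        exact .inl (this (hS hp) c1).2
      · rw [hout p c1, hout _ c2]
        exact isWord_pat b S p a hp hpa
    · rw [key k hk ((e hr).trans (hout r hrG))]
      exact wordEdges_congr fun p hp => (e (hG hp)).trans (hin p hp)

/-- A piece that is a single edge; the words are forced. -/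
theorem forcedPiece_single {T S : Set Pt} {r : Pt} {b : Bool} (hS : S ⊆ T) {p : Pt} {a : Dir}
    (hp : (p ∈ S ∧ p - a.step ∉ T ∧ pat b p = a) ∨
      (p - a.step ∈ S ∧ p ∉ T ∧ pat b (p - a.step) = a))
    (hr : r ∈ S) (hforced : ∀ h, IsWord T h → h r = pat b r → ∀ p ∈ S, h p = pat b p) :
    ForcedPiece (.single (seg p a)) T S r (pat b r) := by
  have key : ∀ h, IsWord T h → h r = pat b r →
      wordEdges T h ∩ (Piece.single (seg p a)).edges = {seg p a} := by
    intro h hh hhr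
    refine Set.inter_eq_right.2 ?_
    rintro _ rfl
    rw [seg_mem_wordEdges]
    rcases hp with ⟨h1, h2, h3⟩ | ⟨h1, h2, h3⟩
    · exact ⟨.inl (hS h1), fun _ => (hforced h hh hhr _ h1).trans h3, fun h => absurd h h2⟩
    · exact ⟨.inr (hS h1), fun h => absurd h h2, fun _ => (hforced h hh hhr _ h1).trans h3⟩
  refine ⟨?_, ?_, ?_, ?_⟩
  · rintro _ rfl
    exact not_isDiag_seg p a
  · intro h hh hhr
    rw [key h hh hhr]
    exact mem_perfectMatchings_single.2 rfl
  · intro h h' hh hh' hhr hhr'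
    rw [key h hh hhr, key h' hh' hhr']
    exact iff_of_true rfl fun p hp => by rw [hforced h hh hhr p hp, hforced h' hh' hhr' p hp]
  · intro Q hQ
    obtain rfl := mem_perfectMatchings_single.1 hQ
    exact ⟨pat b, isWord_pat b S, rfl, fun k hk e => key k hk (e hr)⟩

/-! ### Propagation of forced values along a snake graph -/

section Index

variable {G : SnakeGraph} {f : Edge → ℤˣ} {c : ℤˣ} {b : Bool}

/-- Propagation of the pattern towards the first tile. -/
theorem SignPat.forced_before (hb : SignPat G f c b) {h : Pt → Dir} (hh : IsWord G.tiles h) {m n : ℕ}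
    (hn : n + 1 ≤ G.d) (hr : h (G.tile (n + 1)) = pat (!b) (G.tile (n + 1)))
    (hm : ∀ j, m < j → 1 ≤ j → j ≤ n → f (G.inner j) ≠ c) {j : ℕ} (h1 : 1 ≤ j) (hmj : m < j)
    (hjn : j ≤ n + 1) : h (G.tile j) = pat (!b) (G.tile j) := by
  obtain ⟨i, hi⟩ : ∃ i, n + 1 = j + i := ⟨n + 1 - j, by omega⟩
  clear hjn
  induction i generalizing j with
  | zero => rw [← Nat.add_zero j, ← hi]; exact hr
  | succ i ih =>
    have ih' := ih (j := j + 1) (by omega) (by omega) (by omega)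
    -- As `e_j` does not have the sign `c`, the pattern `b` has the value `G.dir j` at `G_{j+1}` and
    -- the other value at `G_j`. The known value at `G_{j+1}`, from the opposite pattern, violates
    -- the condition at `e_j`, so `G_j` must satisfy it.
    have hne := hm j hmj h1 (by omega)
    have e1 := mt (hb.inner h1 (by omega)).2 hne
    have e2 := not_not.1 (mt (hb.inner_succ h1 (by omega)).2 hne)
    have hw := hh (G.tile j) (G.dir j) (G.tile_mem h1 (by omega))
    rw [← G.tile_succ h1 (by omega)] at hw
    have := (hw (G.tile_mem (by omega) (by omega))).resolve_right (by
      rw [ih', pat_not, e2]; exact Dir.other_ne _)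
    rw [this, pat_not, eq_comm, Dir.other_eq_iff]
    exact e1

/-- Propagation of the pattern towards the last tile. -/
theorem SignPat.forced_after (hb : SignPat G f c b) {h : Pt → Dir} (hh : IsWord G.tiles h) {m n : ℕ}
    (hn : 1 ≤ n) (hr : h (G.tile n) = pat b (G.tile n))
    (hm : ∀ j, n ≤ j → j + 1 < m → j < G.d → f (G.inner j) ≠ c) {j : ℕ} (h1 : n ≤ j) (hmj : j < m)
    (hjd : j ≤ G.d) : h (G.tile j) = pat b (G.tile j) := by
  induction j, h1 using Nat.le_induction with
  | base => exact hr
  | succ j hj ih =>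
    have ih' := ih (by omega) (by omega)
    -- The same reasoning forwards: the value of the pattern `b` at `G_j` is not `G.dir j`, so
    -- `G_{j+1}` must have this value.
    have hne := hm j hj hmj (by omega)
    have e1 := mt (hb.inner (by omega) (by omega)).2 hne
    have e2 := not_not.1 (mt (hb.inner_succ (k := j) (by omega) (by omega)).2 hne)
    have hw := hh (G.tile j) (G.dir j) (G.tile_mem (by omega) (by omega))
    rw [← G.tile_succ (by omega) (by omega)] at hw
    have := (hw (G.tile_mem (by omega) (by omega))).resolve_left (by rw [ih']; exact e1)
    rw [this, e2]

/-- The value of the opposite pattern at `G_{n+1}` is passed backwards across every edge whose sign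
is not `c`. At the first edge `e_k` of sign `c` that is met, the forced value at `G_{k+1}` already
satisfies the adjacency condition, so the word on `G[1, k]` is free. If there is no such edge, all
values are forced and the matching of the single edge `e_0` carries no information. -/
theorem initialPiece_forced (hb : SignPat G f c b) {n : ℕ} (hn : n + 1 ≤ G.d) :
    ForcedPiece (initialPiece G f c n) G.tiles (G.tilesOf 1 (n + 1)) (G.tile (n + 1))
      (pat (!b) (G.tile (n + 1))) := by
  have hS : G.tilesOf 1 (n + 1) ⊆ G.tiles := G.tilesOf_mono le_rfl hn
  have hr : G.tile (n + 1) ∈ G.tilesOf 1 (n + 1) := ⟨_, by omega, le_rfl, rfl⟩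
  unfold initialPiece
  split_ifs with hex hsouth
  · obtain ⟨m, hm1, hm2, hm3⟩ := hex
    classical
    have hspec := Nat.findGreatest_spec (P := fun k => 1 ≤ k ∧ f (G.inner k) = c) hm2 ⟨hm1, hm3⟩
    have hle := Nat.findGreatest_le (P := fun k => 1 ≤ k ∧ f (G.inner k) = c) n
    have hgr := fun {k} => Nat.findGreatest_is_greatest
      (P := fun k => 1 ≤ k ∧ f (G.inner k) = c) (n := n) (k := k)
    convert_to ForcedPiece (Piece.snake (G.sub 1
      (Nat.findGreatest (fun k => 1 ≤ k ∧ f (G.inner k) = c) n))) _ _ _ _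
    set k₀ := Nat.findGreatest (fun k => 1 ≤ k ∧ f (G.inner k) = c) n
    obtain ⟨hk1, hk2⟩ := hspec
    have htiles := G.sub_tiles le_rfl hk1 (show k₀ ≤ G.d by omega)
    have hmem : ∀ j, 1 ≤ j → j ≤ G.d → (G.tile j ∈ (G.sub 1 k₀).tiles ↔ j ≤ k₀) := by
      intro j h1 h2
      rw [htiles, G.tile_mem_tilesOf le_rfl (by omega) h1 h2]
      omega
    refine forcedPiece_snake ?_ hS hr ?_ ?_ ?_ ?_
    · rw [htiles]; exact G.tilesOf_mono le_rfl (by omega)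
    · rw [hmem _ (by omega) hn]; omega
    · rintro p a hp hpa hpa'
      rw [htiles] at hp
      obtain ⟨j, h1, h2, rfl⟩ := hp
      obtain ⟨h3, rfl⟩ := (G.tile_add_step_mem h1 (by omega)).1 hpa
      rw [← G.tile_succ h1 h3, hmem _ (by omega) (by omega)] at hpa'
      obtain rfl : j = k₀ := by omega
      rw [← G.tile_succ h1 h3, pat_not, Dir.other_eq_iff]
      exact ⟨⟨_, by omega, by omega, rfl⟩, (hb.inner_succ h1 h3).1 hk2⟩
    · rintro p a hp hpa hpa'
      rw [htiles] at hp
      obtain ⟨j, h1, h2, rfl⟩ := hp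
      obtain ⟨h3, rfl⟩ := (G.tile_sub_step_mem h1 (by omega)).1 hpa
      rw [← G.tile_pred h3 (by omega), hmem _ (by omega) (by omega)] at hpa'
      omega
    · rintro h hh hr _ ⟨j, h1, h2, rfl⟩ hj
      rw [hmem _ h1 (by omega)] at hj
      exact hb.forced_before hh hn hr (m := k₀) (fun i h3 h4 h5 h6 => hgr h3 h5 ⟨h4, h6⟩) h1
        (by omega) h2
  all_goals
    have hforced : ∀ h, IsWord G.tiles h → h (G.tile (n + 1)) = pat (!b) (G.tile (n + 1)) →
        ∀ p ∈ G.tilesOf 1 (n + 1), h p = pat (!b) p := by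
      rintro h hh hr _ ⟨j, h1, h2, rfl⟩
      exact hb.forced_before hh hn hr (m := 0)
        (fun i _ h4 h5 h6 => hex ⟨i, h4, h5, h6⟩) h1 (by omega) h2
    have hside := fun a => (hb 1 le_rfl (by omega) a).2
    have hnot : ∀ a : Dir, G.tile 1 - a.step ∉ G.tiles := fun a h => by
      have := ((G.tile_sub_step_mem le_rfl G.one_le_d).1 h).1
      omega
  · refine forcedPiece_single (p := G.tile 1) (a := .north) hS (.inl ⟨⟨1, le_rfl, by omega, rfl⟩,
      hnot _, ?_⟩) hr hforced
    rw [pat_not, Dir.other_eq_iff]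
    exact (hside .north).1 hsouth
  · refine forcedPiece_single (p := G.tile 1) (a := .east) hS (.inl ⟨⟨1, le_rfl, by omega, rfl⟩,
      hnot _, ?_⟩) hr hforced
    have := not_not.1 (mt (hside .north).2 hsouth)
    rw [pat_not, this]
    rfl

/-- Forwards it is the pattern `b` itself that is passed on from `G_n`, until an edge `e_{k-1}` of
sign `c` sets the word on `G[k, d]` free. -/
theorem finalPiece_forced (hb : SignPat G f c b) {n : ℕ} (h1n : 1 ≤ n) (hn : n ≤ G.d) :
    ForcedPiece (finalPiece G f c n) G.tiles (G.tilesOf n G.d) (G.tile n) (pat b (G.tile n)) := by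
  have hS : G.tilesOf n G.d ⊆ G.tiles := G.tilesOf_mono h1n le_rfl
  have hr : G.tile n ∈ G.tilesOf n G.d := ⟨_, le_rfl, hn, rfl⟩
  unfold finalPiece
  split_ifs with hex hnorth
  · classical
    have hspec := Nat.find_spec hex
    have hmin := fun {m} => Nat.find_min hex (m := m)
    set k₀ := Nat.find hex
    obtain ⟨hk1, hk2, hk3⟩ := hspec
    have htiles := G.sub_tiles (i := k₀) (by omega) hk2 le_rfl
    have hmem : ∀ j, 1 ≤ j → j ≤ G.d → (G.tile j ∈ (G.sub k₀ G.d).tiles ↔ k₀ ≤ j) := by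
      intro j h1 h2
      rw [htiles, G.tile_mem_tilesOf (by omega) le_rfl h1 h2]
      omega
    refine forcedPiece_snake ?_ hS hr ?_ ?_ ?_ ?_
    · rw [htiles]; exact G.tilesOf_mono (by omega) le_rfl
    · rw [hmem _ h1n hn]; omega
    · rintro p a hp hpa hpa'
      rw [htiles] at hp
      obtain ⟨j, h1, h2, rfl⟩ := hp
      obtain ⟨h3, rfl⟩ := (G.tile_add_step_mem (by omega) h2).1 hpa
      rw [← G.tile_succ (by omega) h3, hmem _ (by omega) (by omega)] at hpa'
      omega
    · rintro p a hp hpa hpa'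
      rw [htiles] at hp
      obtain ⟨j, h1, h2, rfl⟩ := hp
      obtain ⟨h3, rfl⟩ := (G.tile_sub_step_mem (by omega) h2).1 hpa
      rw [← G.tile_pred h3 h2, hmem _ (by omega) (by omega)] at hpa'
      obtain rfl : j = k₀ := by omega
      rw [← G.tile_pred h3 h2]
      exact ⟨⟨_, by omega, by omega, rfl⟩, (hb.inner (by omega) (by omega)).1 hk3⟩
    · rintro h hh hr _ ⟨j, h1, h2, rfl⟩ hj
      rw [hmem _ (by omega) h2] at hj
      exact hb.forced_after hh h1n hr (m := k₀) (fun i h3 h4 h5 h6 =>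
        hmin h4 ⟨by omega, by omega, by simpa using h6⟩) h1 (by omega) h2
  all_goals
    have hforced : ∀ h, IsWord G.tiles h → h (G.tile n) = pat b (G.tile n) →
        ∀ p ∈ G.tilesOf n G.d, h p = pat b p := by
      rintro h hh hr _ ⟨j, h1, h2, rfl⟩
      exact hb.forced_after hh h1n hr (m := G.d + 1)
        (fun i h3 h4 h5 h6 => hex ⟨i + 1, by omega, by omega, by simpa using h6⟩) h1 (by omega) h2
    have hside := fun a => (hb G.d G.one_le_d le_rfl a).1
    have hnot : ∀ a : Dir, G.last + a.step ∉ G.tiles := fun a h => by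
      have := ((G.tile_add_step_mem G.one_le_d le_rfl).1 h).1
      omega
  · have e : northE G.last = seg (G.last + Dir.north.step) .north := sideOut_eq_seg _ .north
    rw [e]
    refine forcedPiece_single hS (.inr ⟨?_, hnot _, ?_⟩) hr hforced
    · rw [add_sub_cancel_right]; exact ⟨_, hn, le_rfl, rfl⟩
    · rw [add_sub_cancel_right]
      exact (hside .north).1 hnorth
  · have e : eastE G.last = seg (G.last + Dir.east.step) .east := sideOut_eq_seg _ .east
    rw [e]
    refine forcedPiece_single hS (.inr ⟨?_, hnot _, ?_⟩) hr hforced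
    · rw [add_sub_cancel_right]; exact ⟨_, hn, le_rfl, rfl⟩
    · rw [add_sub_cancel_right]
      have := mt (hside .north).2 hnorth
      exact Dir.ne_iff.1 this

end Index

/-! ### Gluing -/

theorem SnakeGraph.tile_eq_last_of_mem (G : SnakeGraph) {p : Pt} (hp : p ∈ G.tiles)
    (h : lev G.last ≤ lev p) : p = G.last := by
  obtain ⟨k, h1, h2, rfl⟩ := hp
  rw [last, G.lev_tile h1 h2, G.lev_tile G.one_le_d le_rfl] at h
  obtain rfl : k = G.d := by omega
  rfl

theorem SnakeGraph.lev_le_last (G : SnakeGraph) {p : Pt} (hp : p ∈ G.tiles) : lev p ≤ lev G.last := by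
  obtain ⟨k, h1, h2, rfl⟩ := hp
  rw [last, G.lev_tile h1 h2, G.lev_tile G.one_le_d le_rfl]
  omega

theorem SnakeGraph.base_lev_le (G : SnakeGraph) {p : Pt} (hp : p ∈ G.tiles) :
    lev G.base ≤ lev p := by
  obtain ⟨k, h1, h2, rfl⟩ := hp
  rw [G.lev_tile h1 h2]
  omega

theorem SnakeGraph.base_mem (G : SnakeGraph) : G.base ∈ G.tiles := by
  rw [← tile_one]; exact G.tile_mem le_rfl G.one_le_d

theorem SnakeGraph.last_mem (G : SnakeGraph) : G.last ∈ G.tiles := G.tile_mem G.one_le_d le_rfl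

@[simp] theorem lev_add (p q : Pt) : lev (p + q) = lev p + lev q := by
  simp [lev]; ring

@[simp] theorem lev_sub (p q : Pt) : lev (p - q) = lev p - lev q := by
  simp [lev]; ring

@[simp] theorem lev_step (a : Dir) : lev a.step = 1 := by cases a <;> rfl

theorem seg_map_add (v p : Pt) (a : Dir) : (seg p a).map (fun p => p + v) = seg (p + v) a := by
  cases a <;> simp [seg, sideIn, southE, westE, add_right_comm]

theorem image_add_wordEdges (v : Pt) (T : Set Pt) (h : Pt → Dir) :
    Sym2.map (fun p => p + v) '' wordEdges T h =
      wordEdges ((fun p => p + v) '' T) (fun p => h (p - v)) := by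
  ext e
  constructor
  · rintro ⟨_, ⟨p, a, rfl, H⟩, rfl⟩
    rw [seg_map_add, seg_mem_wordEdges, show p + v - a.step = (p - a.step) + v by abel]
    simpa using H
  · rintro ⟨p, a, rfl, H⟩
    refine ⟨seg (p - v) a, ?_, by rw [seg_map_add, sub_add_cancel]⟩
    rw [seg_mem_wordEdges, show p - v - a.step = p - a.step - v by abel]
    have hmem : ∀ q : Pt, q ∈ (fun p => p + v) '' T ↔ q - v ∈ T := by
      intro q
      constructor
      · rintro ⟨x, hx, rfl⟩; simpa using hx
      · exact fun h => ⟨_, h, by simp⟩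
    simpa only [hmem] using H

section Glue

variable (A : SnakeGraph) (a : Dir) (B : SnakeGraph)

/-- The word on `glue A a B` given by words on `A` and `B`. -/
def glueWord (h k : Pt → Dir) : Pt → Dir := fun p =>
  if lev p ≤ lev A.last then h p else k (p - (A.last + a.step - B.base))

theorem glueWord_left {h k : Pt → Dir} : Set.EqOn (glueWord A a B h k) h A.tiles :=
  fun _ hp => if_pos (A.lev_le_last hp)

theorem glueWord_right {h k : Pt → Dir} {p : Pt} (hp : p ∈ B.tiles) :
    glueWord A a B h k (p + (A.last + a.step - B.base)) = k p := by
  rw [glueWord, if_neg, add_sub_cancel_right]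
  have := B.base_lev_le hp
  simp
  omega

theorem disjoint_glue :
    Disjoint A.tiles ((fun p => p + (A.last + a.step - B.base)) '' B.tiles) := by
  rw [Set.disjoint_left]
  rintro _ hp ⟨q, hq, rfl⟩
  have h1 := A.lev_le_last hp
  have h2 := B.base_lev_le hq
  simp at h1
  omega

/-- The tiles of `A` lie on earlier antidiagonals than those of the translated `B`. The two tiles of
a common edge are on consecutive antidiagonals, hence they are the last tile of `A` and the first
one of `B`. -/
theorem glue_inter_edges :
    tileSetEdges A.tiles ∩ tileSetEdges ((fun p => p + (A.last + a.step - B.base)) '' B.tiles) =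
      {sideOut A.last a} := by
  rw [sideOut_eq_seg]
  ext e
  constructor
  · rintro ⟨⟨p, c, rfl, h1⟩, h2⟩
    rw [seg_mem_tileSetEdges] at h2
    have hB : ∀ q, q ∈ (fun p => p + (A.last + a.step - B.base)) '' B.tiles →
        lev A.last + 1 ≤ lev q ∧ (lev q = lev A.last + 1 → q = A.last + a.step) := by
      rintro _ ⟨q, hq, rfl⟩
      have h2 := B.base_lev_le hq
      refine ⟨by simp; omega, fun h => ?_⟩
      have : q = B.base := B.thin _ hq _ B.base_mem (by simp at h; omega)
      rw [this]; simp
    have hA : ∀ q, q ∈ A.tiles → lev q ≤ lev A.last ∧ (lev q = lev A.last → q = A.last) :=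
      fun q hq => ⟨A.lev_le_last hq, fun h => A.tile_eq_last_of_mem hq h.ge⟩
    have hl : lev (p - c.step) = lev p - 1 := lev_sub_step p c
    rcases h1 with h1 | h1 <;> rcases h2 with h2 | h2
    · have := hA _ h1; have := hB _ h2; omega
    · have := hA _ h1; have := hB _ h2; omega
    · have e1 := hA _ h1
      have e2 := hB _ h2
      have e3 := e1.2 (by omega)
      have e4 := e2.2 (by omega)
      rw [e4] at e3 ⊢
      have : c = a := by
        have : a.step - c.step = 0 := by
          rw [add_sub_assoc] at e3
          simpa using e3
        exact (Dir.step_injective (sub_eq_zero.1 this)).symm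
      rw [this]; rfl
    · have := hA _ h1; have := hB _ h2; omega
  · rintro rfl
    refine ⟨seg_mem_tileSetEdges.2 (.inr ?_), seg_mem_tileSetEdges.2 (.inl ⟨B.base, B.base_mem, ?_⟩)⟩
    · rw [add_sub_cancel_right]; exact A.last_mem
    · simp

/-- The rule for the gluing edge, that it is kept only if both sets contain it, is the rule by which
a word defines its edges. -/
theorem glueMatching_wordEdges (h k : Pt → Dir) :
    glueMatching A a B (wordEdges A.tiles h) (wordEdges B.tiles k) =
      wordEdges (glue A a B).tiles (glueWord A a B h k) := by
  rw [SnakeGraph.glue_tiles, wordEdges_union (disjoint_glue A a B), glue_inter_edges]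
  have e1 : glueEdge A a B '' wordEdges B.tiles k =
      wordEdges ((fun p => p + (A.last + a.step - B.base)) '' B.tiles) (glueWord A a B h k) := by
    refine (image_add_wordEdges _ _ _).trans (wordEdges_congr ?_)
    rintro _ ⟨p, hp, rfl⟩
    rw [glueWord_right A a B hp]
    simp only [add_sub_cancel_right]
  rw [glueMatching, e1, wordEdges_congr (glueWord_left A a B (h := h) (k := k)).symm]
  rfl

/-- Gluing creates one new adjacency, between the last tile of `A` and the first tile of `B`. -/
theorem isWord_glueWord_iff {h k : Pt → Dir} :
    IsWord (glue A a B).tiles (glueWord A a B h k) ↔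
      IsWord A.tiles h ∧ IsWord B.tiles k ∧ (h A.last = a ∨ k B.base = a) := by
  rw [SnakeGraph.glue_tiles]
  set v := A.last + a.step - B.base with hv
  have hBv : B.base + v = A.last + a.step := by rw [hv]; abel
  constructor
  · intro H
    refine ⟨(H.mono Set.subset_union_left).congr (glueWord_left A a B), fun p c hp hpc => ?_, ?_⟩
    · have := H (p + v) c (.inr ⟨p, hp, rfl⟩) (.inr ⟨_, hpc, by simp [add_right_comm]⟩)
      rwa [add_right_comm, glueWord_right A a B hp, glueWord_right A a B hpc] at this
    · have := H A.last a (.inl A.last_mem) (.inr ⟨B.base, B.base_mem, hBv⟩)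
      rwa [glueWord_left A a B A.last_mem, ← hBv, glueWord_right A a B B.base_mem] at this
  · rintro ⟨hA, hB, hAB⟩ p c (hp | ⟨p, hp, rfl⟩) (hpc | ⟨q, hq, hqp⟩)
    · rw [glueWord_left A a B hp, glueWord_left A a B hpc]
      exact hA p c hp hpc
    · simp only at hqp
      have h1 := A.lev_le_last hp
      have h2 := B.base_lev_le hq
      have h3 := congrArg lev hqp
      have h4 := congrArg lev hBv
      simp only [lev_add, lev_step] at h3 h4
      have hpl := A.tile_eq_last_of_mem hp (by omega)
      have hql : q = B.base := B.thin _ hq _ B.base_mem (by omega)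
      subst hpl hql
      obtain rfl : c = a := Dir.step_injective (add_left_cancel (hqp.symm.trans hBv))
      rw [← hqp, glueWord_left A c B A.last_mem, glueWord_right A c B hq]
      exact hAB
    · have h1 := A.lev_le_last hpc
      have h2 := B.base_lev_le hp
      have h4 := congrArg lev hBv
      simp only [lev_add, lev_step] at h1 h4
      omega
    · have hq' : q = p + c.step := by
        have : q + v = (p + c.step) + v := by rw [add_right_comm]; exact hqp
        exact add_right_cancel this
      subst hq'
      rw [← hqp, glueWord_right A a B hp, glueWord_right A a B hq]
      exact hB p c hp hq

/-- The perfect matchings of a glued snake graph. -/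
theorem mem_perfectMatchings_glue {Q : Set Edge} :
    Q ∈ perfectMatchings (Piece.snake (glue A a B)).graph ↔
      ∃ h k, IsWord A.tiles h ∧ IsWord B.tiles k ∧ (h A.last = a ∨ k B.base = a) ∧
        glueMatching A a B (wordEdges A.tiles h) (wordEdges B.tiles k) = Q := by
  rw [mem_perfectMatchings_snake]
  constructor
  · rintro ⟨w, hw, rfl⟩
    have e : Set.EqOn w
        (glueWord A a B w (fun p => w (p + (A.last + a.step - B.base)))) (glue A a B).tiles := by
      rw [SnakeGraph.glue_tiles]
      rintro p (hp | ⟨p, hp, rfl⟩)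
      · exact (glueWord_left A a B hp).symm
      · exact (glueWord_right A a B (k := fun p => w (p + (A.last + a.step - B.base))) hp).symm
    obtain ⟨h1, h2, h3⟩ := (isWord_glueWord_iff A a B).1 (hw.congr e)
    exact ⟨_, _, h1, h2, h3, by rw [glueMatching_wordEdges, wordEdges_congr e]⟩
  · rintro ⟨h, k, h1, h2, h3, rfl⟩
    exact ⟨_, (isWord_glueWord_iff A a B).2 ⟨h1, h2, h3⟩, (glueMatching_wordEdges A a B h k).symm⟩

theorem glueMatching_eq_iff {h k h' k' : Pt → Dir} :
    glueMatching A a B (wordEdges A.tiles h) (wordEdges B.tiles k) =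
      glueMatching A a B (wordEdges A.tiles h') (wordEdges B.tiles k') ↔
      Set.EqOn h h' A.tiles ∧ Set.EqOn k k' B.tiles := by
  constructor
  · intro H
    rw [glueMatching_wordEdges, glueMatching_wordEdges] at H
    have e := eqOn_of_wordEdges_eq (glue A a B).thin H
    rw [SnakeGraph.glue_tiles] at e
    refine ⟨fun p hp => ?_, fun p hp => ?_⟩
    · have := e (.inl hp)
      rwa [glueWord_left A a B hp, glueWord_left A a B hp] at this
    · have := e (.inr ⟨p, hp, rfl⟩)
      rwa [glueWord_right A a B hp, glueWord_right A a B hp] at this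
  · rintro ⟨e1, e2⟩
    rw [wordEdges_congr e1, wordEdges_congr e2]

end Glue

/-! ### Gluing of reflected snake graphs -/

/-- The reflection of a word. -/
def barWord (h : Pt → Dir) : Pt → Dir := fun p => (h (barTile p)).other

@[simp] theorem barWord_barWord (h : Pt → Dir) : barWord (barWord h) = h := by
  ext p; simp [barWord]

theorem SnakeGraph.barEdge_image (G : SnakeGraph) (h : Pt → Dir) :
    barEdge '' wordEdges G.tiles h = wordEdges G.bar.tiles (barWord h) := by
  rw [bar_tiles]; exact barEdge_image_wordEdges _ _

theorem SnakeGraph.isWord_bar {G : SnakeGraph} {h : Pt → Dir} :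
    IsWord G.bar.tiles (barWord h) ↔ IsWord G.tiles h := by
  rw [bar_tiles]
  constructor
  · intro H
    have := H.bar
    rw [Set.image_image] at this
    simpa [barWord] using this
  · exact IsWord.bar

theorem SnakeGraph.eqOn_bar {G : SnakeGraph} {h k : Pt → Dir} :
    Set.EqOn (barWord h) (barWord k) G.bar.tiles ↔ Set.EqOn h k G.tiles := by
  rw [bar_tiles]
  constructor
  · intro H p hp
    have := H ⟨p, hp, rfl⟩
    simp only [barWord, barTile_barTile] at this
    rw [← Dir.other_other (h p), this, Dir.other_other]
  · rintro H _ ⟨p, hp, rfl⟩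
    simp only [barWord, barTile_barTile]
    rw [H hp]

theorem SnakeGraph.barTile_bar_base (G : SnakeGraph) : barTile G.bar.base = G.last := by
  change barTile (barTile G.last) = _
  simp

theorem SnakeGraph.barTile_bar_last (G : SnakeGraph) : barTile G.bar.last = G.base := by
  rw [last, bar_d, bar_tile G G.one_le_d le_rfl]
  simp

/-- The reflection makes the last tile of `B` the first one and exchanges the values, so the
condition at the gluing edge becomes `k B.last ≠ a`. -/
theorem mem_perfectMatchings_glue_bar_right {A : SnakeGraph} {a : Dir} {B : SnakeGraph}
    {Q : Set Edge} : Q ∈ perfectMatchings (Piece.snake (glue A a B.bar)).graph ↔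
      ∃ h k, IsWord A.tiles h ∧ IsWord B.tiles k ∧ (h A.last = a ∨ k B.last ≠ a) ∧
        glueMatching A a B.bar (wordEdges A.tiles h) (barEdge '' wordEdges B.tiles k) = Q := by
  rw [mem_perfectMatchings_glue]
  have hb : ∀ k, barWord k B.bar.base = a ↔ k B.last ≠ a := fun k => by
    rw [barWord, B.barTile_bar_base, Dir.other_eq_iff]
  constructor
  · rintro ⟨h, k, h1, h2, h3, h4⟩
    refine ⟨h, barWord k, h1, ?_, ?_, ?_⟩
    · rw [← SnakeGraph.isWord_bar]; simpa using h2
    · rw [← hb]; simpa using h3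
    · rw [SnakeGraph.barEdge_image]; simpa using h4
  · rintro ⟨h, k, h1, h2, h3, h4⟩
    refine ⟨h, barWord k, h1, SnakeGraph.isWord_bar.2 h2, by rwa [hb], ?_⟩
    rwa [← SnakeGraph.barEdge_image]

theorem mem_perfectMatchings_glue_bar_left {A : SnakeGraph} {a : Dir} {B : SnakeGraph}
    {Q : Set Edge} : Q ∈ perfectMatchings (Piece.snake (glue A.bar a B)).graph ↔
      ∃ h k, IsWord A.tiles h ∧ IsWord B.tiles k ∧ (h A.base ≠ a ∨ k B.base = a) ∧
        glueMatching A.bar a B (barEdge '' wordEdges A.tiles h) (wordEdges B.tiles k) = Q := by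
  rw [mem_perfectMatchings_glue]
  have hb : ∀ k, barWord k A.bar.last = a ↔ k A.base ≠ a := fun k => by
    rw [barWord, A.barTile_bar_last, Dir.other_eq_iff]
  constructor
  · rintro ⟨h, k, h1, h2, h3, h4⟩
    refine ⟨barWord h, k, ?_, h2, ?_, ?_⟩
    · rw [← SnakeGraph.isWord_bar]; simpa using h1
    · rw [← hb]; simpa using h3
    · rw [SnakeGraph.barEdge_image]; simpa using h4
  · rintro ⟨h, k, h1, h2, h3, h4⟩
    refine ⟨barWord h, k, SnakeGraph.isWord_bar.2 h1, h2, by rwa [hb], ?_⟩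
    rwa [← SnakeGraph.barEdge_image]

theorem glueMatching_bar_right_eq_iff {A : SnakeGraph} {a : Dir} {B : SnakeGraph}
    {h k h' k' : Pt → Dir} :
    glueMatching A a B.bar (wordEdges A.tiles h) (barEdge '' wordEdges B.tiles k) =
      glueMatching A a B.bar (wordEdges A.tiles h') (barEdge '' wordEdges B.tiles k') ↔
      Set.EqOn h h' A.tiles ∧ Set.EqOn k k' B.tiles := by
  rw [SnakeGraph.barEdge_image, SnakeGraph.barEdge_image, glueMatching_eq_iff, SnakeGraph.eqOn_bar]

theorem glueMatching_bar_left_eq_iff {A : SnakeGraph} {a : Dir} {B : SnakeGraph}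
    {h k h' k' : Pt → Dir} :
    glueMatching A.bar a B (barEdge '' wordEdges A.tiles h) (wordEdges B.tiles k) =
      glueMatching A.bar a B (barEdge '' wordEdges A.tiles h') (wordEdges B.tiles k') ↔
      Set.EqOn h h' A.tiles ∧ Set.EqOn k k' B.tiles := by
  rw [SnakeGraph.barEdge_image, SnakeGraph.barEdge_image, glueMatching_eq_iff, SnakeGraph.eqOn_bar]

/-! ### Cutting and joining words -/

namespace SnakeGraph

variable (G : SnakeGraph)

/-- The only link between the two parts is the adjacency at `e_s`; once it is met they are
independent. -/
theorem exists_join {s : ℕ} (h1 : 1 ≤ s) (hs : s < G.d) {g g' : Pt → Dir}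
    (hg : IsWord (G.tilesOf 1 s) g) (hg' : IsWord (G.tilesOf (s + 1) G.d) g')
    (H : g (G.tile s) = G.dir s ∨ g' (G.tile (s + 1)) = G.dir s) :
    ∃ h, IsWord G.tiles h ∧ Set.EqOn h g (G.tilesOf 1 s) ∧
      Set.EqOn h g' (G.tilesOf (s + 1) G.d) := by
  have hl : ∀ k, 1 ≤ k → k ≤ G.d → (lev (G.tile k) ≤ lev (G.tile s) ↔ k ≤ s) := by
    intro k hk hk'
    rw [G.lev_tile hk hk', G.lev_tile h1 hs.le]
    omega
  have e1 : ∀ k, 1 ≤ k → k ≤ s → swapWord (lev (G.tile s)) g g' (G.tile k) = g (G.tile k) :=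
    fun k hk hks => swapWord_of_le ((hl k hk (by omega)).2 hks)
  have e2 : ∀ k, s < k → k ≤ G.d → swapWord (lev (G.tile s)) g g' (G.tile k) = g' (G.tile k) :=
    fun k hk hkd => swapWord_of_lt (not_le.1 (mt (hl k (by omega) hkd).1 (by omega)))
  refine ⟨swapWord (lev (G.tile s)) g g', ?_, ?_, ?_⟩
  · rintro _ a ⟨k, hk, hk', rfl⟩ hpa
    obtain ⟨hkd, rfl⟩ := (G.tile_add_step_mem hk hk').1 hpa
    rw [← G.tile_succ hk hkd]
    rcases lt_trichotomy k s with hks | rfl | hks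
    · rw [e1 k hk hks.le, e1 (k + 1) (by omega) (by omega)]
      have := hg (G.tile k) (G.dir k) ⟨k, hk, hks.le, rfl⟩
      rw [← G.tile_succ hk hkd] at this
      exact this ⟨k + 1, by omega, by omega, rfl⟩
    · rw [e1 k hk le_rfl, e2 (k + 1) (by omega) (by omega)]
      exact H
    · rw [e2 k hks hk', e2 (k + 1) (by omega) (by omega)]
      have := hg' (G.tile k) (G.dir k) ⟨k, hks, hk', rfl⟩
      rw [← G.tile_succ hk hkd] at this
      exact this ⟨k + 1, by omega, by omega, rfl⟩
  · rintro _ ⟨k, hk, hk', rfl⟩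
    exact e1 k hk hk'
  · rintro _ ⟨k, hk, hk', rfl⟩
    exact e2 k hk hk'

theorem tiles_eq_union {s : ℕ} (h1 : 1 ≤ s) (hs : s < G.d) :
    G.tiles = G.tilesOf 1 s ∪ G.tilesOf (s + 1) G.d := by
  ext p
  constructor
  · rintro ⟨k, hk, hk', rfl⟩
    rcases le_or_gt k s with h | h
    exacts [.inl ⟨k, hk, h, rfl⟩, .inr ⟨k, h, hk', rfl⟩]
  · rintro (⟨k, hk, hk', rfl⟩ | ⟨k, hk, hk', rfl⟩)
    exacts [⟨k, hk, by omega, rfl⟩, ⟨k, by omega, hk', rfl⟩]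

theorem eqOn_tiles_iff {s : ℕ} (h1 : 1 ≤ s) (hs : s < G.d) {h h' : Pt → Dir} :
    Set.EqOn h h' G.tiles ↔
      Set.EqOn h h' (G.tilesOf 1 s) ∧ Set.EqOn h h' (G.tilesOf (s + 1) G.d) := by
  rw [G.tiles_eq_union h1 hs, Set.eqOn_union]

/-- Restriction to an initial part of the tiles. -/
theorem wordEdges_inter_initial {s : ℕ} (h1 : 1 ≤ s) (hs : s < G.d) {h : Pt → Dir}
    (H : h (G.tile s) = G.dir s → h (G.tile (s + 1)) = G.dir s) :
    wordEdges G.tiles h ∩ G.edgesOf 1 s = wordEdges (G.tilesOf 1 s) h := by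
  rw [edgesOf_eq]
  -- Only `e_s` is critical: as a boundary edge of the part it needs the value `G.dir s` at `G_s`
  -- only, as an interior edge also at `G_{s+1}`.
  refine wordEdges_inter (G.tilesOf_mono le_rfl hs.le) ?_ ?_
  · rintro _ a ⟨k, hk, hk', rfl⟩ hpa hpa' hw
    obtain ⟨hkd, rfl⟩ := (G.tile_add_step_mem hk (by omega)).1 hpa
    rw [← G.tile_succ hk hkd, G.tile_mem_tilesOf le_rfl hs.le (by omega) (by omega)] at hpa'
    obtain rfl : k = s := by omega
    rw [← G.tile_succ hk hkd]
    exact H hw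
  · rintro _ a ⟨k, hk, hk', rfl⟩ hpa hpa' hw
    obtain ⟨hkd, rfl⟩ := (G.tile_sub_step_mem hk (by omega)).1 hpa
    rw [← G.tile_pred hkd (by omega), G.tile_mem_tilesOf le_rfl hs.le (by omega) (by omega)] at hpa'
    omega

/-- Restriction to a final part of the tiles. -/
theorem wordEdges_inter_final {s : ℕ} (h1 : 1 ≤ s) {h : Pt → Dir}
    (H : h (G.tile (s + 1)) = G.dir s → h (G.tile s) = G.dir s) :
    wordEdges G.tiles h ∩ G.edgesOf (s + 1) G.d = wordEdges (G.tilesOf (s + 1) G.d) h := by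
  rw [edgesOf_eq]
  refine wordEdges_inter (G.tilesOf_mono (by omega) le_rfl) ?_ ?_
  · rintro _ a ⟨k, hk, hk', rfl⟩ hpa hpa' hw
    obtain ⟨hkd, rfl⟩ := (G.tile_add_step_mem (by omega) (by omega)).1 hpa
    rw [← G.tile_succ (by omega) hkd,
      G.tile_mem_tilesOf (by omega) le_rfl (by omega) (by omega)] at hpa'
    omega
  · rintro _ a ⟨k, hk, hk', rfl⟩ hpa hpa' hw
    obtain ⟨hkd, rfl⟩ := (G.tile_sub_step_mem (by omega) (by omega)).1 hpa
    rw [← G.tile_pred hkd (by omega),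
      G.tile_mem_tilesOf (by omega) le_rfl (by omega) (by omega)] at hpa'
    obtain rfl : k = s + 1 := by omega
    rw [← G.tile_pred hkd (by omega)]
    exact H hw

theorem wordEdges_eq_iff {h h' : Pt → Dir} :
    wordEdges G.tiles h = wordEdges G.tiles h' ↔ Set.EqOn h h' G.tiles :=
  ⟨eqOn_of_wordEdges_eq G.thin, wordEdges_congr⟩

theorem sideIn_mem_wordEdges {h : Pt → Dir} {a : Dir} :
    sideIn (G.tile 1) a ∈ wordEdges G.tiles h ↔ h G.base = a := by
  rw [sideIn_eq_seg, seg_self_mem_wordEdges (G.tile_mem le_rfl G.one_le_d),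
    G.tile_sub_step_mem le_rfl G.one_le_d]
  simp

/-- The condition on `a` says that the edge is on the boundary, so that only one tile decides about
it. -/
theorem sideOut_mem_wordEdges {h : Pt → Dir} {a : Dir} {k : ℕ} (h1 : 1 ≤ k) (h2 : k ≤ G.d)
    (ha : k < G.d → a ≠ G.dir k) :
    sideOut (G.tile k) a ∈ wordEdges G.tiles h ↔ h (G.tile k) = a := by
  rw [sideOut_eq_seg, seg_add_step_mem_wordEdges (G.tile_mem h1 h2), G.tile_add_step_mem h1 h2]
  constructor
  · exact fun h => h.1
  · exact fun h => ⟨h, fun h' => absurd h'.2 (ha h'.1)⟩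

theorem inner_mem_wordEdges {h : Pt → Dir} {k : ℕ} (h1 : 1 ≤ k) (h2 : k < G.d) :
    G.inner k ∈ wordEdges G.tiles h ↔ h (G.tile k) = G.dir k ∧ h (G.tile (k + 1)) = G.dir k := by
  rw [inner, sideOut_eq_seg, seg_add_step_mem_wordEdges (G.tile_mem h1 h2.le),
    G.tile_add_step_mem h1 h2.le, ← G.tile_succ h1 h2]
  simp [h2]

end SnakeGraph

theorem mem_perfectMatchings_disjointUnion {G₁ G₂ : SnakeGraph} {P : Set (Sym2 (Pt ⊕ Pt))} :
    P ∈ perfectMatchings (disjointUnion (.snake G₁) (.snake G₂)) ↔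
      ∃ w : (Pt → Dir) × (Pt → Dir), (IsWord G₁.tiles w.1 ∧ IsWord G₂.tiles w.2) ∧
        unionPart (wordEdges G₁.tiles w.1) (wordEdges G₂.tiles w.2) = P := by
  rw [disjointUnion, mem_perfectMatchings_sum]
  constructor
  · rintro ⟨P₁, hP₁, P₂, hP₂, rfl⟩
    obtain ⟨h, hh, rfl⟩ := mem_perfectMatchings_snake.1 hP₁
    obtain ⟨k, hk, rfl⟩ := mem_perfectMatchings_snake.1 hP₂
    exact ⟨(h, k), ⟨hh, hk⟩, rfl⟩
  · rintro ⟨⟨h, k⟩, ⟨hh, hk⟩, rfl⟩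
    exact ⟨_, mem_perfectMatchings_snake.2 ⟨h, hh, rfl⟩, _,
      mem_perfectMatchings_snake.2 ⟨k, hk, rfl⟩, rfl⟩

theorem barEdge_image_inter_bar (P : Set Edge) (A : Piece) :
    barEdge '' P ∩ A.bar.edges = barEdge '' (P ∩ A.edges) := by
  rw [A.bar_edges, Set.image_inter barEdge_injective]

theorem image_barEdge_injective : Function.Injective (Set.image barEdge) :=
  Set.image_injective.2 barEdge_injective

/-! ### Grafting -/

/-- One of `G_s`, `G_{s+1}` has the value `δ`. In the first case (`K`) it is `G_{s+1}`: this is the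
starting value that forces the word down to `G_4`, and what is left is the gluing condition of
`G_3`. In the second case `G_s` has the value `δ`, which forces the word down to `G_5`, and the
negation of `K` leaves the gluing condition of `G_6`. -/
theorem exists_graft_equiv (G₁ G₂ : SnakeGraph) (s : ℕ) (f₁ : Edge → ℤˣ) (h1 : 1 ≤ s) (hs : s < G₁.d)
    (hf : IsSign G₁ f₁) :
    ∃ φ : perfectMatchings (disjointUnion (.snake G₁) (.snake G₂)) ≃ MatchingsOf (graft G₁ G₂ f₁ s),
      ∀ P, GraftRule G₁ G₂ f₁ s (fstPart P.1) (sndPart P.1)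
        (φ P).1 (fstPart (φ P).2.1) (sndPart (φ P).2.1) := by
  set δ := G₁.dir s with hδ
  set a := δ.other with ha
  obtain ⟨b, hb⟩ := hf.exists_signPat (-f₁ (G₁.inner s))
  -- Since the edge `e_s` does not have the sign that defines the pieces, the pattern has the value
  -- `δ` at `G_{s+1}` and the opposite pattern has it at `G_s`.
  have hne : f₁ (G₁.inner s) ≠ -f₁ (G₁.inner s) := units_eq_neg_iff.1 rfl
  have hbs : pat b (G₁.tile s) ≠ δ := mt (hb.inner h1 hs).2 hne
  have hbs1 : pat b (G₁.tile (s + 1)) = δ := not_not.1 (mt (hb.inner_succ h1 hs).2 hne)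
  have hbs' : pat (!b) (G₁.tile s) = δ := by rw [pat_not, Dir.other_eq_iff]; exact hbs
  have F := finalPiece_forced hb (n := s + 1) (by omega) (by omega)
  rw [hbs1] at F
  have I := initialPiece_forced hb (n := s - 1) (by omega)
  rw [Nat.sub_add_cancel h1, hbs'] at I
  have hA := G₁.sub_tiles le_rfl h1 hs.le
  have hB := G₁.sub_tiles (i := s + 1) (j := G₁.d) (by omega) (by omega) le_rfl
  have hAl := G₁.sub_last le_rfl h1 hs.le
  have hBb : (G₁.sub (s + 1) G₁.d).base = G₁.tile (s + 1) := rfl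
  let C : (Pt → Dir) × (Pt → Dir) → Prop := fun w => IsWord G₁.tiles w.1 ∧ IsWord G₂.tiles w.2
  let K : (Pt → Dir) × (Pt → Dir) → Prop := fun w =>
    w.1 (G₁.tile s) = a ∨ (w.1 (G₁.tile (s + 1)) = δ ∧ w.2 G₂.base = a)
  let q₀ : (Pt → Dir) × (Pt → Dir) → Set (Sym2 (Pt ⊕ Pt)) := fun w =>
    unionPart (glueMatching (G₁.sub 1 s) a G₂ (wordEdges G₁.tiles w.1 ∩ G₁.edgesOf 1 s)
        (wordEdges G₂.tiles w.2))
      (wordEdges G₁.tiles w.1 ∩ (finalPiece G₁ f₁ (-f₁ (G₁.inner s)) (s + 1)).edges)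
  let q₁ : (Pt → Dir) × (Pt → Dir) → Set (Sym2 (Pt ⊕ Pt)) := fun w =>
    unionPart (wordEdges G₁.tiles w.1 ∩ (initialPiece G₁ f₁ (-f₁ (G₁.inner s)) (s - 1)).edges)
      (glueMatching G₂.bar a (G₁.sub (s + 1) G₁.d) (barEdge '' wordEdges G₂.tiles w.2)
        (wordEdges G₁.tiles w.1 ∩ G₁.edgesOf (s + 1) G₁.d))
  have hcut : ∀ h, IsWord G₁.tiles h → h (G₁.tile s) = δ ∨ h (G₁.tile (s + 1)) = δ := by
    intro h hh
    have := hh (G₁.tile s) δ (G₁.tile_mem h1 hs.le)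
    rw [← G₁.tile_succ h1 hs] at this
    exact this (G₁.tile_mem (by omega) (by omega))
  have K1 : ∀ w, C w → K w → w.1 (G₁.tile (s + 1)) = δ := by
    rintro w hw (h | h)
    · exact (hcut _ hw.1).resolve_left (by rw [h]; exact δ.other_ne)
    · exact h.1
  have K2 : ∀ w, C w → K w → w.1 (G₁.tile s) = a ∨ w.2 G₂.base = a := by
    rintro w hw (h | h)
    exacts [.inl h, .inr h.2]
  have N1 : ∀ w, ¬ K w → w.1 (G₁.tile s) = δ := by
    intro w h
    have : w.1 (G₁.tile s) ≠ a := fun h' => h (.inl h')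
    rw [Dir.ne_iff.1 this, ha, Dir.other_other]
  have N2 : ∀ w, ¬ K w → w.2 G₂.base ≠ a ∨ w.1 (G₁.tile (s + 1)) = a := by
    intro w h
    by_cases h' : w.2 G₂.base = a
    · exact .inr (Dir.ne_iff.1 fun h'' => h (.inr ⟨h'', h'⟩))
    · exact .inl h'
  have r0 : ∀ w, C w → K w →
      wordEdges G₁.tiles w.1 ∩ G₁.edgesOf 1 s = wordEdges (G₁.sub 1 s).tiles w.1 := by
    intro w hw hk
    rw [hA]
    exact G₁.wordEdges_inter_initial h1 hs fun _ => K1 w hw hk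
  have r1 : ∀ w, ¬ K w → wordEdges G₁.tiles w.1 ∩ G₁.edgesOf (s + 1) G₁.d =
      wordEdges (G₁.sub (s + 1) G₁.d).tiles w.1 := by
    intro w hk
    rw [hB]
    exact G₁.wordEdges_inter_final h1 fun _ => N1 w hk
  have hpeq : ∀ w w' : (Pt → Dir) × (Pt → Dir), unionPart (wordEdges G₁.tiles w.1) (wordEdges G₂.tiles w.2) =
      unionPart (wordEdges G₁.tiles w'.1) (wordEdges G₂.tiles w'.2) ↔
      Set.EqOn w.1 w'.1 G₁.tiles ∧ Set.EqOn w.2 w'.2 G₂.tiles := by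
    intro w w'
    rw [unionPart_inj, G₁.wordEdges_eq_iff, G₂.wordEdges_eq_iff]
  refine Exists.elim (exists_equiv_matchingsOf (C := C) (K := K)
    (p := fun w => unionPart (wordEdges G₁.tiles w.1) (wordEdges G₂.tiles w.2)) (q₀ := q₀) (q₁ := q₁)
    (D := disjointUnion (.snake G₁) (.snake G₂))
    (A := disjointUnion (.snake (glue (G₁.sub 1 s) a G₂))
      (finalPiece G₁ f₁ (-f₁ (G₁.inner s)) (s + 1)))
    (B := disjointUnion (initialPiece G₁ f₁ (-f₁ (G₁.inner s)) (s - 1))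
      (.snake (glue G₂.bar a (G₁.sub (s + 1) G₁.d))))
    (fun P => mem_perfectMatchings_disjointUnion) ?_ ?_ ?_ ?_ ?_) fun φ hφ => ?_
  rotate_left 5
  · refine ⟨φ, fun P => ?_⟩
    obtain ⟨w, hw, hwP, H⟩ := hφ P
    rw [← hwP, fstPart_unionPart, sndPart_unionPart]
    -- Membership of `e_s` requires the value `δ` at `G_s` too; if it fails, `G_s` has the value `a`
    -- and the first alternative holds.
    have hK : (sideOut (G₁.tile s) a ∈ wordEdges G₁.tiles w.1 ∨
        (G₁.inner s ∈ wordEdges G₁.tiles w.1 ∧ sideIn (G₂.tile 1) a ∈ wordEdges G₂.tiles w.2)) ↔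
        K w := by
      rw [G₁.sideOut_mem_wordEdges h1 hs.le (fun _ => δ.other_ne), G₁.inner_mem_wordEdges h1 hs,
        G₂.sideIn_mem_wordEdges]
      have := hcut _ hw.1
      have h2 : w.1 (G₁.tile s) = δ ∨ w.1 (G₁.tile s) = a := by
        rw [ha, or_iff_not_imp_left]; exact Dir.ne_iff.1
      constructor
      · rintro (h | ⟨h, h'⟩)
        exacts [.inl h, .inr ⟨h.2, h'⟩]
      · rintro (h | ⟨h, h'⟩)
        · exact .inl h
        · rcases h2 with h2 | h2
          exacts [.inr ⟨⟨h2, h⟩, h'⟩, .inl h2]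
    rcases H with ⟨hk, e1, e2⟩ | ⟨hk, e1, e2⟩
    · refine .inl ⟨e1, hK.2 hk, ?_, ?_⟩
      · exact (congrArg fstPart e2).trans (fstPart_unionPart _ _)
      · exact (congrArg sndPart e2).trans (sndPart_unionPart _ _)
    · refine .inr ⟨e1, fun h => hk (hK.1 h), ?_, ?_⟩
      · exact (congrArg fstPart e2).trans (fstPart_unionPart _ _)
      · exact (congrArg sndPart e2).trans (sndPart_unionPart _ _)
  · intro Q
    rw [disjointUnion, mem_perfectMatchings_sum]
    constructor
    · rintro ⟨P₁, hP₁, P₂, hP₂, rfl⟩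
      obtain ⟨g, k, hg, hk, hgk, rfl⟩ := (mem_perfectMatchings_glue _ _ _).1 hP₁
      obtain ⟨g', hg', hr, hQ⟩ := F.surj P₂ hP₂
      rw [hA] at hg
      rw [hAl] at hgk
      -- The forced value at `G_{s+1}` meets the adjacency condition at `e_s`, so the words on the
      -- two parts can be chosen independently.
      obtain ⟨h, hh, e1, e2⟩ := G₁.exists_join h1 hs hg hg' (.inr hr)
      have hs' := e1 (show G₁.tile s ∈ _ from ⟨s, h1, le_rfl, rfl⟩)
      have hs1 := e2 (show G₁.tile (s + 1) ∈ _ from ⟨s + 1, le_rfl, hs, rfl⟩)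
      have hC : C (h, k) := ⟨hh, hk⟩
      have hKw : K (h, k) := by
        rcases hgk with h' | h'
        · exact .inl (hs'.trans h')
        · exact .inr ⟨hs1.trans hr, h'⟩
      refine ⟨(h, k), hC, hKw, ?_⟩
      simp only [q₀]
      rw [r0 _ hC hKw, hQ h hh e2, hA, wordEdges_congr e1]
    · rintro ⟨w, hC, hKw, rfl⟩
      refine ⟨_, ?_, _, F.mem w.1 hC.1 (K1 w hC hKw), rfl⟩
      rw [r0 _ hC hKw]
      refine (mem_perfectMatchings_glue _ _ _).2 ⟨w.1, w.2, ?_, hC.2, ?_, rfl⟩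
      · rw [hA]; exact hC.1.mono (G₁.tilesOf_mono le_rfl hs.le)
      · rw [hAl]; exact K2 w hC hKw
  · intro Q
    rw [disjointUnion, mem_perfectMatchings_sum]
    constructor
    · rintro ⟨P₁, hP₁, P₂, hP₂, rfl⟩
      obtain ⟨k, g', hk, hg', hgk, rfl⟩ := mem_perfectMatchings_glue_bar_left.1 hP₂
      obtain ⟨g, hg, hr, hQ⟩ := I.surj P₁ hP₁
      rw [hB] at hg'
      rw [hBb] at hgk
      obtain ⟨h, hh, e1, e2⟩ := G₁.exists_join h1 hs hg hg' (.inl hr)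
      have hs' := e1 (show G₁.tile s ∈ _ from ⟨s, h1, le_rfl, rfl⟩)
      have hs1 := e2 (show G₁.tile (s + 1) ∈ _ from ⟨s + 1, le_rfl, hs, rfl⟩)
      have hKw : ¬ K (h, k) := by
        rintro (h' | ⟨h', h''⟩)
        · simp only at h'
          rw [hs', hr] at h'
          exact δ.other_ne h'.symm
        · simp only at h' h''
          rw [hs1] at h'
          rcases hgk with h3 | h3
          · exact h3 h''
          · rw [h'] at h3; exact δ.other_ne h3.symm
      refine ⟨(h, k), ⟨hh, hk⟩, hKw, ?_⟩
      simp only [q₁]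
      rw [r1 _ hKw, hQ h hh e1, hB, wordEdges_congr e2]
    · rintro ⟨w, hC, hKw, rfl⟩
      refine ⟨_, I.mem w.1 hC.1 (N1 w hKw), _, ?_, rfl⟩
      rw [r1 _ hKw]
      refine mem_perfectMatchings_glue_bar_left.2 ⟨w.2, w.1, hC.2, ?_, N2 w hKw, rfl⟩
      rw [hB]; exact hC.1.mono (G₁.tilesOf_mono (by omega) le_rfl)
  · intro w w' hC hC' hK hK'
    simp only [q₀]
    rw [hpeq, unionPart_inj, r0 _ hC hK, r0 _ hC' hK', glueMatching_eq_iff,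
      F.inj _ _ hC.1 hC'.1 (K1 w hC hK) (K1 w' hC' hK'), hA, G₁.eqOn_tiles_iff h1 hs]
    tauto
  · intro w w' hC hC' hK hK'
    simp only [q₁]
    rw [hpeq, unionPart_inj, r1 _ hK, r1 _ hK', glueMatching_bar_left_eq_iff,
      I.inj _ _ hC.1 hC'.1 (N1 w hK) (N1 w' hK'), hB, G₁.eqOn_tiles_iff h1 hs]
    tauto
  · intro w w' _ _ e hk
    obtain ⟨e1, e2⟩ := (hpeq w w').1 e
    simp only [K] at hk ⊢
    rwa [← e1 (G₁.tile_mem h1 hs.le), ← e1 (G₁.tile_mem (by omega) (by omega)), ← e2 G₂.base_mem]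

/-- Here `K` is the gluing condition of `G_3` itself, and `G_4` has a single matching. If `K` fails,
both tiles at the gluing edge have the value `a.other`, which is the starting value of the forced
parts of both words. -/
theorem exists_graftLast_equiv (G₁ G₂ : SnakeGraph) (a : Dir) (f₁ f₂ : Edge → ℤˣ)
    (hf₁ : IsSign G₁ f₁) (hf₂ : IsSign G₂ f₂)
    (hf : f₂ (sideIn (G₂.tile 1) a) = f₁ (sideOut G₁.last a)) :
    ∃ φ : perfectMatchings (disjointUnion (.snake G₁) (.snake G₂)) ≃
        MatchingsOf (graftLast G₁ G₂ f₁ f₂ a),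
      ∀ P, GraftLastRule G₁ G₂ f₁ f₂ a (fstPart P.1) (sndPart P.1)
        (φ P).1 (fstPart (φ P).2.1) (sndPart (φ P).2.1) := by
  set c := f₁ (sideOut G₁.last a) with hc
  obtain ⟨b₁, hb₁⟩ := hf₁.exists_signPat c
  obtain ⟨b₂, hb₂⟩ := hf₂.exists_signPat c
  have h1 : pat (!b₁) G₁.last = a.other := by
    rw [pat_not]; exact congrArg Dir.other ((hb₁ G₁.d G₁.one_le_d le_rfl a).1.1 hc.symm)
  have h2 : pat b₂ (G₂.tile 1) = a.other :=
    Dir.ne_iff.1 ((hb₂ 1 le_rfl G₂.one_le_d a).2.1 hf)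
  have F := finalPiece_forced hb₂ le_rfl G₂.one_le_d
  rw [h2, SnakeGraph.tile_one] at F
  have I := initialPiece_forced hb₁ (n := G₁.d - 1) (by have := G₁.one_le_d; omega)
  rw [Nat.sub_add_cancel G₁.one_le_d] at I
  change ForcedPiece _ _ G₁.tiles G₁.last (pat (!b₁) G₁.last) at I
  change ForcedPiece _ _ G₂.tiles _ _ at F
  rw [h1] at I
  let C : (Pt → Dir) × (Pt → Dir) → Prop := fun w => IsWord G₁.tiles w.1 ∧ IsWord G₂.tiles w.2
  let K : (Pt → Dir) × (Pt → Dir) → Prop := fun w => w.1 G₁.last = a ∨ w.2 G₂.base = a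
  let q₀ : (Pt → Dir) × (Pt → Dir) → Set (Sym2 (Pt ⊕ Pt)) := fun w =>
    unionPart (glueMatching G₁ a G₂ (wordEdges G₁.tiles w.1) (wordEdges G₂.tiles w.2))
      {sideOut G₁.last a}
  let q₁ : (Pt → Dir) × (Pt → Dir) → Set (Sym2 (Pt ⊕ Pt)) := fun w =>
    unionPart (wordEdges G₁.tiles w.1 ∩ (initialPiece G₁ f₁ c (G₁.d - 1)).edges)
      (barEdge '' wordEdges G₂.tiles w.2 ∩ (finalPiece G₂ f₂ c 1).bar.edges)
  have N : ∀ w, ¬ K w ↔ w.1 G₁.last = a.other ∧ w.2 G₂.base = a.other := by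
    intro w
    simp only [K]
    rw [not_or, ← Ne, ← Ne, Dir.ne_iff, Dir.ne_iff]
  have hpeq : ∀ w w' : (Pt → Dir) × (Pt → Dir), unionPart (wordEdges G₁.tiles w.1) (wordEdges G₂.tiles w.2) =
      unionPart (wordEdges G₁.tiles w'.1) (wordEdges G₂.tiles w'.2) ↔
      Set.EqOn w.1 w'.1 G₁.tiles ∧ Set.EqOn w.2 w'.2 G₂.tiles := by
    intro w w'
    rw [unionPart_inj, G₁.wordEdges_eq_iff, G₂.wordEdges_eq_iff]
  refine Exists.elim (exists_equiv_matchingsOf (C := C) (K := K)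
    (p := fun w => unionPart (wordEdges G₁.tiles w.1) (wordEdges G₂.tiles w.2)) (q₀ := q₀) (q₁ := q₁)
    (D := disjointUnion (.snake G₁) (.snake G₂))
    (A := disjointUnion (.snake (glue G₁ a G₂)) (.single (sideOut G₁.last a)))
    (B := disjointUnion (initialPiece G₁ f₁ c (G₁.d - 1)) (finalPiece G₂ f₂ c 1).bar)
    (fun P => mem_perfectMatchings_disjointUnion) ?_ ?_ ?_ ?_ ?_) fun φ hφ => ?_
  rotate_left 5
  · refine ⟨φ, fun P => ?_⟩
    obtain ⟨w, hw, hwP, H⟩ := hφ P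
    rw [← hwP, fstPart_unionPart, sndPart_unionPart]
    have hK : (sideOut G₁.last a ∈ wordEdges G₁.tiles w.1 ∨
        sideIn (G₂.tile 1) a ∈ wordEdges G₂.tiles w.2) ↔ K w := by
      rw [SnakeGraph.last, G₁.sideOut_mem_wordEdges G₁.one_le_d le_rfl (fun h => absurd h (by simp)),
        G₂.sideIn_mem_wordEdges]
      rfl
    rcases H with ⟨hk, e1, e2⟩ | ⟨hk, e1, e2⟩
    · refine .inl ⟨e1, hK.2 hk, ?_, ?_⟩
      · exact (congrArg fstPart e2).trans (fstPart_unionPart _ _)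
      · exact (congrArg sndPart e2).trans (sndPart_unionPart _ _)
    · refine .inr ⟨e1, fun h => hk (hK.1 h), ?_, ?_⟩
      · exact (congrArg fstPart e2).trans (fstPart_unionPart _ _)
      · exact (congrArg sndPart e2).trans (sndPart_unionPart _ _)
  · intro Q
    rw [disjointUnion, mem_perfectMatchings_sum, sideOut_eq_seg]
    constructor
    · rintro ⟨P₁, hP₁, P₂, hP₂, rfl⟩
      obtain ⟨g, k, hg, hk, hgk, rfl⟩ := (mem_perfectMatchings_glue _ _ _).1 hP₁
      obtain rfl := mem_perfectMatchings_single.1 hP₂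
      exact ⟨(g, k), ⟨hg, hk⟩, hgk, by simp only [q₀]; rw [sideOut_eq_seg]⟩
    · rintro ⟨w, hC, hKw, rfl⟩
      refine ⟨_, (mem_perfectMatchings_glue _ _ _).2 ⟨w.1, w.2, hC.1, hC.2, hKw, rfl⟩, _,
        mem_perfectMatchings_single.2 rfl, by simp only [q₀]; rw [sideOut_eq_seg]⟩
  · intro Q
    rw [disjointUnion, mem_perfectMatchings_sum]
    constructor
    · rintro ⟨P₁, hP₁, P₂, hP₂, rfl⟩
      obtain ⟨P₃, hP₃, rfl⟩ := (mem_perfectMatchings_bar F.not_isDiag).1 hP₂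
      obtain ⟨g, hg, hr, hQ⟩ := I.surj P₁ hP₁
      obtain ⟨g', hg', hr', hQ'⟩ := F.surj P₃ hP₃
      refine ⟨(g, g'), ⟨hg, hg'⟩, (N _).2 ⟨hr, hr'⟩, ?_⟩
      simp only [q₁]
      rw [barEdge_image_inter_bar, hQ g hg (fun _ _ => rfl), hQ' g' hg' (fun _ _ => rfl)]
    · rintro ⟨w, hC, hKw, rfl⟩
      obtain ⟨n1, n2⟩ := (N w).1 hKw
      refine ⟨_, I.mem w.1 hC.1 n1, _, ?_, rfl⟩
      rw [barEdge_image_inter_bar]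
      exact (mem_perfectMatchings_bar F.not_isDiag).2 ⟨_, F.mem w.2 hC.2 n2, rfl⟩
  · intro w w' hC hC' hK hK'
    simp only [q₀]
    rw [hpeq, unionPart_inj, glueMatching_eq_iff]
    simp
  · intro w w' hC hC' hK hK'
    obtain ⟨n1, n2⟩ := (N w).1 hK
    obtain ⟨n1', n2'⟩ := (N w').1 hK'
    simp only [q₁]
    rw [hpeq, unionPart_inj, barEdge_image_inter_bar, barEdge_image_inter_bar,
      image_barEdge_injective.eq_iff, I.inj _ _ hC.1 hC'.1 n1 n1', F.inj _ _ hC.2 hC'.2 n2 n2']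
  · intro w w' _ _ e hk
    obtain ⟨e1, e2⟩ := (hpeq w w').1 e
    simp only [K] at hk ⊢
    rwa [← e1 G₁.last_mem, ← e2 G₂.base_mem]

/-! ### Overlaps and crossings of snake graphs -/

namespace SnakeGraph

variable (G : SnakeGraph)

theorem lev_tile_lt_iff {j k : ℕ} (h1 : 1 ≤ j) (h2 : j ≤ G.d) (h3 : 1 ≤ k) (h4 : k ≤ G.d) :
    lev (G.tile j) < lev (G.tile k) ↔ j < k := by
  rw [G.lev_tile h1 h2, G.lev_tile h3 h4]
  omega

theorem tiles_lt_eq {j : ℕ} (h1 : 1 ≤ j) (h2 : j ≤ G.d) :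
    {p ∈ G.tiles | lev p < lev (G.tile j)} = G.tilesOf 1 (j - 1) := by
  ext p
  constructor
  · rintro ⟨⟨k, h3, h4, rfl⟩, h⟩
    have := (G.lev_tile_lt_iff h3 h4 h1 h2).1 h
    exact ⟨k, h3, by omega, rfl⟩
  · rintro ⟨k, h3, h4, rfl⟩
    exact ⟨⟨k, h3, by omega, rfl⟩, (G.lev_tile_lt_iff h3 (by omega) h1 h2).2 (by omega)⟩

theorem tiles_gt_eq {j : ℕ} (h1 : 1 ≤ j) (h2 : j ≤ G.d) :
    {p ∈ G.tiles | lev (G.tile j) < lev p} = G.tilesOf (j + 1) G.d := by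
  ext p
  constructor
  · rintro ⟨⟨k, h3, h4, rfl⟩, h⟩
    exact ⟨k, (G.lev_tile_lt_iff h1 h2 h3 h4).1 h, h4, rfl⟩
  · rintro ⟨k, h3, h4, rfl⟩
    exact ⟨⟨k, by omega, h4, rfl⟩, (G.lev_tile_lt_iff h1 h2 (by omega) h4).2 h3⟩

end SnakeGraph

/-- One neighbour at each end is enough: by maximality of the overlap a neighbour in the other tile
set lies in the other direction, where the opposite condition is automatic. -/
theorem Overlapping.crossPattern {T₁ T₂ : Set Pt} {r₀ r₁ : Pt} (O : Overlapping T₁ T₂ r₀ r₁) {b : Bool}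
    (hl : (∃ a, r₀ - Dir.step a ∈ T₁ ∧ pat b r₀ = a) ∨ ∃ a, r₀ - Dir.step a ∈ T₂ ∧ pat b r₀ ≠ a)
    (hr : (∃ a, r₁ + Dir.step a ∈ T₁ ∧ pat b r₁ = a) ∨ ∃ a, r₁ + Dir.step a ∈ T₂ ∧ pat b r₁ ≠ a) :
    CrossPattern T₁ T₂ r₀ r₁ b where
  left₁ a ha := by
    rcases hl with ⟨c, hc, h⟩ | ⟨c, hc, h⟩
    · rw [h, O.thin₁.sub_step_unique hc ha]
    · exact Dir.eq_of_ne_of_ne h fun e => O.left a ha (e ▸ hc)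
  left₂ a ha := by
    rcases hl with ⟨c, hc, h⟩ | ⟨c, hc, h⟩
    · exact fun e => O.left c hc (h.symm.trans e ▸ ha)
    · rwa [← O.thin₂.sub_step_unique hc ha]
  right₁ a ha := by
    rcases hr with ⟨c, hc, h⟩ | ⟨c, hc, h⟩
    · rw [h, O.thin₁.step_unique hc ha]
    · exact Dir.eq_of_ne_of_ne h fun e => O.right a ha (e ▸ hc)
  right₂ a ha := by
    rcases hr with ⟨c, hc, h⟩ | ⟨c, hc, h⟩
    · exact fun e => O.right c hc (h.symm.trans e ▸ ha)
    · rwa [← O.thin₂.step_unique hc ha]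
  left := by
    rcases hl with ⟨c, hc, -⟩ | ⟨c, hc, -⟩
    exacts [⟨c, .inl hc⟩, ⟨c, .inr hc⟩]
  right := by
    rcases hr with ⟨c, hc, -⟩ | ⟨c, hc, -⟩
    exacts [⟨c, .inl hc⟩, ⟨c, .inr hc⟩]

section Overlap

variable {G H : SnakeGraph} {s t s' t' : ℕ}

theorem IsCommon.tile_eq (hC : IsCommon G H s t s' t') {j j' : ℕ} (h1 : s ≤ j) (h2 : j ≤ t)
    (h : j + s' = j' + s) : G.tile j = H.tile j' := by
  obtain ⟨-, -, -, -, -, -, h7, h8⟩ := hC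
  have := h8 (j - s) (by omega)
  rwa [show s + (j - s) = j by omega, show s' + (j - s) = j' by omega] at this

theorem IsCommon.extend (hC : IsCommon G H s t s' t') {a b a' b' : ℕ} (ha : 1 ≤ a) (has : a ≤ s)
    (hb : t ≤ b) (hbd : b ≤ G.d) (ha' : 1 ≤ a') (hbd' : b' ≤ H.d) (e : s - a = s' - a')
    (has' : a' ≤ s') (hb' : t' ≤ b') (e' : b - t = b' - t')
    (hl : ∀ j j', a ≤ j → j < s → j + s' = j' + s → G.tile j = H.tile j')
    (hr : ∀ j j', t < j → j ≤ b → j + s' = j' + s → G.tile j = H.tile j') :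
    IsCommon G H a b a' b' := by
  obtain ⟨h1, h2, h3, h4, h5, h6, h7, h8⟩ := id hC
  refine ⟨ha, by omega, hbd, ha', by omega, hbd', by omega, fun i hi => ?_⟩
  rcases lt_or_ge (a + i) s with hlt | hge
  · exact hl _ _ (by omega) hlt (by omega)
  · rcases le_or_gt (a + i) t with hle | hgt
    · exact hC.tile_eq hge hle (by omega)
    · exact hr _ _ hgt (by omega) (by omega)

/-- A common neighbour at either end would give a larger common snake graph, against maximality. -/
theorem IsOverlap.overlapping (hO : IsOverlap G H s t s' t') :
    Overlapping G.tiles H.tiles (G.tile s) (G.tile t) := by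
  obtain ⟨hC, hmax⟩ := hO
  obtain ⟨h1, h2, h3, h4, h5, h6, h7, h8⟩ := id hC
  have es : G.tile s = H.tile s' := hC.tile_eq le_rfl h2 (by omega)
  have et : G.tile t = H.tile t' := hC.tile_eq h2 le_rfl (by omega)
  refine ⟨G.thin, H.thin, G.tile_mem h1 (by omega), G.tile_mem (by omega) h3, ?_, ?_, ?_, ?_, ?_⟩
  · rw [G.lev_tile h1 (by omega), G.lev_tile (by omega) h3]
    omega
  · intro p hp hp'
    constructor
    · rintro ⟨k, hk, hkd, rfl⟩
      rw [← not_lt, G.lev_tile_lt_iff hk hkd h1 (by omega)] at hp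
      rw [← not_lt, G.lev_tile_lt_iff (by omega) h3 hk hkd] at hp'
      rw [hC.tile_eq (j' := s' + (k - s)) (by omega) (by omega) (by omega)]
      exact H.tile_mem (by omega) (by omega)
    · rintro ⟨k, hk, hkd, rfl⟩
      rw [es, ← not_lt, H.lev_tile_lt_iff hk hkd h4 (by omega)] at hp
      rw [et, ← not_lt, H.lev_tile_lt_iff (by omega) h6 hk hkd] at hp'
      rw [← hC.tile_eq (j := s + (k - s')) (by omega) (by omega) (by omega)]
      exact G.tile_mem (by omega) (by omega)
  · intro a ha ha'
    obtain ⟨g1, g2⟩ := (G.tile_sub_step_mem h1 (by omega)).1 ha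
    rw [es] at ha'
    obtain ⟨g3, g4⟩ := (H.tile_sub_step_mem h4 (by omega)).1 ha'
    have := hmax (s - 1) t (s' - 1) t' (hC.extend (by omega) (by omega) le_rfl h3 (by omega) h6
      (by omega) (by omega) le_rfl (by omega) ?_ (by omega)) (by omega) le_rfl (by omega) le_rfl
    · omega
    · intro j j' hj hj' e
      obtain rfl : j = s - 1 := by omega
      obtain rfl : j' = s' - 1 := by omega
      rw [G.tile_pred g1 (by omega), H.tile_pred g3 (by omega), ← g2, ← g4, es]
  · intro a ha ha'
    obtain ⟨g1, g2⟩ := (G.tile_add_step_mem (by omega) h3).1 ha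
    rw [et] at ha'
    obtain ⟨g3, g4⟩ := (H.tile_add_step_mem (by omega) h6).1 ha'
    have := hmax s (t + 1) s' (t' + 1) (hC.extend h1 le_rfl (by omega) g1 h4 g3
      (by omega) le_rfl (by omega) (by omega) (by omega) ?_) le_rfl (by omega) le_rfl (by omega)
    · omega
    · intro j j' hj hj' e
      obtain rfl : j = t + 1 := by omega
      obtain rfl : j' = t' + 1 := by omega
      rw [G.tile_succ (by omega) g1, H.tile_succ (by omega) g3, ← g2, ← g4, et]
  · rintro _ ⟨k, hk, hkd, rfl⟩ hp hp'
    rw [G.lev_tile_lt_iff hk hkd (by omega) h3] at hp'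
    exact ⟨G.dir k, (G.tile_add_step_mem hk hkd).2 ⟨by omega, rfl⟩⟩

/-- If the two snake graphs cross, then the sign functions give rise to a pattern. -/
theorem Crosses.exists_crossPattern {f₁ f₂ : Edge → ℤˣ} (hX : Crosses G H f₁ f₂ s t s' t')
    (hO : IsOverlap G H s t s' t') (hf₁ : IsSign G f₁) (hf₂ : IsSign H f₂)
    (hf : ∀ e ∈ G.edgesOf s t, f₁ e = f₂ e) :
    ∃ b, CrossPattern G.tiles H.tiles (G.tile s) (G.tile t) b := by
  have O := hO.overlapping
  obtain ⟨hC, -⟩ := hO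
  obtain ⟨h1, h2, h3, h4, h5, h6, h7, h8⟩ := id hC
  have es : G.tile s = H.tile s' := hC.tile_eq le_rfl h2 (by omega)
  have et : G.tile t = H.tile t' := hC.tile_eq h2 le_rfl (by omega)
  -- Every kind of crossing provides a sign `c` for which the edge before the overlap and the edge
  -- after it fit the pattern of the edges of sign `c`. In `G` such an edge must not have the sign
  -- `c` on the left and must have it on the right; in `H` it is the other way round.
  have key : ∀ c : ℤˣ,
      (1 < s ∧ f₁ (G.inner (s - 1)) ≠ c) ∨ (1 < s' ∧ f₂ (H.inner (s' - 1)) = c) →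
      (t < G.d ∧ f₁ (G.inner t) = c) ∨ (t' < H.d ∧ f₂ (H.inner t') ≠ c) →
      ∃ b, CrossPattern G.tiles H.tiles (G.tile s) (G.tile t) b := by
    intro c hl hr
    obtain ⟨b, hb⟩ := hf₁.exists_signPat c
    obtain ⟨b', hb'⟩ := hf₂.exists_signPat c
    -- The sign functions agree on the overlap, and one edge of `G_s` suffices to identify the two
    -- patterns.
    obtain rfl : b = b' := by
      refine eq_of_pat_eq (p := G.tile s) ?_
      have hside := (hb s h1 (by omega) (pat b' (G.tile s))).1
      rw [← hside, hf _ ⟨s, le_rfl, h2, ?_⟩, es, (hb' s' h4 (by omega) _).1]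
      rw [sideOut_eq_seg, seg_mem_tileEdges]
      exact .inr (by simp)
    refine ⟨b, O.crossPattern ?_ ?_⟩
    · rcases hl with ⟨g, g'⟩ | ⟨g, g'⟩
      · refine .inl ⟨_, (G.tile_sub_step_mem h1 (by omega)).2 ⟨g, rfl⟩, ?_⟩
        have := not_not.1 (mt (hb.inner_succ (k := s - 1) (by omega) (by omega)).2 g')
        rwa [show s - 1 + 1 = s by omega] at this
      · refine .inr ⟨_, by rw [es]; exact (H.tile_sub_step_mem h4 (by omega)).2 ⟨g, rfl⟩, ?_⟩
        have := (hb'.inner_succ (k := s' - 1) (by omega) (by omega)).1 g'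
        rwa [show s' - 1 + 1 = s' by omega, ← es] at this
    · rcases hr with ⟨g, g'⟩ | ⟨g, g'⟩
      · exact .inl ⟨_, (G.tile_add_step_mem (by omega) h3).2 ⟨g, rfl⟩,
          (hb.inner (by omega) g).1 g'⟩
      · refine .inr ⟨_, by rw [et]; exact (H.tile_add_step_mem (by omega) h6).2 ⟨g, rfl⟩, ?_⟩
        rw [et]
        exact mt (hb'.inner (by omega) g).2 g'
  have hneg : ∀ x : ℤˣ, -x ≠ x := fun x h => units_eq_neg_iff.1 h rfl
  rcases hX with ⟨g1, g2, g3⟩ | ⟨g1, g2, g3⟩ | ⟨-, g2, g3, -, g5⟩ | ⟨g1, -, -, g4, g5⟩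
  · exact key (f₁ (G.inner t)) (.inl ⟨g1, by rw [g3]; exact hneg _⟩) (.inl ⟨g2, rfl⟩)
  · exact key (f₂ (H.inner (s' - 1))) (.inr ⟨g1, rfl⟩)
      (.inr ⟨g2, by rw [g3]; exact (hneg _).symm⟩)
  · exact key (f₁ (G.inner t)) (.inr ⟨g3, g5.symm⟩) (.inl ⟨g2, rfl⟩)
  · exact key (-f₁ (G.inner (s - 1))) (.inl ⟨g1, (hneg _).symm⟩)
      (.inr ⟨g4, by rw [← g5]; exact (hneg _).symm⟩)

/-! ### Switching matchings of snake graphs -/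

theorem switchGraph_tiles_eq_swapTiles (h1 : 1 ≤ t) (h2 : t ≤ G.d) (h3 : 1 ≤ t') (h4 : t' ≤ H.d)
    (h : G.tile t = H.tile t') :
    (switchGraph G H t t').tiles = swapTiles (lev (G.tile t)) G.tiles H.tiles := by
  rw [SnakeGraph.switchGraph_tiles h1 h2 h3 h4 h, ← H.tiles_gt_eq h3 h4]
  ext p
  simp only [swapTiles, Set.mem_union, Set.mem_ofPred_eq, ← h]
  refine or_congr ?_ and_comm
  constructor
  · rintro ⟨k, g1, g2, rfl⟩
    exact ⟨not_lt.1 (mt (G.lev_tile_lt_iff h1 h2 g1 (by omega)).1 (by omega)),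
      G.tile_mem g1 (by omega)⟩
  · rintro ⟨g, k, g1, g2, rfl⟩
    have := mt (G.lev_tile_lt_iff h1 h2 g1 g2).2 (by omega)
    exact ⟨k, g1, by omega, rfl⟩

theorem IsOverlap.switchGraph_tiles (hO : IsOverlap G H s t s' t') :
    (switchGraph G H t t').tiles = swapTiles (lev (G.tile t)) G.tiles H.tiles ∧
    (switchGraph H G t' t).tiles = swapTiles (lev (G.tile t)) H.tiles G.tiles := by
  obtain ⟨hC, -⟩ := hO
  obtain ⟨h1, h2, h3, h4, h5, h6, h7, -⟩ := id hC
  have et : G.tile t = H.tile t' := hC.tile_eq h2 le_rfl (by omega)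
  refine ⟨switchGraph_tiles_eq_swapTiles (by omega) h3 (by omega) h6 et, ?_⟩
  rw [switchGraph_tiles_eq_swapTiles (by omega) h6 (by omega) h3 et.symm, et]

theorem switchAt_iff {j j' : ℕ} (h1 : 1 ≤ j) (h2 : j ≤ G.d) (h3 : 1 ≤ j') (h4 : j' ≤ H.d)
    (h : G.tile j = H.tile j') {P₁ P₂ Q₃ Q₄ : Set Edge} :
    SwitchAt G H t t' P₁ P₂ j j' Q₃ Q₄ ↔
      Q₃ ∈ perfectMatchings (Piece.snake (switchGraph G H t t')).graph ∧
      Q₄ ∈ perfectMatchings (Piece.snake (switchGraph H G t' t)).graph ∧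
      SwitchRel G.tiles H.tiles P₁ P₂ (G.tile j) Q₃ Q₄ := by
  unfold SwitchAt SwitchRel
  rw [SnakeGraph.edgesOf_eq, SnakeGraph.edgesOf_eq, SnakeGraph.edgesOf_eq, SnakeGraph.edgesOf_eq,
    ← G.tiles_lt_eq h1 h2, ← G.tiles_gt_eq h1 h2, ← H.tiles_lt_eq h3 h4, ← H.tiles_gt_eq h3 h4, ← h]

/-- Switching next to a tile of the overlap is switching at this tile. -/
theorem IsOverlap.switchAt (hO : IsOverlap G H s t s' t') {h k : Pt → Dir} (hh : IsWord G.tiles h)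
    (hk : IsWord H.tiles k) {i : ℕ} (hi : i ≤ t - s) {c : ℤ}
    (hc : c = lev (G.tile (s + i)) ∨ c = lev (G.tile (s + i)) - 1)
    (hs : Switchable G.tiles H.tiles h k c) :
    SwitchAt G H t t' (wordEdges G.tiles h) (wordEdges H.tiles k) (s + i) (s' + i)
      (wordEdges (swapTiles (lev (G.tile t)) G.tiles H.tiles) (swapWord c h k))
      (wordEdges (swapTiles (lev (G.tile t)) H.tiles G.tiles) (swapWord c k h)) := by
  have O := hO.overlapping
  obtain ⟨e1, e2⟩ := hO.switchGraph_tiles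
  obtain ⟨h1, h2, h3, h4, h5, h6, h7, h8⟩ := hO.1
  have g0 : lev (G.tile s) ≤ lev (G.tile (s + i)) := by
    rw [← not_lt, G.lev_tile_lt_iff (by omega) (by omega) (by omega) (by omega)]; omega
  have g1 : lev (G.tile (s + i)) ≤ lev (G.tile t) := by
    rw [← not_lt, G.lev_tile_lt_iff (by omega) (by omega) (by omega) (by omega)]; omega
  have t1 := O.swapTiles_eq (c := c) (c' := lev (G.tile t)) (by omega) (by omega)
    (by have := O.le; omega) le_rfl
  have t2 := O.symm.swapTiles_eq (c := c) (c' := lev (G.tile t)) (by omega) (by omega)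
    (by have := O.le; omega) le_rfl
  refine (switchAt_iff (by omega) (by omega) (by omega) (by omega) (h8 i hi)).2 ⟨?_, ?_, ?_⟩
  · exact mem_perfectMatchings_snake.2 ⟨_, by rw [e1, ← t1]; exact hs.1, by rw [e1]⟩
  · exact mem_perfectMatchings_snake.2 ⟨_, by rw [e2, ← t2]; exact hs.2, by rw [e2]⟩
  · exact O.switchRel hh hk (G.tile_mem (by omega) (by omega)) g0 g1 hc hs

theorem IsOverlap.switchable (hO : IsOverlap G H s t s' t') {h k : Pt → Dir} (hh : IsWord G.tiles h)
    (hk : IsWord H.tiles k) {i : ℕ} (hi : i ≤ t - s)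
    (hs : CanSwitch G H s t s' t' (wordEdges G.tiles h) (wordEdges H.tiles k) i) :
    Switchable G.tiles H.tiles h k (lev (G.tile s) + i - 1) ∨
      Switchable G.tiles H.tiles h k (lev (G.tile s) + i) := by
  have O := hO.overlapping
  obtain ⟨e1, e2⟩ := hO.switchGraph_tiles
  obtain ⟨h1, h2, h3, h4, h5, h6, h7, h8⟩ := hO.1
  have g0 : lev (G.tile s) ≤ lev (G.tile (s + i)) := by
    rw [← not_lt, G.lev_tile_lt_iff (by omega) (by omega) (by omega) (by omega)]; omega
  have g1 : lev (G.tile (s + i)) ≤ lev (G.tile t) := by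
    rw [← not_lt, G.lev_tile_lt_iff (by omega) (by omega) (by omega) (by omega)]; omega
  obtain ⟨Q₃, Q₄, hQ⟩ := hs
  obtain ⟨m3, m4, hrel⟩ :=
    (switchAt_iff (by omega) (by omega) (by omega) (by omega) (h8 i hi)).1 hQ
  obtain ⟨q, hq, rfl⟩ := mem_perfectMatchings_snake.1 m3
  obtain ⟨q', hq', rfl⟩ := mem_perfectMatchings_snake.1 m4
  rw [e1] at hq hrel
  rw [e2] at hq' hrel
  have := O.switchable_of_switchRel hh hk hq hq' (G.tile_mem (by omega) (by omega)) g0 g1 hrel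
  have hl : lev (G.tile (s + i)) = lev (G.tile s) + i := by
    rw [G.lev_tile (by omega) (by omega), G.lev_tile (by omega) (by omega)]
    push_cast
    ring
  rwa [hl] at this

theorem IsOverlap.not_canSwitch (hO : IsOverlap G H s t s' t') {h k : Pt → Dir}
    (hh : IsWord G.tiles h) (hk : IsWord H.tiles k)
    (hs : ¬ CanSwap G.tiles H.tiles (G.tile s) (G.tile t) h k) {i : ℕ} (hi : i ≤ t - s) :
    ¬ CanSwitch G H s t s' t' (wordEdges G.tiles h) (wordEdges H.tiles k) i := by
  intro hsw
  obtain ⟨h1, h2, h3, -⟩ := hO.1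
  have hl : lev (G.tile t) = lev (G.tile s) + (t - s : ℕ) := by
    rw [G.lev_tile (by omega) (by omega), G.lev_tile (by omega) (by omega)]
    omega
  rcases hO.switchable hh hk hi hsw with h | h
  exacts [hs ⟨_, by omega, by omega, h⟩, hs ⟨_, by omega, by omega, h⟩]

/-- A switch at an earlier tile would be a cut before or after that tile, hence a cut before `c`. -/
theorem IsOverlap.exists_first_switch (hO : IsOverlap G H s t s' t') {h k : Pt → Dir}
    (hh : IsWord G.tiles h) (hk : IsWord H.tiles k) {c : ℤ}
    (hc : IsFirstCut G.tiles H.tiles (G.tile s) (G.tile t) h k c) :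
    ∃ i ≤ t - s, SwitchAt G H t t' (wordEdges G.tiles h) (wordEdges H.tiles k) (s + i) (s' + i)
        (wordEdges (swapTiles (lev (G.tile t)) G.tiles H.tiles) (swapWord c h k))
        (wordEdges (swapTiles (lev (G.tile t)) H.tiles G.tiles) (swapWord c k h)) ∧
      ∀ l < i, ¬ CanSwitch G H s t s' t' (wordEdges G.tiles h) (wordEdges H.tiles k) l := by
  obtain ⟨h1, h2, h3, -⟩ := hO.1
  obtain ⟨hc0, hc1, hs, hmin⟩ := hc
  have hl : ∀ i ≤ t - s, lev (G.tile (s + i)) = lev (G.tile s) + i := by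
    intro i hi
    rw [G.lev_tile (by omega) (by omega), G.lev_tile (by omega) (by omega)]
    push_cast
    ring
  have hlt := hl (t - s) le_rfl
  rw [show s + (t - s) = t by omega] at hlt
  -- The tile is the one on the antidiagonal `c`. For the cut `lev (G.tile s) - 1` before the
  -- overlap the truncation by `toNat` gives the first tile, as it should.
  refine ⟨(c - lev (G.tile s)).toNat, by omega, hO.switchAt hh hk (by omega) ?_ hs, ?_⟩
  · rw [hl _ (by omega)]
    omega
  · intro l hlc hsw
    rcases hO.switchable hh hk (by omega) hsw with h | h
    exacts [hmin _ (by omega) (by omega) h, hmin _ (by omega) (by omega) h]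

end Overlap

/-! ### The ends of a pair of snake graphs that cross -/

/-- A pair of words with opposite values, those of the alternating patterns, at the tile `r`. -/
structure IsOppositeAt (T₁ T₂ : Set Pt) (r : Pt) (b : Bool) (h k : Pt → Dir) : Prop where
  left : IsWord T₁ h
  right : IsWord T₂ k
  left_eq : h r = pat b r
  right_eq : k r = pat (!b) r

/-- The map `R` identifies the parts on `S₁`, `S₂` of the pairs of words on `T₁`, `T₂` that satisfy the
condition `N` with the perfect matchings of the piece `A`. -/
structure EndModel (A : Piece) (R : Set Edge → Set Edge → Set Edge) (T₁ T₂ S₁ S₂ : Set Pt) (r : Pt)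
    (b : Bool) (N : (Pt → Dir) → (Pt → Dir) → Prop) : Prop where
  mem : ∀ h k, IsOppositeAt T₁ T₂ r b h k → N h k →
    R (wordEdges T₁ h) (wordEdges T₂ k) ∈ perfectMatchings A.graph
  inj : ∀ h k h' k', IsOppositeAt T₁ T₂ r b h k → IsOppositeAt T₁ T₂ r b h' k' → N h k → N h' k' →
    (R (wordEdges T₁ h) (wordEdges T₂ k) = R (wordEdges T₁ h') (wordEdges T₂ k') ↔
      Set.EqOn h h' S₁ ∧ Set.EqOn k k' S₂)
  surj : ∀ Q ∈ perfectMatchings A.graph, ∃ g g', IsWord S₁ g ∧ IsWord S₂ g' ∧ N g g' ∧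
    ∀ h k, IsOppositeAt T₁ T₂ r b h k → Set.EqOn h g S₁ → Set.EqOn k g' S₂ →
      R (wordEdges T₁ h) (wordEdges T₂ k) = Q

theorem isWord_empty (h : Pt → Dir) : IsWord ∅ h := fun _ _ hp => hp.elim

section EndModel

variable {A : Piece} {T₁ T₂ S : Set Pt} {r' : Pt} {x : Dir} {r : Pt} {b : Bool}
  {N : (Pt → Dir) → (Pt → Dir) → Prop}

/-- The case in which only the first graph continues beyond the overlap; the second contributes no
tiles on that side. -/
theorem ForcedPiece.endModel (F : ForcedPiece A T₁ S r' x) (hN : ∀ h k, N h k ↔ h r' = x) :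
    EndModel A (fun P₁ _ => P₁ ∩ A.edges) T₁ T₂ S ∅ r b N where
  mem h k w hn := F.mem h w.left ((hN h k).1 hn)
  inj h k h' k' w w' hn hn' := by
    rw [F.inj h h' w.left w'.left ((hN h k).1 hn) ((hN h' k').1 hn')]
    simp
  surj Q hQ := by
    obtain ⟨g, hg, hr, H⟩ := F.surj Q hQ
    exact ⟨g, g, hg, isWord_empty _, (hN g g).2 hr, fun h k w e _ => H h w.left e⟩

theorem ForcedPiece.endModel_bar (F : ForcedPiece A T₂ S r' x) (hN : ∀ h k, N h k ↔ k r' = x) :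
    EndModel A.bar (fun _ P₂ => barEdge '' P₂ ∩ A.bar.edges) T₁ T₂ ∅ S r b N where
  mem h k w hn := by
    rw [barEdge_image_inter_bar]
    exact (mem_perfectMatchings_bar F.not_isDiag).2 ⟨_, F.mem k w.right ((hN h k).1 hn), rfl⟩
  inj h k h' k' w w' hn hn' := by
    rw [barEdge_image_inter_bar, barEdge_image_inter_bar, image_barEdge_injective.eq_iff,
      F.inj k k' w.right w'.right ((hN h k).1 hn) ((hN h' k').1 hn')]
    simp
  surj Q hQ := by
    obtain ⟨P, hP, rfl⟩ := (mem_perfectMatchings_bar F.not_isDiag).1 hQ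
    obtain ⟨g, hg, hr, H⟩ := F.surj P hP
    refine ⟨g, g, isWord_empty _, hg, (hN g g).2 hr, fun h k w _ e => ?_⟩
    rw [barEdge_image_inter_bar, H k w.right e]

end EndModel

section Ends

variable {G H : SnakeGraph}

theorem openLeft_iff {s s' : ℕ} (h1 : 1 ≤ s) (h2 : s ≤ G.d) (h3 : 1 ≤ s') (h4 : s' ≤ H.d)
    (e : G.tile s = H.tile s') (h k : Pt → Dir) :
    OpenLeft G.tiles H.tiles (G.tile s) h k ↔
      (1 < s → h (G.tile (s - 1)) = G.dir (s - 1)) ∧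
      (1 < s' → k (H.tile (s' - 1)) = H.dir (s' - 1)) := by
  unfold OpenLeft
  rw [forall_and]
  refine and_congr ⟨fun H hs => ?_, fun H a ha => ?_⟩ ⟨fun H' hs => ?_, fun H' a ha => ?_⟩
  · rw [G.tile_pred hs h2]
    exact H _ ((G.tile_sub_step_mem h1 h2).2 ⟨hs, rfl⟩)
  · obtain ⟨hs, rfl⟩ := (G.tile_sub_step_mem h1 h2).1 ha
    rw [← G.tile_pred hs h2]
    exact H hs
  · rw [H.tile_pred hs h4, ← e]
    exact H' _ (by rw [e]; exact (H.tile_sub_step_mem h3 h4).2 ⟨hs, rfl⟩)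
  · rw [e] at ha ⊢
    obtain ⟨hs, rfl⟩ := (H.tile_sub_step_mem h3 h4).1 ha
    rw [← H.tile_pred hs h4]
    exact H' hs

theorem openRight_iff {t t' : ℕ} (h1 : 1 ≤ t) (h2 : t ≤ G.d) (h3 : 1 ≤ t') (h4 : t' ≤ H.d)
    (e : G.tile t = H.tile t') (h k : Pt → Dir) :
    OpenRight G.tiles H.tiles (G.tile t) h k ↔
      (t < G.d → h (G.tile (t + 1)) = G.dir t) ∧ (t' < H.d → k (H.tile (t' + 1)) = H.dir t') := by
  unfold OpenRight
  rw [forall_and]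
  refine and_congr ⟨fun H hs => ?_, fun H a ha => ?_⟩ ⟨fun H' hs => ?_, fun H' a ha => ?_⟩
  · rw [G.tile_succ h1 hs]
    exact H _ ((G.tile_add_step_mem h1 h2).2 ⟨hs, rfl⟩)
  · obtain ⟨hs, rfl⟩ := (G.tile_add_step_mem h1 h2).1 ha
    rw [← G.tile_succ h1 hs]
    exact H hs
  · rw [H.tile_succ h3 hs, ← e]
    exact H' _ (by rw [e]; exact (H.tile_add_step_mem h3 h4).2 ⟨hs, rfl⟩)
  · rw [e] at ha ⊢
    obtain ⟨hs, rfl⟩ := (H.tile_add_step_mem h3 h4).1 ha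
    rw [← H.tile_succ h3 hs]
    exact H' hs

theorem SnakeGraph.tilesOf_eq_empty (G : SnakeGraph) {i j : ℕ} (h : j < i) : G.tilesOf i j = ∅ := by
  ext p
  simp only [Set.mem_empty_iff_false, iff_false]
  rintro ⟨k, h1, h2, -⟩
  omega

/-- The piece `G_5` describes the parts of the words before the overlap. -/
theorem endModel_resFive {f₁ f₂ : Edge → ℤˣ} {s s' : ℕ} {b : Bool} {r₁ : Pt} (hf₁ : IsSign G f₁)
    (hf₂ : IsSign H f₂) (h1 : 1 ≤ s) (h2 : s ≤ G.d) (h3 : 1 ≤ s') (h4 : s' ≤ H.d)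
    (e : G.tile s = H.tile s') (X : CrossPattern G.tiles H.tiles (G.tile s) r₁ b) :
    EndModel (resFive G H f₁ f₂ s s') (restrictFive G H f₁ f₂ s s') G.tiles H.tiles
      (G.tilesOf 1 (s - 1)) (H.tilesOf 1 (s' - 1)) (G.tile s) b
      (fun h k => ¬ OpenLeft G.tiles H.tiles (G.tile s) h k) := by
  have hs : 1 < s ∨ 1 < s' := by
    obtain ⟨a, ha | ha⟩ := X.left
    · exact .inl ((G.tile_sub_step_mem h1 h2).1 ha).1
    · rw [e] at ha
      exact .inr ((H.tile_sub_step_mem h3 h4).1 ha).1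
  simp only [openLeft_iff h1 h2 h3 h4 e]
  have x₁ : 1 < s → pat b (G.tile s) = G.dir (s - 1) := fun hs =>
    X.left₁ _ ((G.tile_sub_step_mem h1 h2).2 ⟨hs, rfl⟩)
  have x₂ : 1 < s' → pat (!b) (G.tile s) = H.dir (s' - 1) := fun hs => by
    rw [pat_not, Dir.other_eq_iff]
    exact X.left₂ _ (by rw [e]; exact (H.tile_sub_step_mem h3 h4).2 ⟨hs, rfl⟩)
  by_cases hb : 1 < s ∧ 1 < s'
  · have y₁ := x₁ hb.1
    have y₂ := x₂ hb.2
    have hdir : H.dir (s' - 1) = (G.dir (s - 1)).other := by rw [← y₁, ← y₂, pat_not]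
    have hA := G.sub_tiles le_rfl (show 1 ≤ s - 1 by omega) (show s - 1 ≤ G.d by omega)
    have hB := H.sub_tiles le_rfl (show 1 ≤ s' - 1 by omega) (show s' - 1 ≤ H.d by omega)
    have hAl := G.sub_last le_rfl (show 1 ≤ s - 1 by omega) (show s - 1 ≤ G.d by omega)
    have hBl := H.sub_last le_rfl (show 1 ≤ s' - 1 by omega) (show s' - 1 ≤ H.d by omega)
    -- The tiles before the overlap lie in different directions. So the failure of openness is the
    -- adjacency condition at the gluing edge of `G_5`, where the second part is reflected.
    have hN : ∀ h k : Pt → Dir, ¬ ((1 < s → h (G.tile (s - 1)) = G.dir (s - 1)) ∧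
        (1 < s' → k (H.tile (s' - 1)) = H.dir (s' - 1))) ↔
        (h (G.sub 1 (s - 1)).last = (G.dir (s - 1)).other ∨
          k (H.sub 1 (s' - 1)).last ≠ (G.dir (s - 1)).other) := by
      intro h k
      rw [hAl, hBl, ← Dir.ne_iff, hdir]
      simp only [hb.1, hb.2, true_imp_iff]
      tauto
    -- The values at `G_s` are the directions from the preceding tiles, so restricting to the parts
    -- before the overlap loses no edge of the smaller matchings.
    have r : ∀ h k, IsOppositeAt G.tiles H.tiles (G.tile s) b h k →
        restrictFive G H f₁ f₂ s s' (wordEdges G.tiles h) (wordEdges H.tiles k) =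
          glueMatching (G.sub 1 (s - 1)) (G.dir (s - 1)).other (H.sub 1 (s' - 1)).bar
            (wordEdges (G.sub 1 (s - 1)).tiles h) (barEdge '' wordEdges (H.sub 1 (s' - 1)).tiles k) := by
      intro h k w
      rw [restrictFive, if_pos hb, hA, hB, G.wordEdges_inter_initial (by omega) (by omega),
        H.wordEdges_inter_initial (by omega) (by omega)]
      · intro _
        rw [show s' - 1 + 1 = s' by omega, ← e, w.right_eq, y₂]
      · intro _
        rw [show s - 1 + 1 = s by omega, w.left_eq, y₁]
    rw [resFive, if_pos hb]
    refine ⟨fun h k w hn => ?_, fun h k h' k' w w' hn hn' => ?_, fun Q hQ => ?_⟩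
    · rw [r h k w]
      refine mem_perfectMatchings_glue_bar_right.2 ⟨h, k, ?_, ?_, (hN h k).1 hn, rfl⟩
      · rw [hA]; exact w.left.mono (G.tilesOf_mono le_rfl (by omega))
      · rw [hB]; exact w.right.mono (H.tilesOf_mono le_rfl (by omega))
    · rw [r h k w, r h' k' w', glueMatching_bar_right_eq_iff, hA, hB]
    · obtain ⟨g, g', hg, hg', hc, rfl⟩ := mem_perfectMatchings_glue_bar_right.1 hQ
      refine ⟨g, g', by rwa [← hA], by rwa [← hB], (hN g g').2 hc, fun h k w e1 e2 => ?_⟩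
      rw [r h k w, hA, hB, wordEdges_congr e1, wordEdges_congr e2]
  · by_cases hs' : s' = 1
    · subst hs'
      have hs1 : 1 < s := by omega
      obtain ⟨b₁, hb₁⟩ := hf₁.exists_signPat (f₁ (G.inner (s - 1)))
      have F := initialPiece_forced hb₁ (n := s - 2) (by omega)
      -- With the sign of `e_{s-1}` as reference, the forced starting value at `G_{s-1}` is the one
      -- different from `G.dir (s - 1)`, as the failure of openness demands.
      rw [show s - 2 + 1 = s - 1 by omega, pat_not,
        (hb₁.inner (k := s - 1) (by omega) (by omega)).1 rfl] at F
      have M := F.endModel (T₂ := H.tiles) (r := G.tile s) (b := b)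
        (N := fun h k => ¬ ((1 < s → h (G.tile (s - 1)) = G.dir (s - 1)) ∧
          (1 < 1 → k (H.tile (1 - 1)) = H.dir (1 - 1)))) (fun h k => by
          rw [← Dir.ne_iff]; simp [hs1])
      rw [H.tilesOf_eq_empty (show 1 - 1 < 1 by omega)]
      have hR : resFive G H f₁ f₂ s 1 = initialPiece G f₁ (f₁ (G.inner (s - 1))) (s - 2) := by
        rw [resFive, if_neg hb, if_pos rfl]
      convert M using 1
      · funext P₁ P₂
        rw [restrictFive, if_neg hb, if_pos rfl, hR]
    · obtain rfl : s = 1 := by omega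
      have hs1 : 1 < s' := by omega
      obtain ⟨b₁, hb₁⟩ := hf₂.exists_signPat (f₂ (H.inner (s' - 1)))
      have F := initialPiece_forced hb₁ (n := s' - 2) (by omega)
      rw [show s' - 2 + 1 = s' - 1 by omega, pat_not,
        (hb₁.inner (k := s' - 1) (by omega) (by omega)).1 rfl] at F
      have M := F.endModel_bar (T₁ := G.tiles) (r := G.tile 1) (b := b)
        (N := fun h k => ¬ ((1 < 1 → h (G.tile (1 - 1)) = G.dir (1 - 1)) ∧
          (1 < s' → k (H.tile (s' - 1)) = H.dir (s' - 1)))) (fun h k => by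
          rw [← Dir.ne_iff]; simp [hs1])
      rw [G.tilesOf_eq_empty (show 1 - 1 < 1 by omega)]
      have hR : resFive G H f₁ f₂ 1 s' =
          (initialPiece H f₂ (f₂ (H.inner (s' - 1))) (s' - 2)).bar := by
        rw [resFive, if_neg hb, if_neg hs']
      convert M using 1
      · funext P₁ P₂
        rw [restrictFive, if_neg hb, if_neg hs', hR]

/-- The piece `G_6` describes the parts of the words after the overlap. -/
theorem endModel_resSix {f₁ f₂ : Edge → ℤˣ} {t t' : ℕ} {b : Bool} {r₀ : Pt} (hf₁ : IsSign G f₁)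
    (hf₂ : IsSign H f₂) (h1 : 1 ≤ t) (h2 : t ≤ G.d) (h3 : 1 ≤ t') (h4 : t' ≤ H.d)
    (e : G.tile t = H.tile t') (X : CrossPattern G.tiles H.tiles r₀ (G.tile t) b) :
    EndModel (resSix G H f₁ f₂ t t') (restrictSix G H f₁ f₂ t t') G.tiles H.tiles
      (G.tilesOf (t + 1) G.d) (H.tilesOf (t' + 1) H.d) (G.tile t) b
      (fun h k => ¬ OpenRight G.tiles H.tiles (G.tile t) h k) := by
  have ht : t < G.d ∨ t' < H.d := by
    obtain ⟨a, ha | ha⟩ := X.right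
    · exact .inl ((G.tile_add_step_mem h1 h2).1 ha).1
    · rw [e] at ha
      exact .inr ((H.tile_add_step_mem h3 h4).1 ha).1
  simp only [openRight_iff h1 h2 h3 h4 e]
  have x₁ : t < G.d → pat b (G.tile t) = G.dir t := fun ht =>
    X.right₁ _ ((G.tile_add_step_mem h1 h2).2 ⟨ht, rfl⟩)
  have x₂ : t' < H.d → pat (!b) (G.tile t) = H.dir t' := fun ht => by
    rw [pat_not, Dir.other_eq_iff]
    exact X.right₂ _ (by rw [e]; exact (H.tile_add_step_mem h3 h4).2 ⟨ht, rfl⟩)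
  by_cases hb : t < G.d ∧ t' < H.d
  · have y₁ := x₁ hb.1
    have y₂ := x₂ hb.2
    have hdir : H.dir t' = (G.dir t).other := by rw [← y₁, ← y₂, pat_not]
    have hA := H.sub_tiles (show 1 ≤ t' + 1 by omega) hb.2 le_rfl
    have hB := G.sub_tiles (show 1 ≤ t + 1 by omega) hb.1 le_rfl
    have hAb : (H.sub (t' + 1) H.d).base = H.tile (t' + 1) := rfl
    have hBb : (G.sub (t + 1) G.d).base = G.tile (t + 1) := rfl
    -- Here the reflected part from `H` comes first, and again the failure of openness is the
    -- adjacency condition at the gluing edge.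
    have hN : ∀ h k : Pt → Dir, ¬ ((t < G.d → h (G.tile (t + 1)) = G.dir t) ∧
        (t' < H.d → k (H.tile (t' + 1)) = H.dir t')) ↔
        (k (H.sub (t' + 1) H.d).base ≠ (G.dir t).other ∨
          h (G.sub (t + 1) G.d).base = (G.dir t).other) := by
      intro h k
      rw [hAb, hBb, ← Dir.ne_iff, hdir]
      simp only [hb.1, hb.2, true_imp_iff]
      tauto
    have r : ∀ h k, IsOppositeAt G.tiles H.tiles (G.tile t) b h k →
        restrictSix G H f₁ f₂ t t' (wordEdges G.tiles h) (wordEdges H.tiles k) =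
          glueMatching (H.sub (t' + 1) H.d).bar (G.dir t).other (G.sub (t + 1) G.d)
            (barEdge '' wordEdges (H.sub (t' + 1) H.d).tiles k)
            (wordEdges (G.sub (t + 1) G.d).tiles h) := by
      intro h k w
      rw [restrictSix, if_pos hb, hA, hB, G.wordEdges_inter_final h1,
        H.wordEdges_inter_final h3]
      · intro _
        rw [← e, w.right_eq, y₂]
      · intro _
        rw [w.left_eq, y₁]
    rw [resSix, if_pos hb]
    refine ⟨fun h k w hn => ?_, fun h k h' k' w w' hn hn' => ?_, fun Q hQ => ?_⟩
    · rw [r h k w]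
      refine mem_perfectMatchings_glue_bar_left.2 ⟨k, h, ?_, ?_, (hN h k).1 hn, rfl⟩
      · rw [hA]; exact w.right.mono (H.tilesOf_mono (by omega) le_rfl)
      · rw [hB]; exact w.left.mono (G.tilesOf_mono (by omega) le_rfl)
    · rw [r h k w, r h' k' w', glueMatching_bar_left_eq_iff, hA, hB, and_comm]
    · obtain ⟨g', g, hg', hg, hc, rfl⟩ := mem_perfectMatchings_glue_bar_left.1 hQ
      refine ⟨g, g', by rwa [← hB], by rwa [← hA], (hN g g').2 hc, fun h k w e1 e2 => ?_⟩
      rw [r h k w, hA, hB, wordEdges_congr e1, wordEdges_congr e2]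
  · by_cases ht' : t = G.d
    · subst ht'
      have ht1 : t' < H.d := by omega
      obtain ⟨b₁, hb₁⟩ := hf₂.exists_signPat (f₂ (H.inner t'))
      have F := finalPiece_forced hb₁ (n := t' + 1) (by omega) (by omega)
      rw [Dir.ne_iff.1 ((hb₁.inner_succ h3 ht1).1 rfl)] at F
      have M := F.endModel_bar (T₁ := G.tiles) (r := G.tile G.d) (b := b)
        (N := fun h k => ¬ ((G.d < G.d → h (G.tile (G.d + 1)) = G.dir G.d) ∧
          (t' < H.d → k (H.tile (t' + 1)) = H.dir t'))) (fun h k => by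
          rw [← Dir.ne_iff]; simp [ht1])
      rw [G.tilesOf_eq_empty (show G.d < G.d + 1 by omega)]
      have hR : resSix G H f₁ f₂ G.d t' =
          (finalPiece H f₂ (f₂ (H.inner t')) (t' + 1)).bar := by
        rw [resSix, if_neg hb, if_pos rfl]
      convert M using 1
      · funext P₁ P₂
        rw [restrictSix, if_neg hb, if_pos rfl, hR]
    · have ht1 : t < G.d := by omega
      obtain rfl : t' = H.d := by omega
      obtain ⟨b₁, hb₁⟩ := hf₁.exists_signPat (f₁ (G.inner t))
      have F := finalPiece_forced hb₁ (n := t + 1) (by omega) (by omega)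
      rw [Dir.ne_iff.1 ((hb₁.inner_succ h1 ht1).1 rfl)] at F
      have M := F.endModel (T₂ := H.tiles) (r := G.tile t) (b := b)
        (N := fun h k => ¬ ((t < G.d → h (G.tile (t + 1)) = G.dir t) ∧
          (H.d < H.d → k (H.tile (H.d + 1)) = H.dir H.d))) (fun h k => by
          rw [← Dir.ne_iff]; simp [ht1])
      rw [H.tilesOf_eq_empty (show H.d < H.d + 1 by omega)]
      have hR : resSix G H f₁ f₂ t H.d = finalPiece G f₁ (f₁ (G.inner t)) (t + 1) := by
        rw [resSix, if_neg hb, if_neg ht']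
      convert M using 1
      · funext P₁ P₂
        rw [restrictSix, if_neg hb, if_neg ht', hR]

end Ends

/-! ### Joining words before, in, and after an overlap -/

/-- The word that follows `g` before the overlap, the pattern in it, and `g'` after it. -/
noncomputable def joinWord (r₀ r₁ : Pt) (b : Bool) (g g' : Pt → Dir) : Pt → Dir := fun p =>
  if lev p < lev r₀ then g p else if lev p ≤ lev r₁ then pat b p else g' p

section Join

variable {T : Set Pt} {r₀ r₁ : Pt} {b : Bool} {g g' : Pt → Dir}

theorem joinWord_of_lt {p : Pt} (h : lev p < lev r₀) : joinWord r₀ r₁ b g g' p = g p := if_pos h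

theorem joinWord_of_mem {p : Pt} (h : lev r₀ ≤ lev p) (h' : lev p ≤ lev r₁) :
    joinWord r₀ r₁ b g g' p = pat b p := by
  rw [joinWord, if_neg h.not_gt, if_pos h']

theorem joinWord_of_gt {p : Pt} (h : lev r₀ ≤ lev r₁) (h' : lev r₁ < lev p) :
    joinWord r₀ r₁ b g g' p = g' p := by
  rw [joinWord, if_neg (by omega), if_neg h'.not_ge]

/-- At both ends the pattern itself meets the adjacency condition, so it imposes nothing on the
parts outside of the overlap. -/
theorem isWord_joinWord (hT : IsThin T) (h0 : r₀ ∈ T) (h1 : r₁ ∈ T) (hle : lev r₀ ≤ lev r₁)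
    (hg : IsWord {p ∈ T | lev p < lev r₀} g) (hg' : IsWord {p ∈ T | lev r₁ < lev p} g')
    (hl : ∀ a, r₀ - Dir.step a ∈ T → pat b r₀ = a) (hr : ∀ a, r₁ + Dir.step a ∈ T → pat b r₁ = a) :
    IsWord T (joinWord r₀ r₁ b g g') := by
  intro p a hp hpa
  have hlev : lev (p + a.step) = lev p + 1 := lev_add_step p a
  rcases lt_trichotomy (lev p + 1) (lev r₀) with c | c | c
  · rw [joinWord_of_lt (by omega), joinWord_of_lt (by omega)]
    exact hg p a ⟨hp, by omega⟩ ⟨hpa, by omega⟩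
  · obtain h := hT _ hpa _ h0 (by omega)
    rw [h, joinWord_of_mem (p := r₀) le_rfl hle]
    exact .inr (hl a (by rw [← h]; simpa using hp))
  · rcases lt_trichotomy (lev p) (lev r₁) with c' | c' | c'
    · rw [joinWord_of_mem (by omega) (by omega), joinWord_of_mem (by omega) (by omega)]
      exact isWord_pat b T p a hp hpa
    · obtain rfl := hT _ hp _ h1 c'
      rw [joinWord_of_mem (by omega) le_rfl]
      exact .inl (hr a hpa)
    · rw [joinWord_of_gt hle c', joinWord_of_gt hle (by omega)]
      exact hg' p a ⟨hp, c'⟩ ⟨hpa, by omega⟩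

end Join

/-! ### Resolutions of crossings -/

theorem onEdge_image_preimage_wordEdges {m : Motion} {G : SnakeGraph} {k : Pt → Dir}
    (hk : IsWord (m.onSnake G).tiles k) :
    m.onEdge '' (m.onEdge ⁻¹' wordEdges (m.onSnake G).tiles k) =
      wordEdges (m.onSnake G).tiles k := by
  obtain ⟨P, -, hP⟩ := exists_onEdge_image_eq (mem_perfectMatchings_snake.2 ⟨k, hk, rfl⟩)
  rw [← hP, Set.preimage_image_eq _ m.onEdge_injective]

/-- The second matching is described by a word on the moved graph, in which the overlap is visible.
-/
theorem mem_perfectMatchings_disjointUnion_onSnake {m : Motion} {G₁ G₂ : SnakeGraph}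
    {P : Set (Sym2 (Pt ⊕ Pt))} :
    P ∈ perfectMatchings (disjointUnion (.snake G₁) (.snake G₂)) ↔
      ∃ w : (Pt → Dir) × (Pt → Dir), (IsWord G₁.tiles w.1 ∧ IsWord (m.onSnake G₂).tiles w.2) ∧
        unionPart (wordEdges G₁.tiles w.1) (m.onEdge ⁻¹' wordEdges (m.onSnake G₂).tiles w.2) = P := by
  rw [disjointUnion, mem_perfectMatchings_sum]
  constructor
  · rintro ⟨P₁, hP₁, P₂, hP₂, rfl⟩
    obtain ⟨h, hh, rfl⟩ := mem_perfectMatchings_snake.1 hP₁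
    obtain ⟨k, hk, hkP⟩ := mem_perfectMatchings_snake.1 (mem_perfectMatchings_onSnake (m := m).2 hP₂)
    refine ⟨(h, k), ⟨hh, hk⟩, ?_⟩
    simp only
    rw [hkP, Set.preimage_image_eq _ m.onEdge_injective]
  · rintro ⟨⟨h, k⟩, ⟨hh, hk⟩, rfl⟩
    refine ⟨_, mem_perfectMatchings_snake.2 ⟨h, hh, rfl⟩, _, ?_, rfl⟩
    rw [← mem_perfectMatchings_onSnake (m := m), onEdge_image_preimage_wordEdges hk]
    exact mem_perfectMatchings_snake.2 ⟨k, hk, rfl⟩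

/-- The case distinction `K` is whether a cut exists. If so, the tails are exchanged at the first
one; if not, the pair consists of the fixed patterns on the overlap and of independent parts before
and after it, which are the matchings of `G_5` and `G_6`. -/
theorem exists_crossing_equiv {G₁ G₂ : SnakeGraph} {m : Motion} {s t s' t' : ℕ} {f₁ f₂ : Edge → ℤˣ}
    (hO : IsOverlap G₁ (m.onSnake G₂) s t s' t') (hf₁ : IsSign G₁ f₁)
    (hf₂ : IsSign (m.onSnake G₂) f₂) (hf : ∀ e ∈ G₁.edgesOf s t, f₁ e = f₂ e)
    (hX : Crosses G₁ (m.onSnake G₂) f₁ f₂ s t s' t') :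
    ∃ φ : perfectMatchings (disjointUnion (.snake G₁) (.snake G₂)) ≃ MatchingsOf
        [disjointUnion (.snake (switchGraph G₁ (m.onSnake G₂) t t'))
            (.snake (switchGraph (m.onSnake G₂) G₁ t' t)),
          disjointUnion (resFive G₁ (m.onSnake G₂) f₁ f₂ s s')
            (resSix G₁ (m.onSnake G₂) f₁ f₂ t t')],
      ∀ P, CrossingRule G₁ (m.onSnake G₂) f₁ f₂ s t s' t' (fstPart P.1) (m.onEdge '' sndPart P.1)
        (φ P).1 (fstPart (φ P).2.1) (sndPart (φ P).2.1) := by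
  set H := m.onSnake G₂
  obtain ⟨b, X⟩ := hX.exists_crossPattern hO hf₁ hf₂ hf
  have O := hO.overlapping
  obtain ⟨e₃, e₄⟩ := hO.switchGraph_tiles
  obtain ⟨h1, h2, h3, h4, h5, h6, h7, h8⟩ := hO.1
  have es : G₁.tile s = H.tile s' := hO.1.tile_eq le_rfl h2 (by omega)
  have et : G₁.tile t = H.tile t' := hO.1.tile_eq h2 le_rfl (by omega)
  have M₅ := endModel_resFive hf₁ hf₂ h1 (by omega) h4 (by omega) es X
  have M₆ := endModel_resSix hf₁ hf₂ (by omega) h3 (by omega) h6 et X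
  rw [← G₁.tiles_lt_eq h1 (by omega), ← H.tiles_lt_eq h4 (by omega), ← es] at M₅
  rw [← G₁.tiles_gt_eq (by omega) h3, ← H.tiles_gt_eq (by omega) h6, ← et] at M₆
  set T₁ := G₁.tiles
  set T₂ := H.tiles
  set r₀ := G₁.tile s
  set r₁ := G₁.tile t
  have hle := O.le
  let C : (Pt → Dir) × (Pt → Dir) → Prop := fun w => IsWord T₁ w.1 ∧ IsWord T₂ w.2
  let K : (Pt → Dir) × (Pt → Dir) → Prop := fun w => CanSwap T₁ T₂ r₀ r₁ w.1 w.2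
  let c : (Pt → Dir) × (Pt → Dir) → ℤ := fun w => firstCut T₁ T₂ r₀ r₁ w.1 w.2
  let q₀ : (Pt → Dir) × (Pt → Dir) → Set (Sym2 (Pt ⊕ Pt)) := fun w =>
    unionPart (wordEdges (swapTiles (lev r₁) T₁ T₂) (swapWord (c w) w.1 w.2))
      (wordEdges (swapTiles (lev r₁) T₂ T₁) (swapWord (c w) w.2 w.1))
  let q₁ : (Pt → Dir) × (Pt → Dir) → Set (Sym2 (Pt ⊕ Pt)) := fun w =>
    unionPart (restrictFive G₁ H f₁ f₂ s s' (wordEdges T₁ w.1) (wordEdges T₂ w.2))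
      (restrictSix G₁ H f₁ f₂ t t' (wordEdges T₁ w.1) (wordEdges T₂ w.2))
  have hpeq : ∀ w w' : (Pt → Dir) × (Pt → Dir), C w → C w' →
      (unionPart (wordEdges T₁ w.1) (m.onEdge ⁻¹' wordEdges T₂ w.2) =
        unionPart (wordEdges T₁ w'.1) (m.onEdge ⁻¹' wordEdges T₂ w'.2) ↔
      Set.EqOn w.1 w'.1 T₁ ∧ Set.EqOn w.2 w'.2 T₂) := by
    intro w w' hw hw'
    rw [unionPart_inj, G₁.wordEdges_eq_iff, ← H.wordEdges_eq_iff]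
    refine and_congr_right fun _ => ⟨fun h => ?_, fun h => by rw [h]⟩
    have := congrArg (Set.image m.onEdge) h
    rwa [onEdge_image_preimage_wordEdges hw.2, onEdge_image_preimage_wordEdges hw'.2] at this
  have hnot : ∀ w, C w → (¬ K w ↔
      (∀ p ∈ T₁, lev r₀ ≤ lev p → lev p ≤ lev r₁ → w.1 p = pat b p ∧ w.2 p = (pat b p).other) ∧
        ¬ OpenLeft T₁ T₂ r₀ w.1 w.2 ∧ ¬ OpenRight T₁ T₂ r₁ w.1 w.2) := fun w hw =>
    O.not_canSwap_iff X hw.1 hw.2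
  have hopp : ∀ w, C w → ¬ K w → IsOppositeAt T₁ T₂ r₀ b w.1 w.2 ∧
      IsOppositeAt T₁ T₂ r₁ b w.1 w.2 := by
    intro w hw hk
    have := ((hnot w hw).1 hk).1
    obtain ⟨g1, g2⟩ := this r₀ O.mem₀ le_rfl hle
    obtain ⟨g3, g4⟩ := this r₁ O.mem₁ hle le_rfl
    exact ⟨⟨hw.1, hw.2, g1, by rw [g2, pat_not]⟩, ⟨hw.1, hw.2, g3, by rw [g4, pat_not]⟩⟩
  refine Exists.elim (exists_equiv_matchingsOf (C := C) (K := K)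
    (p := fun w => unionPart (wordEdges T₁ w.1) (m.onEdge ⁻¹' wordEdges T₂ w.2)) (q₀ := q₀) (q₁ := q₁)
    (A := disjointUnion (.snake (switchGraph G₁ H t t')) (.snake (switchGraph H G₁ t' t)))
    (B := disjointUnion (resFive G₁ H f₁ f₂ s s') (resSix G₁ H f₁ f₂ t t'))
    (fun P => mem_perfectMatchings_disjointUnion_onSnake) ?_ ?_ ?_ ?_ ?_) fun φ hφ => ?_
  rotate_left 5
  · refine ⟨φ, fun P => ?_⟩
    obtain ⟨w, hw, hwP, hr⟩ := hφ P
    rw [← hwP, fstPart_unionPart, sndPart_unionPart, onEdge_image_preimage_wordEdges hw.2]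
    rcases hr with ⟨hk, e1, e2⟩ | ⟨hk, e1, e2⟩
    · refine .inl ⟨e1, ?_⟩
      rw [(congrArg fstPart e2).trans (fstPart_unionPart _ _),
        (congrArg sndPart e2).trans (sndPart_unionPart _ _)]
      exact hO.exists_first_switch hw.1 hw.2 hk.isFirstCut
    · refine .inr ⟨e1, fun i hi => hO.not_canSwitch hw.1 hw.2 hk hi, ?_, ?_⟩
      · exact (congrArg fstPart e2).trans (fstPart_unionPart _ _)
      · exact (congrArg sndPart e2).trans (sndPart_unionPart _ _)
  · intro Q
    rw [disjointUnion, mem_perfectMatchings_sum]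
    constructor
    · rintro ⟨Q₃, hQ₃, Q₄, hQ₄, rfl⟩
      obtain ⟨q, hq, rfl⟩ := mem_perfectMatchings_snake.1 hQ₃
      obtain ⟨q', hq', rfl⟩ := mem_perfectMatchings_snake.1 hQ₄
      rw [e₃] at hq ⊢
      rw [e₄] at hq' ⊢
      obtain ⟨h, k, x, hh, hk, hx, rfl, rfl⟩ := O.exists_firstCut_swap X hq hq'
      refine ⟨(h, k), ⟨hh, hk⟩, hx.canSwap, ?_⟩
      simp only [q₀, c]
      rw [hx.firstCut_eq]
    · rintro ⟨w, hC, hK, rfl⟩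
      obtain ⟨g0, g1, hs, -⟩ := hK.isFirstCut
      have t1 := O.swapTiles_eq (c' := lev r₁) g0 g1 (by omega) le_rfl
      have t2 := O.symm.swapTiles_eq (c' := lev r₁) g0 g1 (by omega) le_rfl
      refine ⟨_, mem_perfectMatchings_snake.2 ⟨_, ?_, by rw [e₃]⟩, _,
        mem_perfectMatchings_snake.2 ⟨_, ?_, by rw [e₄]⟩, rfl⟩
      · rw [e₃, ← t1]; exact hs.1
      · rw [e₄, ← t2]; exact hs.2
  · intro Q
    rw [disjointUnion, mem_perfectMatchings_sum]
    constructor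
    · rintro ⟨Q₅, hQ₅, Q₆, hQ₆, rfl⟩
      obtain ⟨g₁, g₂, hg₁, hg₂, hL, HL⟩ := M₅.surj Q₅ hQ₅
      obtain ⟨g₁', g₂', hg₁', hg₂', hR, HR⟩ := M₆.surj Q₆ hQ₆
      -- The preimage of a pair of matchings has the pattern on the overlap for the first word and
      -- the opposite pattern for the second.
      have hh : IsWord T₁ (joinWord r₀ r₁ b g₁ g₁') :=
        isWord_joinWord O.thin₁ O.mem₀ O.mem₁ hle hg₁ hg₁' X.left₁ X.right₁
      have hk : IsWord T₂ (joinWord r₀ r₁ (!b) g₂ g₂') := by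
        refine isWord_joinWord O.thin₂ O.symm.mem₀ O.symm.mem₁ hle hg₂ hg₂' (fun a ha => ?_)
          (fun a ha => ?_)
        · rw [pat_not, Dir.other_eq_iff]; exact X.left₂ a ha
        · rw [pat_not, Dir.other_eq_iff]; exact X.right₂ a ha
      have hC : C (joinWord r₀ r₁ b g₁ g₁', joinWord r₀ r₁ (!b) g₂ g₂') := ⟨hh, hk⟩
      have hK : ¬ K (joinWord r₀ r₁ b g₁ g₁', joinWord r₀ r₁ (!b) g₂ g₂') := by
        refine (hnot _ hC).2 ⟨fun p _ hp hp' => ?_, ?_, ?_⟩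
        · simp only
          rw [joinWord_of_mem hp hp', joinWord_of_mem hp hp', pat_not]
          exact ⟨rfl, rfl⟩
        · have : ∀ a : Dir, lev (r₀ - a.step) < lev r₀ := fun a => by simp
          simpa only [OpenLeft, joinWord_of_lt (this _)] using hL
        · have : ∀ a : Dir, lev r₁ < lev (r₁ + a.step) := fun a => by simp
          simpa only [OpenRight, joinWord_of_gt hle (this _)] using hR
      obtain ⟨o₀, o₁⟩ := hopp _ hC hK
      refine ⟨_, hC, hK, ?_⟩
      simp only [q₁]
      rw [HL _ _ o₀ (fun p hp => joinWord_of_lt hp.2) (fun p hp => joinWord_of_lt hp.2),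
        HR _ _ o₁ (fun p hp => joinWord_of_gt hle hp.2) (fun p hp => joinWord_of_gt hle hp.2)]
    · rintro ⟨w, hC, hK, rfl⟩
      obtain ⟨-, hL, hR⟩ := (hnot w hC).1 hK
      obtain ⟨o₀, o₁⟩ := hopp w hC hK
      exact ⟨_, M₅.mem _ _ o₀ hL, _, M₆.mem _ _ o₁ hR, rfl⟩
  · intro w w' hC hC' hK hK'
    simp only [q₀]
    rw [hpeq w w' hC hC', unionPart_inj]
    constructor
    · rintro ⟨g1, g2⟩
      -- The first cut depends only on the values of the words on their tiles, so equal matchings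
      -- are cut at the same place.
      have hc : c w = c w' := (IsFirstCut.congr g1 g2 hK.isFirstCut).unique hK'.isFirstCut
      obtain ⟨c0, c1, -, -⟩ := hK.isFirstCut
      have t1 := O.swapTiles_eq (c' := lev r₁) c0 c1 (by omega) le_rfl
      have t2 := O.symm.swapTiles_eq (c' := lev r₁) c0 c1 (by omega) le_rfl
      rw [← hc, ← t1, ← t2]
      exact ⟨wordEdges_congr (swapWord_eqOn g1 g2 _), wordEdges_congr (swapWord_eqOn g2 g1 _)⟩
    · rintro ⟨g1, g2⟩
      exact O.eqOn_of_swap_eqOn hC.1 hC.2 hC'.1 hC'.2 hK.isFirstCut hK'.isFirstCut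
        (eqOn_of_wordEdges_eq (O.thin_swap _) g1) (eqOn_of_wordEdges_eq (O.symm.thin_swap _) g2)
  · intro w w' hC hC' hK hK'
    obtain ⟨hm, hL, hR⟩ := (hnot w hC).1 hK
    obtain ⟨o₀, o₁⟩ := hopp w hC hK
    obtain ⟨hm', hL', hR'⟩ := (hnot w' hC').1 hK'
    obtain ⟨o₀', o₁'⟩ := hopp w' hC' hK'
    simp only [q₁]
    rw [hpeq w w' hC hC', unionPart_inj, M₅.inj _ _ _ _ o₀ o₀' hL hL',
      M₆.inj _ _ _ _ o₁ o₁' hR hR']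
    constructor
    · rintro ⟨g1, g2⟩
      exact ⟨⟨g1.mono (Set.sep_subset _ _), g2.mono (Set.sep_subset _ _)⟩,
        ⟨g1.mono (Set.sep_subset _ _), g2.mono (Set.sep_subset _ _)⟩⟩
    · rintro ⟨⟨g1, g2⟩, g3, g4⟩
      refine ⟨fun p hp => ?_, fun p hp => ?_⟩
      · rcases lt_or_ge (lev p) (lev r₀) with c0 | c0
        · exact g1 ⟨hp, c0⟩
        · rcases le_or_gt (lev p) (lev r₁) with c1 | c1
          · rw [(hm p hp c0 c1).1, (hm' p hp c0 c1).1]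
          · exact g3 ⟨hp, c1⟩
      · rcases lt_or_ge (lev p) (lev r₀) with c0 | c0
        · exact g2 ⟨hp, c0⟩
        · rcases le_or_gt (lev p) (lev r₁) with c1 | c1
          · have hp' := (O.agree p c0 c1).2 hp
            rw [(hm p hp' c0 c1).2, (hm' p hp' c0 c1).2]
          · exact g4 ⟨hp, c1⟩
  · intro w w' hC hC' e hk
    obtain ⟨g1, g2⟩ := (hpeq w w' hC hC').1 e
    obtain ⟨x, x0, x1, hs⟩ := hk
    exact ⟨x, x0, x1, hs.congr g1 g2⟩

theorem exists_resolution_equiv {G₁ G₂ : SnakeGraph} {m : Motion} {s t s' t' : ℕ}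
    {f₁ f₂ : Edge → ℤˣ} (hO : IsOverlap G₁ (m.onSnake G₂) s t s' t') (hf₁ : IsSign G₁ f₁)
    (hf₂ : IsSign (m.onSnake G₂) f₂) (hf : ∀ e ∈ G₁.edgesOf s t, f₁ e = f₂ e) :
    ∃ φ : perfectMatchings (disjointUnion (.snake G₁) (.snake G₂)) ≃
        MatchingsOf (resolution G₁ G₂ m f₁ f₂ s t s' t'),
      ∀ P, ResolutionRule G₁ G₂ m f₁ f₂ s t s' t' P.1 (φ P).1 (φ P).2.1 := by
  unfold ResolutionRule
  by_cases hX : Crosses G₁ (m.onSnake G₂) f₁ f₂ s t s' t'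
  · have e : resolution G₁ G₂ m f₁ f₂ s t s' t' = _ := if_pos hX
    rw [e]
    obtain ⟨φ, hφ⟩ := exists_crossing_equiv hO hf₁ hf₂ hf hX
    exact ⟨φ, fun P => ⟨fun _ => hφ P, fun h => absurd hX h⟩⟩
  · have e : resolution G₁ G₂ m f₁ f₂ s t s' t' = _ := if_neg hX
    rw [e]
    let D := disjointUnion (.snake G₁) (.snake G₂)
    let φ : perfectMatchings D → MatchingsOf [D] := fun P => ⟨(0 : Fin 1), P⟩
    have hφ : Function.Bijective φ := by
      constructor
      · intro P P' h
        exact eq_of_heq (Sigma.mk.inj h).2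
      · rintro ⟨i, Q⟩
        change Fin 1 at i
        obtain rfl : i = 0 := Subsingleton.elim _ _
        exact ⟨Q, rfl⟩
    exact ⟨Equiv.ofBijective φ hφ, fun P => ⟨fun h => absurd h hX, fun _ => rfl⟩⟩

end SnakeCalculus

theorem theorem3p1 (G₁ G₂ : SnakeGraph) :
    (∀ (m : Motion) (s t s' t' : ℕ) (f₁ f₂ : Edge → ℤˣ),
      IsOverlap G₁ (m.onSnake G₂) s t s' t' →
      IsSign G₁ f₁ → IsSign (m.onSnake G₂) f₂ →
      (∀ e ∈ G₁.edgesOf s t, f₁ e = f₂ e) →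
      ∃ φ : perfectMatchings (disjointUnion (.snake G₁) (.snake G₂)) ≃
          MatchingsOf (resolution G₁ G₂ m f₁ f₂ s t s' t'),
        ∀ P, ResolutionRule G₁ G₂ m f₁ f₂ s t s' t' P.1 (φ P).1 (φ P).2.1) ∧
    (∀ (s : ℕ) (f₁ : Edge → ℤˣ), 1 ≤ s → s < G₁.d → IsSign G₁ f₁ →
      ∃ φ : perfectMatchings (disjointUnion (.snake G₁) (.snake G₂)) ≃
          MatchingsOf (graft G₁ G₂ f₁ s),
        ∀ P, GraftRule G₁ G₂ f₁ s (fstPart P.1) (sndPart P.1)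
          (φ P).1 (fstPart (φ P).2.1) (sndPart (φ P).2.1)) ∧
    (∀ (a : Dir) (f₁ f₂ : Edge → ℤˣ), IsSign G₁ f₁ → IsSign G₂ f₂ →
      f₂ (sideIn (G₂.tile 1) a) = f₁ (sideOut G₁.last a) →
      ∃ φ : perfectMatchings (disjointUnion (.snake G₁) (.snake G₂)) ≃
          MatchingsOf (graftLast G₁ G₂ f₁ f₂ a),
        ∀ P, GraftLastRule G₁ G₂ f₁ f₂ a (fstPart P.1) (sndPart P.1)
          (φ P).1 (fstPart (φ P).2.1) (sndPart (φ P).2.1)) := by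
  refine ⟨fun m s t s' t' f₁ f₂ hO hf₁ hf₂ hf => ?_, fun s f₁ h1 hs hf => ?_,
    fun a f₁ f₂ hf₁ hf₂ hf => ?_⟩
  · exact exists_resolution_equiv hO hf₁ hf₂ hf
  · exact exists_graft_equiv G₁ G₂ s f₁ h1 hs hf
  · exact exists_graftLast_equiv G₁ G₂ a f₁ f₂ hf₁ hf₂ hf
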